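/- Let $p_1,p_2,p_3$ be the vertices of a regular triangle in $\mathbb R^2$ with $p_1+p_2+p_3=0$ and side length $1$, let $\alpha\in(0,1)$, $S=\{1,2,3\}$, $B=\{(1,2),(2,3),(3,1)\}$, $G_i(x)=\frac{1-\alpha}{2}(x-p_i)+p_i$, $p_{ij}=G_i(p_j)$, and let $e_{ij}$ be the segment $p_{ij}p_{ji}$. Let $K$ be the stretched Sierpinski gasket, i.e. the unique compact set with $K=\bigcup_{i\in S} G_i(K)\cup e_{12}\cup e_{23}\cup e_{31}$. For a word $w=w_1\cdots w_m\in W_m=S^m$ put $G_w=G_{w_1}\circ\cdots\circ G_{w_m}$ and $e^w_{ij}=G_w(e_{ij})$. Let $\widetilde{\mathcal F}$ be the set of $u\in C(K)$ with $u|_{e^w_{ij}}\in H^1(e^w_{ij})$ for all words $w$ and all $(i,j)\in B$. For $u,v\in\widetilde{\mathcal F}$ and $m\ge1$ let $\mathcal D^I_m(u,v)=\sum_{w\in W_{m-1},(i,j)\in B}\int_0^1 (u\circ\xi)'(v\circ\xi)'\,dx$, where $\xi(t)=(1-t)G_w(p_{ij})+tG_w(p_{ji})$; and let $Q_0^\Sigma(u,v)=\sum_{(i,j)\in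 B}(u(p_i)-u(p_j))(v(p_i)-v(p_j))$, $Q^\Sigma_m(u,v)=\sum_{w\in W_m}Q_0^\Sigma(u\circ G_w,v\circ G_w)$. Let $\mathcal R=\{(r_m,\rho_m)\}_{m\ge1}$ be a sequence of matching pairs: $r_m,\rho_m>0$ and $\frac53r_m+\rho_m=1$ for all $m\ge 1$. Put $\delta_m=r_1\cdots r_m$, $\gamma_m=\delta_{m-1}\rho_m$ and $$\mathcal E_{\mathcal R,m}(u,v)=\frac1{\delta_m}Q^\Sigma_m(u,v)+\sum_{k=1}^m\frac1{\gamma_k}\mathcal D^I_k(u,v).$$ Let $\mathcal F_{\mathcal R}$ be the set of $u\in\widetilde{\mathcal F}$ for which the (non-decreasing) sequence $\mathcal E_{\mathcal R,m}(u,u)$ has a finite limit, and let $\mathcal E_{\mathcal R}(u,v)=\lim_m\mathcal E_{\mathcal R,m}(u,v)$ for $u,v\in\mathcal F_{\mathcal R}$. The line part of $\mathcal E_{\mathcal R}$ is $\mathcal E^I_{\mathcal R}(u,v)=\sum_{k\ge1}\frac1{\gamma_k}\mathcal D^I_k(u,v)$, the SG part is $\mathcal E^\Sigma_{\mathcal R}=\mathcal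 E_{\mathcal R}-\mathcal E^I_{\mathcal R}$, and $\mathcal F^I_{\mathcal R}=\{u\in\mathcal F_{\mathcal R}:\mathcal E^\Sigma_{\mathcal R}(u,u)=0\}$. Let $\mathcal{RF}^{(0)}_S$ be the class of resistance forms $(\mathcal E,\mathcal F)$ on $K$ such that (a) $\mathcal F\subseteq C(K)$, and $u\in\mathcal F$ if and only if $u|_{G_i(K)}\in\mathcal F|_{G_i(K)}$ for all $i\in S$ and $u|_{e_{ij}}\in H^1(e_{ij})$ for all $(i,j)\in B$; (b) the identity map from $K$ with the Euclidean metric to $K$ with the resistance metric is a homeomorphism; (c) $u\circ\varphi\in\mathcal F$ and $\mathcal E(u\circ\varphi,u\circ\varphi)=\mathcal E(u,u)$ for every $u\in\mathcal F$ and every linear $\varphi:\mathbb R^2\to\mathbb R^2$ with $\varphi(K)=K$. For $(\mathcal E,\mathcal F)\in\mathcal{RF}^{(0)}_S$ the normalizing constant $r_0(\mathcal E,\mathcal F)$ is the number $r_0>0$ for which the trace of $(\mathcal E,\mathcal F)$ on $\{p_1,p_2,p_3\}$ equals $\frac1{r_0}Q^\Sigma_0$. **Proposition.** For every sequence $\mathcal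 R=\{(r_m,\rho_m)\}_{m\ge1}$ of matching pairs, $(\mathcal E^I_{\mathcal R},\mathcal F^I_{\mathcal R})$ belongs to $\mathcal{RF}^{(0)}_S$, the constant $r_0(\mathcal E^I_{\mathcal R},\mathcal F^I_{\mathcal R})$ exists, the product and the series below converge (the product possibly to $0$), and $$r_0(\mathcal E^I_{\mathcal R},\mathcal F^I_{\mathcal R})=1-\prod_{m=1}^\infty(1-\rho_m)=\sum_{m=1}^\infty\Big(\rho_m\prod_{i=1}^{m-1}(1-\rho_i)\Big).$$ In particular, $r_0(\mathcal E^I_{\mathcal R},\mathcal F^I_{\mathcal R})<1$ if and only if $\sum_{m=1}^\infty\rho_m<\infty$. -/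

import Mathlib

open Set Filter Topology MeasureTheory
open scoped ContDiff

/-- The Euclidean plane. -/
abbrev Plane : Type := EuclideanSpace ℝ (Fin 2)

/-! ## The stretched Sierpinski gasket -/

/-- Parameters of the construction: the vertices `p 0, p 1, p 2` of a regular triangle with
barycentre `0` and side length `1`, and a stretching parameter `α ∈ (0, 1)`. -/
structure SSGSetup where
  p : Fin 3 → Plane
  sum_p : p 0 + p 1 + p 2 = 0
  dist_p : ∀ i j, i ≠ j → dist (p i) (p j) = 1
  α : ℝ
  α_pos : 0 < α
  α_lt_one : α < 1

namespace SSGSetup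

/-- The similitude `G_i(x) = (1 - α)/2 (x - p_i) + p_i`. -/
noncomputable def G (D : SSGSetup) (i : Fin 3) (x : Plane) : Plane :=
  ((1 - D.α) / 2) • (x - D.p i) + D.p i

/-- `G_w = G_{w_1} ∘ ⋯ ∘ G_{w_m}` for a finite word `w`, with `G_∅ = id`. -/
noncomputable def wordMap (D : SSGSetup) : List (Fin 3) → Plane → Plane
  | [] => id
  | i :: w => D.G i ∘ D.wordMap w

/-- The parametrisation `t ↦ (1 - t) p_{ij} + t p_{ji}` of the segment `e_{ij}`, where
`p_{ij} = G_i(p_j)` and `(i, j) = (b, b + 1)`. As `b` runs through `Fin 3`, the pair `(b, b + 1)`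
runs through the set of bonds `(0, 1), (1, 2), (2, 0)`. -/
noncomputable def bondPath (D : SSGSetup) (b : Fin 3) (t : ℝ) : Plane :=
  (1 - t) • D.G b (D.p (b + 1)) + t • D.G (b + 1) (D.p b)

/-- The segment `e_{ij}` with `(i, j) = (b, b + 1)`. -/
noncomputable def bond (D : SSGSetup) (b : Fin 3) : Set Plane := D.bondPath b '' Icc 0 1

theorem continuous_G (D : SSGSetup) (i : Fin 3) : Continuous (D.G i) := by
  unfold G; fun_prop

theorem isCompact_bond (D : SSGSetup) (b : Fin 3) : IsCompact (D.bond b) := by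
  refine isCompact_Icc.image ?_
  unfold bondPath; fun_prop

theorem norm_G_le (D : SSGSetup) (M : ℝ) (hM : ∀ i, ‖D.p i‖ ≤ M) (i : Fin 3) (x : Plane)
    (hx : ‖x‖ ≤ M) : ‖D.G i x‖ ≤ M := by
  have h0 := D.α_pos
  have h1 := D.α_lt_one
  have e : D.G i x = ((1 - D.α) / 2) • x + ((1 + D.α) / 2) • D.p i := by
    unfold G; module
  rw [e]
  refine (norm_add_le _ _).trans ?_
  rw [norm_smul, norm_smul, Real.norm_of_nonneg (by linarith), Real.norm_of_nonneg (by linarith)]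
  nlinarith [hM i]

theorem dist_G (D : SSGSetup) (i : Fin 3) (x y : Plane) :
    dist (D.G i x) (D.G i y) = (1 - D.α) / 2 * dist x y := by
  have h1 := D.α_lt_one
  have e : D.G i x - D.G i y = ((1 - D.α) / 2) • (x - y) := by
    unfold G; module
  rw [dist_eq_norm, e, norm_smul, Real.norm_of_nonneg (by linarith), dist_eq_norm]

/-- There is exactly one compact set `K` with
`K = G_1(K) ∪ G_2(K) ∪ G_3(K) ∪ e_{12} ∪ e_{23} ∪ e_{31}`. -/
theorem existsUnique_gasket (D : SSGSetup) :
    ∃! K : Set Plane, IsCompact K ∧ K = (⋃ i, D.G i '' K) ∪ ⋃ b, D.bond b := by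
  set U : Set Plane := ⋃ w : List (Fin 3), ⋃ b, D.wordMap w '' D.bond b with hU
  have hUeq : U = (⋃ i, D.G i '' U) ∪ ⋃ b, D.bond b := by
    ext x
    simp only [hU, mem_union, mem_iUnion, mem_image]
    constructor
    · rintro ⟨w, b, y, hy, rfl⟩
      cases w with
      | nil => exact Or.inr ⟨b, hy⟩
      | cons i w => exact Or.inl ⟨i, D.wordMap w y, ⟨w, b, y, hy, rfl⟩, rfl⟩
    · rintro (⟨i, _, ⟨w, b, y, hy, rfl⟩, rfl⟩ | ⟨b, hb⟩)
      · exact ⟨i :: w, b, y, hy, rfl⟩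
      · exact ⟨[], b, x, hb, rfl⟩
  have hUbd : Bornology.IsBounded U := by
    have hM : ∀ i, ‖D.p i‖ ≤ ∑ j, ‖D.p j‖ := fun i =>
      Finset.single_le_sum (f := fun j => ‖D.p j‖) (fun _ _ => norm_nonneg _) (Finset.mem_univ i)
    have hw : ∀ (w : List (Fin 3)) (x : Plane), ‖x‖ ≤ ∑ j, ‖D.p j‖ →
        ‖D.wordMap w x‖ ≤ ∑ j, ‖D.p j‖ := by
      intro w
      induction w with
      | nil => exact fun x hx => hx
      | cons i w ih => exact fun x hx => D.norm_G_le _ hM i _ (ih x hx)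
    refine (Metric.isBounded_closedBall (x := (0 : Plane)) (r := ∑ j, ‖D.p j‖)).subset ?_
    intro x hx
    simp only [hU, mem_iUnion, mem_image] at hx
    obtain ⟨w, b, y, ⟨t, ht, rfl⟩, rfl⟩ := hx
    rw [mem_closedBall_zero_iff]
    refine hw w _ ?_
    unfold bondPath
    refine (norm_add_le _ _).trans ?_
    rw [norm_smul, norm_smul, Real.norm_of_nonneg (by linarith [ht.2]), Real.norm_of_nonneg ht.1]
    have a1 := D.norm_G_le _ hM b _ (hM (b + 1))
    have a2 := D.norm_G_le _ hM (b + 1) _ (hM b)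
    nlinarith [ht.1, ht.2]
  have hKc : IsCompact (closure U) := hUbd.isCompact_closure
  have hKeq : closure U = (⋃ i, D.G i '' closure U) ∪ ⋃ b, D.bond b := by
    conv_lhs => rw [hUeq]
    rw [closure_union, closure_iUnion_of_finite, closure_iUnion_of_finite]
    congr 1
    · refine iUnion_congr fun i => ?_
      exact (image_closure_of_isCompact hKc (D.continuous_G i).continuousOn).symm
    · exact iUnion_congr fun b => (D.isCompact_bond b).isClosed.closure_eq
  refine ⟨closure U, ⟨hKc, hKeq⟩, ?_⟩
  rintro L ⟨hLc, hL⟩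
  have hKne : (closure U).Nonempty := by
    refine ⟨D.bondPath 0 0, ?_⟩
    rw [hKeq]
    exact Or.inr (mem_iUnion.2 ⟨0, 0, by simp, rfl⟩)
  have hUL : ∀ (w : List (Fin 3)) (x : Plane), x ∈ L → D.wordMap w x ∈ L := by
    intro w
    induction w with
    | nil => exact fun x hx => hx
    | cons i w ih =>
      intro x hx
      rw [hL]
      exact Or.inl (mem_iUnion.2 ⟨i, _, ih x hx, rfl⟩)
  apply Subset.antisymm
  · intro x hx
    obtain ⟨z, hz, hmax⟩ := hLc.exists_isMaxOn ⟨x, hx⟩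
      (Metric.continuous_infDist_pt (closure U)).continuousOn
    have hz0 : Metric.infDist z (closure U) ≤ 0 := by
      have hz' := hz
      rw [hL] at hz'
      rcases hz' with h | h
      · obtain ⟨i, y, hy, rfl⟩ := mem_iUnion.1 h
        obtain ⟨k, hk, hk'⟩ := hKc.exists_infDist_eq_dist hKne y
        have h1 : Metric.infDist (D.G i y) (closure U) ≤ dist (D.G i y) (D.G i k) := by
          refine Metric.infDist_le_dist_of_mem ?_
          rw [hKeq]
          exact Or.inl (mem_iUnion.2 ⟨i, k, hk, rfl⟩)
        rw [D.dist_G, ← hk'] at h1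
        have h2 : Metric.infDist y (closure U) ≤ Metric.infDist (D.G i y) (closure U) := hmax hy
        nlinarith [D.α_pos, D.α_lt_one, Metric.infDist_nonneg (x := y) (s := closure U)]
      · have : z ∈ closure U := by rw [hKeq]; exact Or.inr h
        rw [Metric.infDist_zero_of_mem this]
    have hx0 : Metric.infDist x (closure U) = 0 :=
      le_antisymm ((hmax hx).trans hz0) Metric.infDist_nonneg
    exact (isClosed_closure.mem_iff_infDist_zero hKne).2 hx0
  · refine closure_minimal ?_ hLc.isClosed
    intro x hx
    simp only [hU, mem_iUnion, mem_image] at hx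
    obtain ⟨w, b, y, hy, rfl⟩ := hx
    refine hUL w y ?_
    rw [hL]
    exact Or.inr (mem_iUnion.2 ⟨b, hy⟩)

/-- The stretched Sierpinski gasket: the unique compact set `K` with
`K = G_1(K) ∪ G_2(K) ∪ G_3(K) ∪ e_{12} ∪ e_{23} ∪ e_{31}`. -/
noncomputable def K (D : SSGSetup) : Set Plane := D.existsUnique_gasket.choose

theorem isCompact_K (D : SSGSetup) : IsCompact D.K := D.existsUnique_gasket.choose_spec.1.1

theorem K_eq (D : SSGSetup) : D.K = (⋃ i, D.G i '' D.K) ∪ ⋃ b, D.bond b :=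
  D.existsUnique_gasket.choose_spec.1.2

theorem wordMap_mem_K (D : SSGSetup) (w : List (Fin 3)) {x : Plane} (hx : x ∈ D.K) :
    D.wordMap w x ∈ D.K := by
  induction w with
  | nil => exact hx
  | cons i w ih =>
    rw [D.K_eq]
    exact Or.inl (mem_iUnion.2 ⟨i, _, ih, rfl⟩)

theorem bondPath_mem_K (D : SSGSetup) (b : Fin 3) (t : Icc (0 : ℝ) 1) :
    D.bondPath b t ∈ D.K := by
  rw [D.K_eq]
  exact Or.inr (mem_iUnion.2 ⟨b, t, t.2, rfl⟩)

theorem p_mem_K (D : SSGSetup) (i : Fin 3) : D.p i ∈ D.K := by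
  have h0 := D.α_pos
  have h1 := D.α_lt_one
  set x : Plane := D.bondPath 0 0 with hxdef
  have hx : x ∈ D.K := D.bondPath_mem_K 0 ⟨0, by simp⟩
  have hmem : ∀ n : ℕ, ((1 - D.α) / 2) ^ n • (x - D.p i) + D.p i ∈ D.K := by
    intro n
    induction n with
    | zero => simpa using hx
    | succ n ih =>
      rw [D.K_eq]
      refine Or.inl (mem_iUnion.2 ⟨i, _, ih, ?_⟩)
      unfold G
      rw [add_sub_cancel_right, smul_smul, pow_succ']
  have ht : Tendsto (fun n : ℕ => ((1 - D.α) / 2) ^ n • (x - D.p i) + D.p i) atTop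
      (𝓝 ((0 : ℝ) • (x - D.p i) + D.p i)) :=
    ((tendsto_pow_atTop_nhds_zero_of_lt_one (by linarith) (by linarith)).smul_const _).add_const _
  rw [zero_smul, zero_add] at ht
  exact D.isCompact_K.isClosed.mem_of_tendsto ht (Eventually.of_forall hmem)

/-- The vertex `p_i` as a point of `K`. -/
noncomputable def vertex (D : SSGSetup) (i : Fin 3) : D.K := ⟨D.p i, D.p_mem_K i⟩

/-- The map `G_w : K → K`. -/
noncomputable def cellMap (D : SSGSetup) (w : List (Fin 3)) (x : D.K) : D.K :=
  ⟨D.wordMap w x, D.wordMap_mem_K w x.2⟩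

/-- The affine parametrisation of the segment `e_{ij}^w = G_w(e_{ij})`, `(i, j) = (b, b + 1)`,
by `[0, 1]`, running from `G_w(p_{ij})` to `G_w(p_{ji})`. -/
noncomputable def edgePath (D : SSGSetup) (w : List (Fin 3)) (b : Fin 3) (t : Icc (0 : ℝ) 1) :
    D.K :=
  D.cellMap w ⟨D.bondPath b t, D.bondPath_mem_K b t⟩

end SSGSetup

/-! ## The Sobolev space `H¹([0, 1])` -/

/-- `g` is the derivative of `f` on `(0, 1)` in the sense of distributions. -/
def HasWeakDeriv (f g : ℝ → ℝ) : Prop :=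
  ∀ φ : ℝ → ℝ, ContDiff ℝ ∞ φ → HasCompactSupport φ → tsupport φ ⊆ Ioo 0 1 →
    ∫ x in (0 : ℝ)..1, f x * deriv φ x = -∫ x in (0 : ℝ)..1, g x * φ x

/-- `f|_{[0,1]} ∈ H¹([0, 1])`. As usual, elements of `H¹([0, 1])` are continuous functions (every
class modulo null sets has exactly one continuous representative). -/
def MemH1 (f : ℝ → ℝ) : Prop :=
  ContinuousOn f (Icc 0 1) ∧
    ∃ g : ℝ → ℝ, MemLp g 2 (volume.restrict (Icc (0 : ℝ) 1)) ∧ HasWeakDeriv f g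

open Classical in
/-- The distributional derivative of `f` in `L²([0, 1])` (unique almost everywhere on `[0, 1]`). -/
noncomputable def weakDeriv (f : ℝ → ℝ) : ℝ → ℝ :=
  if h : ∃ g : ℝ → ℝ, MemLp g 2 (volume.restrict (Icc (0 : ℝ) 1)) ∧ HasWeakDeriv f g then h.choose
  else 0

/-- The Dirichlet form `∫₀¹ f' g' dx` on `H¹([0, 1])`. -/
noncomputable def dirichletForm (f g : ℝ → ℝ) : ℝ :=
  ∫ x in (0 : ℝ)..1, weakDeriv f x * weakDeriv g x

/-! ## Resistance forms -/

/-- The unit contraction `ū = min(max(u, 0), 1)`. -/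
noncomputable def unitContraction {X : Type*} (u : X → ℝ) : X → ℝ := fun x => min (max (u x) 0) 1

/-- The set of quotients `|u(p) - u(q)|² / E(u, u)` with `u ∈ F`, `E(u, u) > 0`. -/
def resistanceSet {X : Type*} (E : (X → ℝ) → (X → ℝ) → ℝ) (F : Set (X → ℝ)) (p q : X) : Set ℝ :=
  {a | ∃ u ∈ F, 0 < E u u ∧ a = |u p - u q| ^ 2 / E u u}

/-- The resistance metric associated with `(E, F)`. -/
noncomputable def resistanceMetric {X : Type*} (E : (X → ℝ) → (X → ℝ) → ℝ) (F : Set (X → ℝ))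
    (p q : X) : ℝ :=
  sSup (resistanceSet E F p q)

/-- `(E, F)` is a resistance form on `X`. Only the values of `E` on `F × F` matter. -/
structure IsResistanceForm {X : Type*} (E : (X → ℝ) → (X → ℝ) → ℝ) (F : Set (X → ℝ)) : Prop where
  const_mem : ∀ c : ℝ, (fun _ => c) ∈ F
  add_mem : ∀ u ∈ F, ∀ v ∈ F, u + v ∈ F
  smul_mem : ∀ (c : ℝ), ∀ u ∈ F, c • u ∈ F
  symm : ∀ u ∈ F, ∀ v ∈ F, E u v = E v u
  add_left : ∀ u ∈ F, ∀ v ∈ F, ∀ w ∈ F, E (u + v) w = E u w + E v w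
  smul_left : ∀ (c : ℝ), ∀ u ∈ F, ∀ v ∈ F, E (c • u) v = c * E u v
  nonneg : ∀ u ∈ F, 0 ≤ E u u
  eq_zero_iff : ∀ u ∈ F, E u u = 0 ↔ ∃ c : ℝ, u = fun _ => c
  complete : ∀ s : ℕ → X → ℝ, (∀ n, s n ∈ F) →
    (∀ ε > 0, ∃ N, ∀ m ≥ N, ∀ n ≥ N, E (s m - s n) (s m - s n) < ε) →
    ∃ u ∈ F, Tendsto (fun n => E (s n - u) (s n - u)) atTop (𝓝 0)
  separates : ∀ x y : X, x ≠ y → ∃ u ∈ F, u x ≠ u y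
  bddAbove : ∀ x y : X, BddAbove (resistanceSet E F x y)
  markov : ∀ u ∈ F, unitContraction u ∈ F ∧ E (unitContraction u) (unitContraction u) ≤ E u u

/-- `u` is the `Y`-harmonic function with boundary value `u|_Y` for `(E, F)`: it minimises the
energy among all functions of `F` with the same values on `Y`. -/
def IsHarmonicExtension {X : Type*} (E : (X → ℝ) → (X → ℝ) → ℝ) (F : Set (X → ℝ)) (Y : Set X)
    (u : X → ℝ) : Prop :=
  u ∈ F ∧ ∀ v ∈ F, EqOn v u Y → E u u ≤ E v v

/-! ## Forms on the stretched Sierpinski gasket -/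

namespace SSGSetup

/-- `u|_{e_{ij}^w}` in the affine parametrisation of `e_{ij}^w`, `(i, j) = (b, b + 1)`, as a
function on `[0, 1]` (extended constantly outside `[0, 1]`). -/
noncomputable def onEdge (D : SSGSetup) (u : D.K → ℝ) (w : List (Fin 3)) (b : Fin 3) : ℝ → ℝ :=
  IccExtend (zero_le_one (α := ℝ)) (u ∘ D.edgePath w b)

/-- The space of `u ∈ C(K)` with `u|_{e_{ij}^w} ∈ H¹(e_{ij}^w)` for all words `w` and bonds. -/
def tildeF (D : SSGSetup) : Set (D.K → ℝ) :=
  {u | Continuous u ∧ ∀ w b, MemH1 (D.onEdge u w b)}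

/-- `D^I_{k+1}(u, v)`: the sum of the Dirichlet integrals over all `e_{ij}^w` with `|w| = k`. -/
noncomputable def lineForm (D : SSGSetup) (k : ℕ) (u v : D.K → ℝ) : ℝ :=
  ∑ w : Fin k → Fin 3, ∑ b : Fin 3,
    dirichletForm (D.onEdge u (List.ofFn w) b) (D.onEdge v (List.ofFn w) b)

/-- `Q^Σ_0`, the sum over the bonds `(i, j)` of `(u(p_i) - u(p_j)) (v(p_i) - v(p_j))`. -/
noncomputable def Q0 (D : SSGSetup) (u v : D.K → ℝ) : ℝ :=
  ∑ b : Fin 3, (u (D.vertex b) - u (D.vertex (b + 1))) * (v (D.vertex b) - v (D.vertex (b + 1)))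

/-- `Q^Σ_m(u, v)`, the sum of `Q^Σ_0(u ∘ G_w, v ∘ G_w)` over all words `w` of length `m`. -/
noncomputable def Qm (D : SSGSetup) (m : ℕ) (u v : D.K → ℝ) : ℝ :=
  ∑ w : Fin m → Fin 3, D.Q0 (u ∘ D.cellMap (List.ofFn w)) (v ∘ D.cellMap (List.ofFn w))

/-- The class of resistance forms `(E, F)` on `K` such that
(a) `F ⊆ C(K)`, and `u ∈ F` if and only if `u|_{G_i(K)} ∈ F|_{G_i(K)}` for all `i` and
`u|_{e_{ij}} ∈ H¹(e_{ij})` for all bonds `(i, j)`;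
(b) the identity map from `K` with the Euclidean metric to `K` with the resistance metric is a
homeomorphism, that is, both metrics have the same open sets;
(c) the form is invariant under all linear maps `φ` of the plane with `φ(K) = K`. -/
structure IsSymmetricForm (D : SSGSetup) (E : (D.K → ℝ) → (D.K → ℝ) → ℝ) (F : Set (D.K → ℝ)) :
    Prop where
  isResistanceForm : IsResistanceForm E F
  continuous : ∀ u ∈ F, Continuous u
  mem_iff : ∀ u : D.K → ℝ, u ∈ F ↔
    (∀ i : Fin 3, ∃ v ∈ F, ∀ x : D.K, u (D.cellMap [i] x) = v (D.cellMap [i] x)) ∧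
      ∀ b : Fin 3, MemH1 (D.onEdge u [] b)
  isOpen_iff : ∀ s : Set D.K, IsOpen s ↔
    ∀ x ∈ s, ∃ ε > 0, ∀ y : D.K, resistanceMetric E F x y < ε → y ∈ s
  invariant : ∀ (φ : Plane →ₗ[ℝ] Plane) (hφ : φ '' D.K = D.K), ∀ u ∈ F,
    (fun x : D.K => u ⟨φ x, hφ.subset (mem_image_of_mem φ x.2)⟩) ∈ F ∧
      E (fun x : D.K => u ⟨φ x, hφ.subset (mem_image_of_mem φ x.2)⟩)
        (fun x : D.K => u ⟨φ x, hφ.subset (mem_image_of_mem φ x.2)⟩) = E u u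

/-- `r > 0` is such that the trace of `(E, F)` on `V_0 = {p_1, p_2, p_3}` is `r⁻¹ Q^Σ_0`: every
function on `V_0` has a harmonic extension, and `E(u, v) = r⁻¹ Q^Σ_0(u, v)` for all `V_0`-harmonic
functions `u`, `v`. -/
def IsTraceConstant (D : SSGSetup) (E : (D.K → ℝ) → (D.K → ℝ) → ℝ) (F : Set (D.K → ℝ)) (r : ℝ) :
    Prop :=
  0 < r ∧
    (∀ f : Fin 3 → ℝ, ∃ u, IsHarmonicExtension E F (range D.vertex) u ∧
      ∀ i, u (D.vertex i) = f i) ∧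
    ∀ u v, IsHarmonicExtension E F (range D.vertex) u →
      IsHarmonicExtension E F (range D.vertex) v → E u v = r⁻¹ * D.Q0 u v

open Classical in
/-- The normalizing constant `r_0(E, F)`, the number `r > 0` for which the trace of `(E, F)` on
`V_0` is `r⁻¹ Q^Σ_0` (with the value `0` if there is no such number). -/
noncomputable def r0 (D : SSGSetup) (E : (D.K → ℝ) → (D.K → ℝ) → ℝ) (F : Set (D.K → ℝ)) : ℝ :=
  if h : ∃ r, D.IsTraceConstant E F r then h.choose else 0

end SSGSetup

/-- A sequence of matching pairs `(r_m, ρ_m)_{m ≥ 1}`; here `r k` and `ρ k` stand for `r_{k+1}` and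
`ρ_{k+1}`. -/
structure MatchingSeq where
  r : ℕ → ℝ
  ρ : ℕ → ℝ
  r_pos : ∀ k, 0 < r k
  ρ_pos : ∀ k, 0 < ρ k
  matching : ∀ k, 5 / 3 * r k + ρ k = 1

namespace MatchingSeq

/-- `δ_m = r_1 ⋯ r_m`. -/
noncomputable def δ (R : MatchingSeq) (m : ℕ) : ℝ := ∏ i ∈ Finset.range m, R.r i

/-- `R.γ k` is `γ_{k+1} = δ_k ρ_{k+1}`. -/
noncomputable def γ (R : MatchingSeq) (k : ℕ) : ℝ := R.δ k * R.ρ k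

end MatchingSeq

namespace SSGSetup

/-- The approximating form
`E_{R,m}(u, v) = δ_m⁻¹ Q^Σ_m(u, v) + ∑_{k=1}^m γ_k⁻¹ D^I_k(u, v)`. -/
noncomputable def approxForm (D : SSGSetup) (R : MatchingSeq) (m : ℕ) (u v : D.K → ℝ) : ℝ :=
  (R.δ m)⁻¹ * D.Qm m u v + ∑ k ∈ Finset.range m, (R.γ k)⁻¹ * D.lineForm k u v

/-- The domain `F_R`: functions in `tildeF` for which the (non-decreasing) sequence `E_{R,m}(u, u)`
has a finite limit. -/
def domain (D : SSGSetup) (R : MatchingSeq) : Set (D.K → ℝ) :=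
  {u | u ∈ D.tildeF ∧ ∃ L : ℝ, Tendsto (fun m => D.approxForm R m u u) atTop (𝓝 L)}

/-- `E_R(u, v) = lim_m E_{R,m}(u, v)`. -/
noncomputable def form (D : SSGSetup) (R : MatchingSeq) (u v : D.K → ℝ) : ℝ :=
  limUnder atTop (fun m => D.approxForm R m u v)

/-- The line part `E^I_R(u, v) = ∑_{k ≥ 1} γ_k⁻¹ D^I_k(u, v)`. -/
noncomputable def linePart (D : SSGSetup) (R : MatchingSeq) (u v : D.K → ℝ) : ℝ :=
  ∑' k, (R.γ k)⁻¹ * D.lineForm k u v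

/-- The SG part `E^Σ_R = E_R - E^I_R`. -/
noncomputable def sgPart (D : SSGSetup) (R : MatchingSeq) (u v : D.K → ℝ) : ℝ :=
  D.form R u v - D.linePart R u v

/-- The domain of the line part, `F^I_R = {u ∈ F_R | E^Σ_R(u, u) = 0}`. -/
def lineDomain (D : SSGSetup) (R : MatchingSeq) : Set (D.K → ℝ) :=
  {u | u ∈ D.domain R ∧ D.sgPart R u u = 0}

end SSGSetup

/-! Write P_m for the product of 1 - ρ_i over i < m, and X = `R.resistance` for 1 minus the infinite
product. Three triangles with edge resistance s, joined by three edges of resistance ρ, are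
electrically equivalent at the outer corners to one triangle with edge resistance (5/3)s + ρ.
Cutting K into its three cells and three bonds turns a form for R into forms for the shifted
sequence, scaled by r_0. As (5/3)r_0 = 1 - ρ_0, the trace constant should satisfy X(R) = ρ_0 + (1 -
ρ_0) X(`R.shift`) (`resistance_eq`). This recursion alone does not determine X, since the constant 1
also solves it; the vanishing of the SG part selects the solution.

Lower bound for the energy. `network_energy_ge` is the one-step estimate, proved with the optimal
current flow. Iterating it m times (`Q0_le_approx`) bounds `Q0` with the constant 1 - P_m + P_m ε,
provided the term δ_m⁻¹ Q_m is weighted by ε⁻¹. For a function in `lineDomain` that term tends to 0,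
so letting m → ∞ at fixed ε and then ε → 0 leaves `Q0_le`: Q_0(u, u) ≤ X E(u, u).

Upper bound. Prescribing at every level the values of the optimal network potential, and affine
functions on bonds, defines `harmonic`. Its level-k line energy is ρ_k P_k / X² times Q_0; these
terms sum to Q_0 / X because the ρ_k P_k telescope to X. Its SG energy at level m is P_m X_m² / X²
times Q_0, with X_m the constant of the m-fold shift. Since 1 - X = P_m (1 - X_m), it is at most a
multiple of P_m X_m = P_m - (1 - X), which tends to 0, whether or not the ρ_k are summable. Hence
`harmonic` lies in the domain and attains the lower bound, and polarisation gives the trace.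

Resistance form. The energy of u on a cell is at most r_0 ≤ 3/5 times the total energy, so an
oscillation estimate propagates through all levels (`sq_sub_le`) and yields equicontinuity
(`eventually_sq_sub_le`). These two facts carry the finiteness and continuity of the resistance
metric and the compactness part of completeness. That the condition of zero SG part survives limits
follows from `Qm_le_linePart`, which is uniform in the level. Everything is proved for all sequences
R at once, because restriction to a cell replaces R by its shift. -/

/-! ## Functions in `H¹([0, 1])` as primitives of square integrable functions -/

/-- `f` is on `[0, 1]` a primitive of the square integrable function `g`. -/
def IsPrimitive (f g : ℝ → ℝ) : Prop :=
  MemLp g 2 (volume.restrict (Icc (0 : ℝ) 1)) ∧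
    ∀ t ∈ Icc (0 : ℝ) 1, f t = f 0 + ∫ x in (0 : ℝ)..t, g x

theorem integrableOn_of_memLp_two {g : ℝ → ℝ}
    (hg : MemLp g 2 (volume.restrict (Icc (0 : ℝ) 1))) : IntegrableOn g (Icc 0 1) :=
  hg.integrable (by norm_num)

theorem intervalIntegrable_of_integrableOn {g : ℝ → ℝ} (hg : IntegrableOn g (Icc 0 1)) {s t : ℝ}
    (hs : s ∈ Icc (0 : ℝ) 1) (ht : t ∈ Icc (0 : ℝ) 1) : IntervalIntegrable g volume s t := by
  rw [intervalIntegrable_iff]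
  refine hg.mono_set (uIoc_subset_uIcc.trans ?_)
  exact uIcc_subset_Icc hs ht

theorem intervalIntegral_unit (g : ℝ → ℝ) :
    ∫ x in (0 : ℝ)..1, g x = ∫ x in Icc (0 : ℝ) 1, g x := by
  rw [intervalIntegral.integral_of_le zero_le_one, integral_Icc_eq_integral_Ioc]

theorem integrableOn_mul_of_memLp_two {g h : ℝ → ℝ}
    (hg : MemLp g 2 (volume.restrict (Icc (0 : ℝ) 1)))
    (hh : MemLp h 2 (volume.restrict (Icc (0 : ℝ) 1))) :
    IntegrableOn (fun x => g x * h x) (Icc 0 1) :=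
  MemLp.integrable_mul hg hh

namespace IsPrimitive

variable {f g f' g' : ℝ → ℝ}

/-- Absolute continuity is what makes integration by parts available, and it is stable under
composition with contractions. -/
theorem absolutelyContinuous (h : IsPrimitive f g) : AbsolutelyContinuousOnInterval f 0 1 := by
  have h1 : IntervalIntegrable g volume 0 1 :=
    intervalIntegrable_of_integrableOn (integrableOn_of_memLp_two h.1) (by simp) (by simp)
  have h2 := h1.absolutelyContinuousOnInterval_intervalIntegral (c := 0) (by simp)
  rw [absolutelyContinuousOnInterval_iff] at h2 ⊢
  intro ε hε
  obtain ⟨d, hd, H⟩ := h2 ε hε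
  refine ⟨d, hd, fun E hE hl => ?_⟩
  refine lt_of_eq_of_lt (Finset.sum_congr rfl fun i hi => ?_) (H E hE hl)
  have := hE.1 i hi
  rw [uIcc_of_le zero_le_one] at this
  rw [h.2 _ this.1, h.2 _ this.2, dist_add_left]

theorem continuousOn (h : IsPrimitive f g) : ContinuousOn f (Icc 0 1) := by
  simpa using h.absolutelyContinuous.continuousOn

theorem ae_hasDerivAt (h : IsPrimitive f g) :
    ∀ᵐ x ∂(volume.restrict (Icc (0 : ℝ) 1)), HasDerivAt f (g x) x := by
  have h1 : IntervalIntegrable g volume 0 1 :=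
    intervalIntegrable_of_integrableOn (integrableOn_of_memLp_two h.1) (by simp) (by simp)
  rw [← restrict_Ioo_eq_restrict_Icc, ae_restrict_iff' measurableSet_Ioo]
  filter_upwards [h1.ae_hasDerivAt_integral] with x hx hxI
  have h2 := (hx (by rw [uIcc_of_le zero_le_one]; exact Ioo_subset_Icc_self hxI) 0
    (by simp)).const_add (f 0)
  refine h2.congr_of_eventuallyEq ?_
  filter_upwards [isOpen_Ioo.mem_nhds hxI] with y hy
  exact h.2 y (Ioo_subset_Icc_self hy)

theorem hasWeakDeriv (h : IsPrimitive f g) : HasWeakDeriv f g := by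
  intro φ hφ _ hφs
  have hac : AbsolutelyContinuousOnInterval φ 0 1 :=
    (hφ.of_le (by simp)).contDiffOn.absolutelyContinuousOnInterval
  rw [h.absolutelyContinuous.integral_mul_deriv_eq_deriv_mul hac]
  have h0 : φ 0 = 0 := image_eq_zero_of_notMem_tsupport fun hh => by simpa using hφs hh
  have h1 : φ 1 = 0 := image_eq_zero_of_notMem_tsupport fun hh => by simpa using hφs hh
  rw [h0, h1, intervalIntegral_unit, intervalIntegral_unit]
  simp only [mul_zero, sub_zero, zero_sub, neg_inj]
  refine integral_congr_ae ?_
  filter_upwards [h.ae_hasDerivAt] with x hx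
  rw [hx.deriv]

end IsPrimitive

/-! ### Uniqueness of weak derivatives and the lemma of du Bois-Reymond. -/

theorem ae_eq_zero_of_forall_test {h : ℝ → ℝ} (hh : IntegrableOn h (Icc 0 1))
    (H : ∀ φ : ℝ → ℝ, ContDiff ℝ ∞ φ → HasCompactSupport φ → tsupport φ ⊆ Ioo 0 1 →
      ∫ x in (0 : ℝ)..1, h x * φ x = 0) :
    ∀ᵐ x ∂(volume.restrict (Icc (0 : ℝ) 1)), h x = 0 := by
  rw [← restrict_Ioo_eq_restrict_Icc, ae_restrict_iff' measurableSet_Ioo]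
  refine isOpen_Ioo.ae_eq_zero_of_integral_contDiff_smul_eq_zero
    (hh.mono_set Ioo_subset_Icc_self).locallyIntegrableOn fun φ h1 h2 h3 => ?_
  rw [← H φ h1 h2 h3, intervalIntegral_unit, ← integral_indicator measurableSet_Icc]
  congr 1
  ext x
  by_cases hx : x ∈ Icc (0 : ℝ) 1
  · rw [indicator_of_mem hx, smul_eq_mul, mul_comm]
  · have h0 : φ x = 0 :=
      image_eq_zero_of_notMem_tsupport fun hh => hx (Ioo_subset_Icc_self (h3 hh))
    rw [indicator_of_notMem hx, h0, zero_smul]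

theorem HasWeakDeriv.ae_eq {f g g' : ℝ → ℝ} (h : HasWeakDeriv f g) (h' : HasWeakDeriv f g')
    (hg : IntegrableOn g (Icc 0 1)) (hg' : IntegrableOn g' (Icc 0 1)) :
    g =ᵐ[volume.restrict (Icc (0 : ℝ) 1)] g' := by
  have := ae_eq_zero_of_forall_test (h := fun x => g x - g' x) (hg.sub hg') ?_
  · filter_upwards [this] with x hx using sub_eq_zero.1 hx
  · intro φ h1 h2 h3
    have i1 := (intervalIntegrable_of_integrableOn hg (s := 0) (t := 1) (by simp)
      (by simp)).mul_continuousOn (g := φ) h1.continuous.continuousOn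
    have i2 := (intervalIntegrable_of_integrableOn hg' (s := 0) (t := 1) (by simp)
      (by simp)).mul_continuousOn (g := φ) h1.continuous.continuousOn
    simp only [sub_mul]
    rw [intervalIntegral.integral_sub i1 i2]
    have e1 := h φ h1 h2 h3
    have e2 := h' φ h1 h2 h3
    linarith

/-- The primitive of a test function with vanishing integral is a test function. -/
theorem exists_test_primitive {η : ℝ → ℝ} (h1 : ContDiff ℝ ∞ η) (h2 : HasCompactSupport η)
    (h3 : tsupport η ⊆ Ioo 0 1) (h4 : ∫ x in (0 : ℝ)..1, η x = 0) :
    ∃ φ : ℝ → ℝ, ContDiff ℝ ∞ φ ∧ HasCompactSupport φ ∧ tsupport φ ⊆ Ioo 0 1 ∧ deriv φ = η := by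
  have hc := h1.continuous
  have hd : ∀ x, HasDerivAt (fun x => ∫ y in (0 : ℝ)..x, η y) (η x) x := fun x =>
    intervalIntegral.integral_hasDerivAt_right (hc.intervalIntegrable _ _)
      (hc.stronglyMeasurableAtFilter _ _) hc.continuousAt
  have hde : deriv (fun x => ∫ y in (0 : ℝ)..x, η y) = η := funext fun x => (hd x).deriv
  -- An empty support is covered by the empty interval `Icc 1 0`, so no case distinction survives
  -- this line.
  obtain ⟨a, b, ha, hb, hab⟩ : ∃ a b : ℝ, 0 < a ∧ b < 1 ∧ tsupport η ⊆ Icc a b := by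
    rcases (tsupport η).eq_empty_or_nonempty with he | hne
    · exact ⟨1, 0, by simp, by simp, by simp [he]⟩
    · obtain ⟨a, ha⟩ := IsCompact.exists_isLeast h2 hne
      obtain ⟨b, hb⟩ := IsCompact.exists_isGreatest h2 hne
      exact ⟨a, b, (h3 ha.1).1, (h3 hb.1).2, fun x hx => ⟨ha.2 hx, hb.2 hx⟩⟩
  have hz : ∀ x, x ∉ Icc a b → η x = 0 := fun x hx =>
    image_eq_zero_of_notMem_tsupport fun h => hx (hab h)
  have hsupp : tsupport (fun x => ∫ y in (0 : ℝ)..x, η y) ⊆ Icc a b := by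
    refine closure_minimal (fun x hx => ?_) isClosed_Icc
    by_contra hx'
    refine hx ?_
    -- Left of `a` the integrand vanishes. Right of `b` the integral from 0 to `x` is the total
    -- integral, which is zero by `h4`.
    rcases not_and_or.1 hx' with h | h
    · push Not at h
      refine (intervalIntegral.integral_congr (g := fun _ => 0) fun y hy => hz y fun hy' => ?_).trans
        (by simp)
      have := hy.2
      rcases le_max_iff.1 this with h' | h' <;> linarith [hy'.1]
    · push Not at h
      have e : ∫ y in x..1, η y = 0 := by
        refine (intervalIntegral.integral_congr (g := fun _ => 0) fun y hy =>
          hz y fun hy' => ?_).trans (by simp)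
        have := hy.1
        rcases min_le_iff.1 this with h' | h' <;> linarith [hy'.2]
      have := intervalIntegral.integral_add_adjacent_intervals (a := 0) (b := x) (c := 1)
        (hc.intervalIntegrable (μ := volume) 0 x) (hc.intervalIntegrable x 1)
      change ∫ y in (0 : ℝ)..x, η y = 0
      linarith
  refine ⟨fun x => ∫ y in (0 : ℝ)..x, η y, ?_, ?_, ?_, hde⟩
  · rw [contDiff_infty_iff_deriv, hde]
    exact ⟨fun x => (hd x).differentiableAt, h1⟩
  · exact isCompact_Icc.of_isClosed_subset (isClosed_tsupport _) hsupp
  · exact hsupp.trans fun x hx => ⟨ha.trans_le hx.1, hx.2.trans_lt hb⟩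

/-- The lemma of du Bois-Reymond. -/
theorem HasWeakDeriv.eq_const {h : ℝ → ℝ} (hc : ContinuousOn h (Icc 0 1))
    (H : HasWeakDeriv h 0) : ∀ t ∈ Icc (0 : ℝ) 1, h t = h 0 := by
  -- A test function ψ of integral one, supported in [1/4, 3/4]. The candidate for the constant
  -- value of `h` is its mean against ψ.
  let B : ContDiffBump (1 / 2 : ℝ) := ⟨1 / 8, 1 / 4, by norm_num, by norm_num⟩
  set ψ : ℝ → ℝ := B.normed volume with hψ
  have hψ1 : ContDiff ℝ ∞ ψ := B.contDiff_normed
  have hψ2 : HasCompactSupport ψ := B.hasCompactSupport_normed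
  have hψ3 : tsupport ψ ⊆ Ioo 0 1 := by
    rw [hψ, B.tsupport_normed_eq, Real.closedBall_eq_Icc]
    intro x hx
    have h1 := hx.1
    have h2 := hx.2
    simp only [B] at h1 h2
    constructor <;> linarith
  have hψ4 : ∫ x in (0 : ℝ)..1, ψ x = 1 := by
    rw [intervalIntegral.integral_eq_integral_of_support_subset
      ((subset_tsupport ψ).trans (hψ3.trans Ioo_subset_Ioc_self))]
    exact B.integral_normed
  set c := ∫ x in (0 : ℝ)..1, h x * ψ x with hcdef
  have hi : IntegrableOn h (Icc 0 1) := hc.integrableOn_Icc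
  have hii : ∀ φ : ℝ → ℝ, Continuous φ → IntervalIntegrable (fun x => h x * φ x) volume 0 1 :=
    fun φ hφ => (intervalIntegrable_of_integrableOn hi (s := 0) (t := 1) (by simp)
      (by simp)).mul_continuousOn hφ.continuousOn
  have hae := ae_eq_zero_of_forall_test (h := fun x => h x - c)
    (hi.sub (integrableOn_const (by simp))) ?_
  · have hae' : h =ᵐ[volume.restrict (Icc (0 : ℝ) 1)] fun _ => c := by
      filter_upwards [hae] with x hx using sub_eq_zero.1 hx
    have := Measure.eqOn_Icc_of_ae_eq volume (by norm_num) hae' hc continuousOn_const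
    intro t ht
    rw [this ht, this (by simp : (0 : ℝ) ∈ Icc (0 : ℝ) 1)]
  · intro φ h1 h2 h3
    set k := ∫ x in (0 : ℝ)..1, φ x with hk
    -- Subtracting k ψ makes the integral of φ zero, so the difference is the derivative of a test
    -- function and is annihilated by `h`.
    obtain ⟨Φ, hΦ1, hΦ2, hΦ3, hΦ⟩ := exists_test_primitive (η := fun x => φ x - k * ψ x)
      (h1.sub (contDiff_const.mul hψ1))
      (h2.sub (hψ2.mul_left (f := fun _ => k)))
      ((tsupport_sub φ (fun x => k * ψ x)).trans
        (union_subset h3 ((tsupport_mul_subset_right (f := fun _ => k)).trans hψ3)))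
      (by
        rw [intervalIntegral.integral_sub (h1.continuous.intervalIntegrable _ _)
          ((hψ1.continuous.intervalIntegrable _ _).const_mul k),
          intervalIntegral.integral_const_mul, hψ4, ← hk]
        ring)
    have e := H Φ hΦ1 hΦ2 hΦ3
    rw [hΦ] at e
    simp only [Pi.zero_apply, zero_mul, intervalIntegral.integral_zero, neg_zero] at e
    have e1 : ∀ x, h x * (φ x - k * ψ x) = h x * φ x - k * (h x * ψ x) := fun x => by ring
    simp only [e1] at e
    rw [intervalIntegral.integral_sub (hii φ h1.continuous)
      ((hii ψ hψ1.continuous).const_mul k), intervalIntegral.integral_const_mul, ← hcdef] at e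
    simp only [sub_mul]
    rw [intervalIntegral.integral_sub (hii φ h1.continuous)
      ((h1.continuous.intervalIntegrable _ _).const_mul c),
      intervalIntegral.integral_const_mul, ← hk]
    linarith

/-! ### `H¹([0, 1])` functions as primitives, and the calculus of the Dirichlet form. -/

theorem IsPrimitive.memH1 {f g : ℝ → ℝ} (h : IsPrimitive f g) : MemH1 f :=
  ⟨h.continuousOn, g, h.1, h.hasWeakDeriv⟩

theorem MemH1.weakDeriv_spec {f : ℝ → ℝ} (h : MemH1 f) :
    MemLp (weakDeriv f) 2 (volume.restrict (Icc (0 : ℝ) 1)) ∧ HasWeakDeriv f (weakDeriv f) := by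
  unfold weakDeriv
  rw [dif_pos h.2]
  exact h.2.choose_spec

/-- Subtracting from `f` the primitive of its weak derivative leaves a continuous function with weak
derivative zero, which is constant by du Bois-Reymond. -/
theorem MemH1.isPrimitive {f : ℝ → ℝ} (h : MemH1 f) : IsPrimitive f (weakDeriv f) := by
  obtain ⟨h1, h2⟩ := h.weakDeriv_spec
  set g := weakDeriv f
  refine ⟨h1, ?_⟩
  have hF : IsPrimitive (fun t => ∫ x in (0 : ℝ)..t, g x) g := ⟨h1, fun t _ => by simp⟩
  have hd : ContinuousOn (fun t => f t - ∫ x in (0 : ℝ)..t, g x) (Icc 0 1) :=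
    h.1.sub hF.continuousOn
  have hw : HasWeakDeriv (fun t => f t - ∫ x in (0 : ℝ)..t, g x) 0 := by
    intro φ p1 p2 p3
    have e1 := h2 φ p1 p2 p3
    have e2 := hF.hasWeakDeriv φ p1 p2 p3
    have hφ : Continuous (deriv φ) := p1.continuous_deriv (by simp)
    have hii : ∀ k : ℝ → ℝ, ContinuousOn k (Icc 0 1) →
        IntervalIntegrable (fun x => k x * deriv φ x) volume 0 1 := fun k hk =>
      (intervalIntegrable_of_integrableOn hk.integrableOn_Icc (s := 0) (t := 1) (by simp)
        (by simp)).mul_continuousOn hφ.continuousOn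
    simp only [sub_mul]
    rw [intervalIntegral.integral_sub (hii _ h.1) (hii _ hF.continuousOn), e1, e2]
    simp
  intro t ht
  have := hw.eq_const hd t ht
  simp only [intervalIntegral.integral_same, sub_zero] at this
  linarith

theorem IsPrimitive.weakDeriv_ae_eq {f g : ℝ → ℝ} (h : IsPrimitive f g) :
    weakDeriv f =ᵐ[volume.restrict (Icc (0 : ℝ) 1)] g :=
  h.memH1.weakDeriv_spec.2.ae_eq h.hasWeakDeriv
    (integrableOn_of_memLp_two h.memH1.weakDeriv_spec.1) (integrableOn_of_memLp_two h.1)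

theorem dirichletForm_eq {f₁ g₁ f₂ g₂ : ℝ → ℝ} (h₁ : IsPrimitive f₁ g₁) (h₂ : IsPrimitive f₂ g₂) :
    dirichletForm f₁ f₂ = ∫ x in Icc (0 : ℝ) 1, g₁ x * g₂ x := by
  rw [dirichletForm, intervalIntegral_unit]
  refine integral_congr_ae ?_
  filter_upwards [h₁.weakDeriv_ae_eq, h₂.weakDeriv_ae_eq] with x e1 e2
  rw [e1, e2]

theorem IsPrimitive.congr {f g f' : ℝ → ℝ} (h : IsPrimitive f g) (hf : EqOn f' f (Icc 0 1)) :
    IsPrimitive f' g :=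
  ⟨h.1, fun t ht => by rw [hf ht, hf (by simp), h.2 t ht]⟩

theorem MemH1.congr {f f' : ℝ → ℝ} (h : MemH1 f) (hf : EqOn f' f (Icc 0 1)) : MemH1 f' :=
  (h.isPrimitive.congr hf).memH1

theorem dirichletForm_congr {f f' h h' : ℝ → ℝ} (mf : MemH1 f) (mh : MemH1 h)
    (hf : EqOn f' f (Icc 0 1)) (hh : EqOn h' h (Icc 0 1)) :
    dirichletForm f' h' = dirichletForm f h := by
  rw [dirichletForm_eq (mf.isPrimitive.congr hf) (mh.isPrimitive.congr hh),
    dirichletForm_eq mf.isPrimitive mh.isPrimitive]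

theorem IsPrimitive.add {f g f' g' : ℝ → ℝ} (h : IsPrimitive f g) (h' : IsPrimitive f' g') :
    IsPrimitive (f + f') (g + g') := by
  refine ⟨h.1.add h'.1, fun t ht => ?_⟩
  have i := intervalIntegrable_of_integrableOn (integrableOn_of_memLp_two h.1) (s := 0) (by simp) ht
  have i' := intervalIntegrable_of_integrableOn (integrableOn_of_memLp_two h'.1) (s := 0)
    (by simp) ht
  simp only [Pi.add_apply]
  rw [intervalIntegral.integral_add i i', h.2 t ht, h'.2 t ht]
  ring

theorem IsPrimitive.smul {f g : ℝ → ℝ} (c : ℝ) (h : IsPrimitive f g) :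
    IsPrimitive (c • f) (c • g) := by
  refine ⟨h.1.const_smul c, fun t ht => ?_⟩
  simp only [Pi.smul_apply, smul_eq_mul]
  rw [intervalIntegral.integral_const_mul, h.2 t ht]
  ring

theorem MemH1.add {f f' : ℝ → ℝ} (h : MemH1 f) (h' : MemH1 f') : MemH1 (f + f') :=
  (h.isPrimitive.add h'.isPrimitive).memH1

theorem MemH1.smul {f : ℝ → ℝ} (c : ℝ) (h : MemH1 f) : MemH1 (c • f) :=
  (h.isPrimitive.smul c).memH1

theorem dirichletForm_comm (f h : ℝ → ℝ) : dirichletForm f h = dirichletForm h f := by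
  simp only [dirichletForm, mul_comm]

theorem dirichletForm_add_left {f f' h : ℝ → ℝ} (mf : MemH1 f) (mf' : MemH1 f') (mh : MemH1 h) :
    dirichletForm (f + f') h = dirichletForm f h + dirichletForm f' h := by
  have pf := mf.isPrimitive
  have pf' := mf'.isPrimitive
  have ph := mh.isPrimitive
  rw [dirichletForm_eq (pf.add pf') ph, dirichletForm_eq pf ph, dirichletForm_eq pf' ph,
    ← integral_add (integrableOn_mul_of_memLp_two pf.1 ph.1)
      (integrableOn_mul_of_memLp_two pf'.1 ph.1)]
  simp only [Pi.add_apply, add_mul]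

theorem dirichletForm_smul_left {f h : ℝ → ℝ} (c : ℝ) (mf : MemH1 f) (mh : MemH1 h) :
    dirichletForm (c • f) h = c * dirichletForm f h := by
  have pf := mf.isPrimitive
  have ph := mh.isPrimitive
  rw [dirichletForm_eq (pf.smul c) ph, dirichletForm_eq pf ph, ← integral_const_mul]
  simp only [Pi.smul_apply, smul_eq_mul, mul_assoc]

theorem dirichletForm_self_nonneg (f : ℝ → ℝ) : 0 ≤ dirichletForm f f :=
  intervalIntegral.integral_nonneg zero_le_one fun _ _ => mul_self_nonneg _

/-- Functions in `H¹([0, 1])` are Hölder continuous of exponent `1 / 2`. -/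
theorem MemH1.sq_sub_le {f : ℝ → ℝ} (h : MemH1 f) {s t : ℝ} (hs : s ∈ Icc (0 : ℝ) 1)
    (ht : t ∈ Icc (0 : ℝ) 1) : (f t - f s) ^ 2 ≤ |t - s| * dirichletForm f f := by
  wlog hst : s ≤ t generalizing s t
  · have := this ht hs (le_of_not_ge hst)
    rw [abs_sub_comm]
    linarith [sub_sq_comm (f s) (f t)]
  have p := h.isPrimitive
  set g := weakDeriv f
  have hi := integrableOn_of_memLp_two p.1
  have h2 : IntegrableOn (fun x => g x * g x) (Icc 0 1) := integrableOn_mul_of_memLp_two p.1 p.1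
  have e : f t - f s = ∫ x in s..t, g x := by
    have := intervalIntegral.integral_add_adjacent_intervals
      (intervalIntegrable_of_integrableOn hi (s := 0) (by simp) hs)
      (intervalIntegrable_of_integrableOn hi hs ht)
    rw [p.2 t ht, p.2 s hs]
    linarith
  have hD : ∫ x in s..t, g x * g x ≤ dirichletForm f f := by
    rw [dirichletForm_eq p p, intervalIntegral.integral_of_le hst]
    refine setIntegral_mono_set h2 (Eventually.of_forall fun x => mul_self_nonneg _) ?_
    have hsub : Ioc s t ⊆ Icc 0 1 := fun x hx => ⟨hs.1.trans hx.1.le, hx.2.trans ht.2⟩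
    exact LE.le.eventuallyLE hsub
  rw [abs_of_nonneg (sub_nonneg.2 hst)]
  set m := f t - f s with hm
  rcases hst.eq_or_lt with rfl | hlt
  · simp [hm]
  have hpos : 0 < t - s := sub_pos.2 hlt
  -- Cauchy–Schwarz in the form that the variance of `g` on [s, t] is nonnegative; m / (t - s) is
  -- the mean of `g`.
  have hq : 0 ≤ ∫ x in s..t, (g x - m / (t - s)) ^ 2 :=
    intervalIntegral.integral_nonneg hst fun _ _ => sq_nonneg _
  have e2 : ∀ x, (g x - m / (t - s)) ^ 2 =
      g x * g x - 2 * (m / (t - s)) * g x + (m / (t - s)) ^ 2 := fun x => by ring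
  simp only [e2] at hq
  have j1 := intervalIntegrable_of_integrableOn h2 hs ht
  have j2 := (intervalIntegrable_of_integrableOn hi hs ht).const_mul (2 * (m / (t - s)))
  rw [intervalIntegral.integral_add (j1.sub j2) intervalIntegrable_const,
    intervalIntegral.integral_sub j1 j2, intervalIntegral.integral_const_mul, ← e,
    intervalIntegral.integral_const, smul_eq_mul] at hq
  have e3 : (t - s) * (m / (t - s)) ^ 2 = m * (m / (t - s)) := by field_simp
  have e4 : m ^ 2 = (t - s) * (m * (m / (t - s))) := by field_simp
  rw [e3] at hq
  rw [e4]
  exact mul_le_mul_of_nonneg_left (by linarith) hpos.le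

theorem isPrimitive_affine (c d : ℝ) : IsPrimitive (fun t => c + t * d) fun _ => d :=
  ⟨memLp_const d, fun t _ => by simp⟩

theorem memH1_affine (c d : ℝ) : MemH1 fun t => c + t * d := (isPrimitive_affine c d).memH1

theorem dirichletForm_affine (c d : ℝ) :
    dirichletForm (fun t => c + t * d) (fun t => c + t * d) = d ^ 2 := by
  rw [dirichletForm_eq (isPrimitive_affine c d) (isPrimitive_affine c d)]
  simp [sq]

/-- Vanishes at both ends and is positive inside; later it separates interior points of a bond from
the rest of K. -/
theorem memH1_tent : MemH1 fun t => t * (1 - t) := by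
  refine IsPrimitive.memH1 (g := fun t => 1 - 2 * t) ⟨?_, fun t _ => ?_⟩
  · exact MemLp.of_bound (by fun_prop) 1 (by
      filter_upwards [ae_restrict_mem measurableSet_Icc] with x hx
      rw [Real.norm_eq_abs, abs_le]
      constructor <;> linarith [hx.1, hx.2])
  · rw [intervalIntegral.integral_sub (by simp) (Continuous.intervalIntegrable (by fun_prop) _ _),
      intervalIntegral.integral_const_mul, integral_id]
    simp
    ring

/-- Needed because reflections of the triangle map bonds to bonds with reversed parametrisation. -/
theorem IsPrimitive.comp_one_sub {f g : ℝ → ℝ} (h : IsPrimitive f g) :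
    IsPrimitive (fun t => f (1 - t)) (fun t => -g (1 - t)) := by
  constructor
  · have hpre : (fun x : ℝ => 1 - x) ⁻¹' Icc 0 1 = Icc 0 1 := by
      ext x
      simp only [mem_preimage, mem_Icc]
      constructor <;> rintro ⟨_, _⟩ <;> constructor <;> linarith
    have hm := (volume.measurePreserving_sub_left (1 : ℝ)).restrict_preimage
      (measurableSet_Icc (a := (0 : ℝ)) (b := 1))
    rw [hpre] at hm
    exact (h.1.comp_measurePreserving hm).neg
  · intro t ht
    have ht' : 1 - t ∈ Icc (0 : ℝ) 1 := ⟨by linarith [ht.2], by linarith [ht.1]⟩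
    have hi := integrableOn_of_memLp_two h.1
    rw [intervalIntegral.integral_neg, intervalIntegral.integral_comp_sub_left g (1 : ℝ)]
    have := intervalIntegral.integral_add_adjacent_intervals
      (intervalIntegrable_of_integrableOn hi (s := 0) (by simp) ht')
      (intervalIntegrable_of_integrableOn hi ht' (t := 1) (by simp))
    change f (1 - t) = f (1 - 0) + -∫ x in 1 - t..1 - 0, g x
    rw [sub_zero, h.2 (1 - t) ht', h.2 1 (by simp)]
    linarith

theorem MemH1.comp_one_sub {f : ℝ → ℝ} (h : MemH1 f) : MemH1 fun t => f (1 - t) :=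
  h.isPrimitive.comp_one_sub.memH1

theorem dirichletForm_comp_one_sub {f h : ℝ → ℝ} (mf : MemH1 f) (mh : MemH1 h) :
    dirichletForm (fun t => f (1 - t)) (fun t => h (1 - t)) = dirichletForm f h := by
  have pf := mf.isPrimitive
  have ph := mh.isPrimitive
  rw [dirichletForm_eq pf.comp_one_sub ph.comp_one_sub, dirichletForm_eq pf ph,
    ← intervalIntegral_unit, ← intervalIntegral_unit]
  simp only [neg_mul_neg]
  rw [intervalIntegral.integral_comp_sub_left (fun x => weakDeriv f x * weakDeriv h x) (1 : ℝ)]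
  simp

/-! ### Contractions and completeness in `H¹([0, 1])`. -/

theorem AbsolutelyContinuousOnInterval.lipschitz_comp {f φ : ℝ → ℝ} {a b : ℝ}
    (hφ : LipschitzWith 1 φ) (hf : AbsolutelyContinuousOnInterval f a b) :
    AbsolutelyContinuousOnInterval (φ ∘ f) a b := by
  rw [absolutelyContinuousOnInterval_iff] at hf ⊢
  intro ε hε
  obtain ⟨d, hd, H⟩ := hf ε hε
  refine ⟨d, hd, fun E hE hl => lt_of_le_of_lt (Finset.sum_le_sum fun i _ => ?_) (H E hE hl)⟩
  simpa using hφ.dist_le_mul (f (E.2 i).1) (f (E.2 i).2)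

/-- Difference quotients of φ ∘ f are dominated by those of `f`. Where φ ∘ f is not differentiable,
`deriv` has the default value 0, which respects the bound too. -/
theorem abs_deriv_lipschitz_comp_le {f φ : ℝ → ℝ} {g x : ℝ} (hφ : LipschitzWith 1 φ)
    (hf : HasDerivAt f g x) : |deriv (φ ∘ f) x| ≤ |g| := by
  by_cases hd : DifferentiableAt ℝ (φ ∘ f) x
  · refine le_of_tendsto_of_tendsto (hasDerivAt_iff_tendsto_slope.1 hd.hasDerivAt).abs
      (hasDerivAt_iff_tendsto_slope.1 hf).abs (Eventually.of_forall fun y => ?_)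
    simp only [slope_def_field, abs_div, Function.comp_apply]
    refine div_le_div_of_nonneg_right ?_ (abs_nonneg _)
    simpa [Real.dist_eq] using hφ.dist_le_mul (f y) (f x)
  · rw [deriv_zero_of_not_differentiableAt hd, abs_zero]
    exact abs_nonneg _

/-- Composition with a contraction preserves `H¹([0, 1])` and does not increase the energy. -/
theorem MemH1.lipschitz_comp {f φ : ℝ → ℝ} (hφ : LipschitzWith 1 φ) (hf : MemH1 f) :
    MemH1 (φ ∘ f) ∧ dirichletForm (φ ∘ f) (φ ∘ f) ≤ dirichletForm f f := by
  have p := hf.isPrimitive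
  have ac := AbsolutelyContinuousOnInterval.lipschitz_comp hφ p.absolutelyContinuous
  have hle : ∀ᵐ x ∂(volume.restrict (Icc (0 : ℝ) 1)), |deriv (φ ∘ f) x| ≤ |weakDeriv f x| := by
    filter_upwards [p.ae_hasDerivAt] with x hx using abs_deriv_lipschitz_comp_le hφ hx
  have p' : IsPrimitive (φ ∘ f) (deriv (φ ∘ f)) := by
    refine ⟨p.1.of_le (measurable_deriv _).aestronglyMeasurable hle, fun t ht => ?_⟩
    rw [(ac.mono _).integral_deriv_eq_sub]
    · ring
    · rw [uIcc_of_le ht.1, uIcc_of_le zero_le_one]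
      exact Icc_subset_Icc_right ht.2
  refine ⟨p'.memH1, ?_⟩
  rw [dirichletForm_eq p' p', dirichletForm_eq p p]
  refine integral_mono_ae (integrableOn_mul_of_memLp_two p'.1 p'.1)
    (integrableOn_mul_of_memLp_two p.1 p.1) ?_
  filter_upwards [hle] with x hx
  exact abs_le_iff_mul_self_le.1 hx

theorem IsPrimitive.sub {f g f' g' : ℝ → ℝ} (h : IsPrimitive f g) (h' : IsPrimitive f' g') :
    IsPrimitive (f - f') (g - g') := by
  have := h.add (h'.smul (-1))
  rw [neg_one_smul, neg_one_smul, ← sub_eq_add_neg, ← sub_eq_add_neg] at this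
  exact this

theorem norm_toLp_sub_sq {g h : ℝ → ℝ} (hg : MemLp g 2 (volume.restrict (Icc (0 : ℝ) 1)))
    (hh : MemLp h 2 (volume.restrict (Icc (0 : ℝ) 1))) :
    ‖hg.toLp g - hh.toLp h‖ ^ 2 = ∫ x in Icc (0 : ℝ) 1, (g - h) x * (g - h) x := by
  rw [← MemLp.toLp_sub, ← real_inner_self_eq_norm_sq, L2.inner_def]
  refine integral_congr_ae ?_
  filter_upwards [(hg.sub hh).coeFn_toLp] with x hx
  rw [hx]
  simp [sq]

/-- The energy is complete along pointwise convergent sequences. -/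
theorem MemH1.of_tendsto {s : ℕ → ℝ → ℝ} {f : ℝ → ℝ} (hs : ∀ n, MemH1 (s n))
    (hC : ∀ ε > 0, ∃ N, ∀ m ≥ N, ∀ n ≥ N, dirichletForm (s m - s n) (s m - s n) < ε)
    (hf : ∀ t ∈ Icc (0 : ℝ) 1, Tendsto (fun n => s n t) atTop (𝓝 (f t))) :
    MemH1 f ∧ Tendsto (fun n => dirichletForm (s n - f) (s n - f)) atTop (𝓝 0) := by
  have p := fun n => (hs n).isPrimitive
  set G := fun n => (p n).1.toLp (weakDeriv (s n)) with hG
  have hGC : CauchySeq G := by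
    rw [Metric.cauchySeq_iff]
    intro ε hε
    obtain ⟨N, hN⟩ := hC (ε ^ 2) (by positivity)
    refine ⟨N, fun m hm n hn => ?_⟩
    have h1 := hN m hm n hn
    rw [dirichletForm_eq ((p m).sub (p n)) ((p m).sub (p n)),
      ← norm_toLp_sub_sq (p m).1 (p n).1] at h1
    rw [dist_eq_norm]
    exact lt_of_pow_lt_pow_left₀ 2 hε.le h1
  obtain ⟨L, hL⟩ := cauchySeq_tendsto_of_complete hGC
  let g : ℝ → ℝ := ⇑(L : ℝ →ₘ[volume.restrict (Icc (0 : ℝ) 1)] ℝ)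
  have hgm : MemLp g 2 (volume.restrict (Icc (0 : ℝ) 1)) := Lp.memLp L
  have hLg : hgm.toLp g = L := Lp.toLp_coeFn L hgm
  have hlim : Tendsto (fun n => ∫ x in Icc (0 : ℝ) 1,
      (weakDeriv (s n) - g) x * (weakDeriv (s n) - g) x) atTop (𝓝 0) := by
    have h1 : Tendsto (fun n => ‖G n - L‖ ^ 2) atTop (𝓝 (0 ^ 2)) :=
      (tendsto_iff_norm_sub_tendsto_zero.1 hL).pow 2
    rw [zero_pow two_ne_zero] at h1
    refine h1.congr fun n => ?_
    rw [← norm_toLp_sub_sq (p n).1 hgm, hLg]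
  have hpf : IsPrimitive f g := by
    refine ⟨hgm, fun t ht => ?_⟩
    have h0 := hf 0 (by simp)
    have h1 := hf t ht
    -- By the Hölder estimate the squared error is at most the energy of `s n` minus the primitive
    -- of the L² limit `g`; so the pointwise limit `f` must agree with that primitive up to a
    -- constant.
    have h2 : Tendsto (fun n => (s n t - s n 0 - ∫ x in (0 : ℝ)..t, g x) ^ 2) atTop (𝓝 0) := by
      refine squeeze_zero (fun n => sq_nonneg _) (fun n => ?_) hlim
      have q : IsPrimitive (fun t => ∫ x in (0 : ℝ)..t, g x) g := ⟨hgm, fun t _ => by simp⟩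
      have q' := (p n).sub q
      have := q'.memH1.sq_sub_le (s := 0) (by simp) ht
      rw [dirichletForm_eq q' q'] at this
      simp only [Pi.sub_apply, intervalIntegral.integral_same, sub_zero] at this
      refine le_trans (le_of_eq (by ring)) (this.trans ?_)
      rw [abs_of_nonneg ht.1]
      refine mul_le_of_le_one_left ?_ ht.2
      exact integral_nonneg fun x => mul_self_nonneg _
    have h3 := tendsto_nhds_unique h2 (((h1.sub h0).sub_const (∫ x in (0 : ℝ)..t, g x)).pow 2)
    have h4 := pow_eq_zero_iff (two_ne_zero) |>.1 h3.symm
    linarith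
  refine ⟨hpf.memH1, hlim.congr fun n => ?_⟩
  rw [dirichletForm_eq ((p n).sub hpf) ((p n).sub hpf)]

/-! ## Geometry of the stretched Sierpinski gasket -/

namespace SSGSetup

variable (D : SSGSetup)

/-! ### Barycentric coordinates. -/

/-- The three unit side lengths and the three products of p_i with the zero sum are six linear
equations for the six inner products. -/
theorem inner_p (i j : Fin 3) :
    inner ℝ (D.p i) (D.p j) = if i = j then (1 / 3 : ℝ) else -(1 / 6) := by
  have hs := D.sum_p
  have hd : ∀ i j, i ≠ j → ‖D.p i‖ ^ 2 - 2 * inner ℝ (D.p i) (D.p j) + ‖D.p j‖ ^ 2 = 1 := by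
    intro i j hij
    rw [← norm_sub_sq_real, ← dist_eq_norm, D.dist_p i j hij, one_pow]
  have h0 : inner ℝ (D.p 0) (D.p 0 + D.p 1 + D.p 2) = (0 : ℝ) := by rw [hs, inner_zero_right]
  have h1 : inner ℝ (D.p 1) (D.p 0 + D.p 1 + D.p 2) = (0 : ℝ) := by rw [hs, inner_zero_right]
  have h2 : inner ℝ (D.p 2) (D.p 0 + D.p 1 + D.p 2) = (0 : ℝ) := by rw [hs, inner_zero_right]
  simp only [inner_add_right] at h0 h1 h2
  have a := hd 0 1 (by decide)
  have b := hd 1 2 (by decide)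
  have c := hd 0 2 (by decide)
  simp only [← real_inner_self_eq_norm_sq] at a b c
  have e1 := real_inner_comm (D.p 0) (D.p 1)
  have e2 := real_inner_comm (D.p 0) (D.p 2)
  have e3 := real_inner_comm (D.p 1) (D.p 2)
  fin_cases i <;> fin_cases j <;> simp <;> (try simp only [← real_inner_self_eq_norm_sq]) <;>
    linarith

/-- Barycentric coordinates with respect to the triangle with vertices `p_i`. -/
noncomputable def bary (i : Fin 3) (x : Plane) : ℝ := 1 / 3 + 2 * inner ℝ (D.p i) x

theorem continuous_bary (i : Fin 3) : Continuous (D.bary i) := by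
  unfold bary; fun_prop

theorem bary_p (i j : Fin 3) : D.bary i (D.p j) = if i = j then 1 else 0 := by
  rw [bary, inner_p]
  split_ifs <;> norm_num

theorem bary_add_smul (i : Fin 3) {s t : ℝ} (h : s + t = 1) (x y : Plane) :
    D.bary i (s • x + t • y) = s * D.bary i x + t * D.bary i y := by
  simp only [bary, inner_add_right, inner_smul_right]
  linear_combination (-1 / 3 : ℝ) * h

theorem sum_bary (x : Plane) : D.bary 0 x + D.bary 1 x + D.bary 2 x = 1 := by
  have h : inner ℝ (D.p 0 + D.p 1 + D.p 2) x = (0 : ℝ) := by rw [D.sum_p, inner_zero_left]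
  simp only [inner_add_left] at h
  simp only [bary]
  linarith

theorem span_p : Submodule.span ℝ (range D.p) = ⊤ := by
  have hli : LinearIndependent ℝ ![D.p 0, D.p 1] := by
    rw [LinearIndependent.pair_iff]
    intro s t h
    have h0 : inner ℝ (D.p 0) (s • D.p 0 + t • D.p 1) = (0 : ℝ) := by rw [h, inner_zero_right]
    have h1 : inner ℝ (D.p 1) (s • D.p 0 + t • D.p 1) = (0 : ℝ) := by rw [h, inner_zero_right]
    simp only [inner_add_right, inner_smul_right, inner_p] at h0 h1
    norm_num at h0 h1
    constructor <;> linarith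
  have h2 := hli.span_eq_top_of_card_eq_finrank (by simp)
  rw [eq_top_iff, ← h2]
  refine Submodule.span_mono ?_
  rintro _ ⟨i, rfl⟩
  fin_cases i
  · exact ⟨0, rfl⟩
  · exact ⟨1, rfl⟩

/-- The difference of the two sides is orthogonal to every p_i, and these span the plane. -/
theorem bary_reconstruct (x : Plane) :
    x = D.bary 0 x • D.p 0 + D.bary 1 x • D.p 1 + D.bary 2 x • D.p 2 := by
  set y := D.bary 0 x • D.p 0 + D.bary 1 x • D.p 1 + D.bary 2 x • D.p 2 with hy
  have hz : ∀ i, inner ℝ (D.p i) (x - y) = (0 : ℝ) := by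
    intro i
    have hs := D.sum_bary x
    have hi : inner ℝ (D.p i) x = (D.bary i x - 1 / 3) / 2 := by rw [bary]; ring
    rw [hy]
    simp only [inner_sub_right, inner_add_right, inner_smul_right, inner_p]
    rw [hi]
    fin_cases i <;> simp <;> linarith
  have hall : ∀ z ∈ Submodule.span ℝ (range D.p), inner ℝ z (x - y) = (0 : ℝ) := by
    intro z hz'
    induction hz' using Submodule.span_induction with
    | mem z h => obtain ⟨i, rfl⟩ := h; exact hz i
    | zero => exact inner_zero_left _
    | add a b _ _ ha hb => rw [inner_add_left, ha, hb, add_zero]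
    | smul c a _ ha => rw [inner_smul_left, ha, mul_zero]
  have := hall (x - y) (by rw [D.span_p]; trivial)
  rw [inner_self_eq_zero] at this
  exact sub_eq_zero.1 this

/-- The contraction ratio of the maps `G_i`. -/
noncomputable def ratio : ℝ := (1 - D.α) / 2

theorem ratio_pos : 0 < D.ratio := by
  have := D.α_lt_one
  unfold ratio; linarith

theorem ratio_lt_half : D.ratio < 1 / 2 := by
  have := D.α_pos
  unfold ratio; linarith

theorem G_eq (i : Fin 3) (x : Plane) : D.G i x = D.ratio • x + (1 - D.ratio) • D.p i := by
  unfold G ratio; module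

theorem bary_G (i j : Fin 3) (x : Plane) :
    D.bary i (D.G j x) = D.ratio * D.bary i x + (1 - D.ratio) * if i = j then 1 else 0 := by
  rw [G_eq, bary_add_smul _ _ (by ring), bary_p]

theorem bary_bondPath (i b : Fin 3) (t : ℝ) : D.bary i (D.bondPath b t) =
    (1 - t) * (D.ratio * (if i = b + 1 then 1 else 0) + (1 - D.ratio) * if i = b then 1 else 0) +
      t * (D.ratio * (if i = b then 1 else 0) + (1 - D.ratio) * if i = b + 1 then 1 else 0) := by
  rw [bondPath, bary_add_smul _ _ (by ring), bary_G, bary_G, bary_p, bary_p]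

theorem bary_bondPath_self (b : Fin 3) (t : ℝ) :
    D.bary b (D.bondPath b t) = (1 - t) * (1 - D.ratio) + t * D.ratio := by
  rw [bary_bondPath]
  have : ¬b = b + 1 := by revert b; decide
  simp [this]

theorem bary_bondPath_succ (b : Fin 3) (t : ℝ) :
    D.bary (b + 1) (D.bondPath b t) = (1 - t) * D.ratio + t * (1 - D.ratio) := by
  rw [bary_bondPath]
  have : ¬b + 1 = b := by revert b; decide
  simp [this]

theorem bary_bondPath_of_ne {i b : Fin 3} (h : i ≠ b) (h' : i ≠ b + 1) (t : ℝ) :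
    D.bary i (D.bondPath b t) = 0 := by
  rw [bary_bondPath]
  simp [h, h']

/-! ### Cells, bonds and the covering of K. -/

theorem continuous_wordMap (w : List (Fin 3)) : Continuous (D.wordMap w) := by
  induction w with
  | nil => exact continuous_id
  | cons i w ih => exact (D.continuous_G i).comp ih

theorem continuous_cellMap (w : List (Fin 3)) : Continuous (D.cellMap w) :=
  ((D.continuous_wordMap w).comp continuous_subtype_val).subtype_mk _

theorem continuous_edgePath (w : List (Fin 3)) (b : Fin 3) : Continuous (D.edgePath w b) := by
  refine (D.continuous_cellMap w).comp (Continuous.subtype_mk ?_ _)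
  unfold bondPath; fun_prop

theorem cellMap_cons (i : Fin 3) (w : List (Fin 3)) (x : D.K) :
    D.cellMap (i :: w) x = D.cellMap [i] (D.cellMap w x) := rfl

theorem cellMap_nil (x : D.K) : D.cellMap [] x = x := rfl

theorem edgePath_cons (i : Fin 3) (w : List (Fin 3)) (b : Fin 3) (t : Icc (0 : ℝ) 1) :
    D.edgePath (i :: w) b t = D.cellMap [i] (D.edgePath w b t) := rfl

theorem coe_cellMap_singleton (i : Fin 3) (x : D.K) : (D.cellMap [i] x : Plane) = D.G i x := rfl

theorem coe_edgePath_nil (b : Fin 3) (t : Icc (0 : ℝ) 1) :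
    (D.edgePath [] b t : Plane) = D.bondPath b t := rfl

theorem dist_cellMap_singleton (i : Fin 3) (x y : D.K) :
    dist (D.cellMap [i] x) (D.cellMap [i] y) = D.ratio * dist x y :=
  D.dist_G i x y

theorem G_p_self (i : Fin 3) : D.G i (D.p i) = D.p i := by
  simp [G]

theorem cellMap_vertex_self (i : Fin 3) : D.cellMap [i] (D.vertex i) = D.vertex i :=
  Subtype.ext (D.G_p_self i)

theorem edgePath_nil_zero (b : Fin 3) : D.edgePath [] b 0 = D.cellMap [b] (D.vertex (b + 1)) := by
  refine Subtype.ext ?_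
  rw [coe_edgePath_nil]
  simp [bondPath, vertex, coe_cellMap_singleton]

theorem edgePath_nil_one (b : Fin 3) : D.edgePath [] b 1 = D.cellMap [b + 1] (D.vertex b) := by
  refine Subtype.ext ?_
  rw [coe_edgePath_nil]
  simp [bondPath, vertex, coe_cellMap_singleton]

/-- The covering of `K` by the cells `G_i(K)` and the bonds `e_{ij}`. -/
noncomputable def cover : (Fin 3 × D.K) ⊕ (Fin 3 × Icc (0 : ℝ) 1) → D.K :=
  Sum.elim (fun a => D.cellMap [a.1] a.2) fun a => D.edgePath [] a.1 a.2

theorem cover_surjective : Function.Surjective D.cover := by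
  rintro ⟨x, hx⟩
  have h := hx
  rw [D.K_eq] at h
  rcases h with h | h
  · obtain ⟨i, y, hy, rfl⟩ := mem_iUnion.1 h
    exact ⟨Sum.inl (i, ⟨y, hy⟩), rfl⟩
  · obtain ⟨b, t, ht, rfl⟩ := mem_iUnion.1 h
    exact ⟨Sum.inr (b, ⟨t, ht⟩), rfl⟩

theorem continuous_cover : Continuous D.cover := by
  refine Continuous.sumElim ?_ ?_
  · exact continuous_prod_of_discrete_left.2 fun i => D.continuous_cellMap [i]
  · exact continuous_prod_of_discrete_left.2 fun b => D.continuous_edgePath [] b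

instance : CompactSpace D.K := isCompact_iff_compactSpace.1 D.isCompact_K

theorem isClosedMap_cover : IsClosedMap D.cover := D.continuous_cover.isClosedMap

theorem cases_K {P : D.K → Prop} (h1 : ∀ i y, P (D.cellMap [i] y))
    (h2 : ∀ b t, P (D.edgePath [] b t)) (x : D.K) : P x := by
  obtain ⟨a, rfl⟩ := D.cover_surjective x
  rcases a with a | a
  · exact h1 a.1 a.2
  · exact h2 a.1 a.2

/-- A property holds near a point of `K` if it holds near this point in every cell and every bond
containing it. -/
theorem eventually_nhds_of_cover {P : D.K → Prop} {x : D.K}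
    (h1 : ∀ i y, D.cellMap [i] y = x → ∀ᶠ z in 𝓝 y, P (D.cellMap [i] z))
    (h2 : ∀ b t, D.edgePath [] b t = x → ∀ᶠ s in 𝓝 t, P (D.edgePath [] b s)) :
    ∀ᶠ z in 𝓝 x, P z := by
  -- `cover` is a closed map, so a neighbourhood of a whole fibre contains the preimage of a
  -- neighbourhood of the point.
  have := D.isClosedMap_cover.eventually_nhds_fiber (p := fun a => P (D.cover a)) x ?_
  · filter_upwards [this] with z hz
    obtain ⟨a, rfl⟩ := D.cover_surjective z
    exact hz a rfl
  · rintro (⟨i, y⟩ | ⟨b, t⟩) ha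
    · rw [nhds_inl, eventually_map, nhds_prod_eq, nhds_discrete, pure_prod, eventually_map]
      exact h1 i y ha
    · rw [nhds_inr, eventually_map, nhds_prod_eq, nhds_discrete, pure_prod, eventually_map]
      exact h2 b t ha

theorem exists_edge_or_cell (n : ℕ) (x : D.K) :
    (∃ w b t, D.edgePath w b t = x) ∨ ∃ w y, w.length = n ∧ D.cellMap w y = x := by
  induction n generalizing x with
  | zero => exact Or.inr ⟨[], x, rfl, rfl⟩
  | succ n ih =>
    refine D.cases_K (P := fun x => (∃ w b t, D.edgePath w b t = x) ∨
      ∃ w y, w.length = n + 1 ∧ D.cellMap w y = x) (fun i y => ?_) (fun b t => ?_) x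
    · rcases ih y with ⟨w, b, t, rfl⟩ | ⟨w, z, hw, rfl⟩
      · exact Or.inl ⟨i :: w, b, t, rfl⟩
      · exact Or.inr ⟨i :: w, z, by simp [hw], rfl⟩
    · exact Or.inl ⟨[], b, t, rfl⟩

theorem dist_cellMap (w : List (Fin 3)) (x y : D.K) :
    dist (D.cellMap w x) (D.cellMap w y) = D.ratio ^ w.length * dist x y := by
  induction w with
  | nil => simp [cellMap_nil]
  | cons i w ih =>
    rw [cellMap_cons, cellMap_cons _ i w y, dist_cellMap_singleton, ih, List.length_cons, pow_succ']
    ring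

/-- A point outside all edges lies in cells of every level n, whose diameters decay like `ratio ^
n`, and each cell contains an edge. Closed conditions on K therefore need checking on edges only. -/
theorem dense_edges :
    Dense {x : D.K | ∃ (w : List (Fin 3)) (b : Fin 3) (t : Icc (0 : ℝ) 1),
      D.edgePath w b t = x} := by
  intro x
  rw [Metric.mem_closure_iff]
  intro ε hε
  obtain ⟨C, hC⟩ := Metric.isBounded_iff.1 (isCompact_univ (X := D.K)).isBounded
  have h1 := D.ratio_pos
  have h2 := D.ratio_lt_half
  have ht : Tendsto (fun n : ℕ => D.ratio ^ n * C) atTop (𝓝 (0 * C)) :=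
    (tendsto_pow_atTop_nhds_zero_of_lt_one h1.le (by linarith)).mul_const C
  rw [zero_mul] at ht
  obtain ⟨n, hn⟩ := (ht.eventually_lt_const hε).exists
  rcases D.exists_edge_or_cell n x with ⟨w, b, t, rfl⟩ | ⟨w, y, rfl, rfl⟩
  · exact ⟨_, ⟨w, b, t, rfl⟩, by simpa using hε⟩
  · refine ⟨D.edgePath w 0 0, ⟨w, 0, 0, rfl⟩, lt_of_le_of_lt ?_ hn⟩
    change dist (D.cellMap w y) (D.cellMap w (D.edgePath [] 0 0)) ≤ _
    rw [dist_cellMap]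
    exact mul_le_mul_of_nonneg_left (hC trivial trivial) (by positivity)

theorem bary_cellMap (i j : Fin 3) (x : D.K) : D.bary i (D.cellMap [j] x : Plane) =
    D.ratio * D.bary i x + (1 - D.ratio) * if i = j then 1 else 0 :=
  D.bary_G i j x

theorem bary_nonneg (i : Fin 3) (x : D.K) : 0 ≤ D.bary i x := by
  have h1 := D.ratio_pos
  have h2 := D.ratio_lt_half
  have hcl : IsClosed {x : D.K | 0 ≤ D.bary i x} :=
    isClosed_le continuous_const ((D.continuous_bary i).comp continuous_subtype_val)
  have hsub : {x : D.K | ∃ w b t, D.edgePath w b t = x} ⊆ {x : D.K | 0 ≤ D.bary i x} := by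
    rintro _ ⟨w, b, t, rfl⟩
    change 0 ≤ D.bary i (D.edgePath w b t : Plane)
    induction w with
    | nil =>
      rw [coe_edgePath_nil, bary_bondPath]
      have a1 := t.2.1
      have a2 : (0 : ℝ) ≤ 1 - t := by linarith [t.2.2]
      have a3 : 0 ≤ 1 - D.ratio := by linarith
      positivity
    | cons j w ih =>
      rw [edgePath_cons, bary_cellMap]
      have a3 : 0 ≤ 1 - D.ratio := by linarith
      positivity
  exact closure_minimal hsub hcl (D.dense_edges x)

theorem bary_le_one (i : Fin 3) (x : D.K) : D.bary i x ≤ 1 := by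
  have h := D.sum_bary x
  have h0 := D.bary_nonneg 0 x
  have h1 := D.bary_nonneg 1 x
  have h2 := D.bary_nonneg 2 x
  fin_cases i <;> simp <;> linarith

theorem eq_p_of_bary_eq_one {i : Fin 3} {x : D.K} (h : D.bary i x = 1) : (x : Plane) = D.p i := by
  have hs := D.sum_bary x
  have h0 := D.bary_nonneg 0 x
  have h1 := D.bary_nonneg 1 x
  have h2 := D.bary_nonneg 2 x
  rw [D.bary_reconstruct x]
  fin_cases i <;> simp at h <;> rw [h] at hs
  · rw [h, (by linarith : D.bary 1 x = 0), (by linarith : D.bary 2 x = 0)]; simp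
  · rw [h, (by linarith : D.bary 0 x = 0), (by linarith : D.bary 2 x = 0)]; simp
  · rw [h, (by linarith : D.bary 0 x = 0), (by linarith : D.bary 1 x = 0)]; simp

/-! ### Intersections of cells and bonds, and gluing of functions. -/

theorem cellMap_injective (i : Fin 3) : Function.Injective (D.cellMap [i]) := by
  intro x y h
  have h1 := D.dist_cellMap_singleton i x y
  rw [h, dist_self] at h1
  rcases mul_eq_zero.1 h1.symm with h2 | h2
  · exact absurd h2 D.ratio_pos.ne'
  · exact dist_eq_zero.1 h2

/-- The i-th barycentric coordinate is at least 1 - `ratio` on the i-th cell and at most `ratio` on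
the others, and `ratio` < 1/2. -/
theorem cell_eq_cell {i j : Fin 3} {x y : D.K} (h : D.cellMap [i] x = D.cellMap [j] y) :
    i = j ∧ x = y := by
  have hij : i = j := by
    by_contra hij
    have e : D.bary i (D.cellMap [i] x : Plane) = D.bary i (D.cellMap [j] y : Plane) := by rw [h]
    rw [bary_cellMap, bary_cellMap, if_pos rfl, if_neg hij] at e
    have := D.bary_nonneg i x
    have := D.bary_le_one i y
    have := D.ratio_pos
    have := D.ratio_lt_half
    nlinarith
  subst hij
  exact ⟨rfl, D.cellMap_injective i h⟩

/-- On a bond the i-th coordinate reaches the value 1 - `ratio`, the least possible on the i-th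
cell, only at the endpoint belonging to that cell. -/
theorem cell_eq_bond {i b : Fin 3} {x : D.K} {t : Icc (0 : ℝ) 1}
    (h : D.cellMap [i] x = D.edgePath [] b t) :
    (i = b ∧ t = 0 ∧ x = D.vertex (b + 1)) ∨ (i = b + 1 ∧ t = 1 ∧ x = D.vertex b) := by
  have e : D.bary i (D.cellMap [i] x : Plane) = D.bary i (D.bondPath b t) := by
    rw [h, coe_edgePath_nil]
  rw [bary_cellMap, if_pos rfl] at e
  have hx := D.bary_nonneg i x
  have r1 := D.ratio_pos
  have r2 := D.ratio_lt_half
  have t1 := t.2.1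
  have t2 := t.2.2
  by_cases hb : i = b
  · subst hb
    have ht : t = 0 := by
      rw [bary_bondPath_self] at e
      refine Subtype.ext (le_antisymm ?_ t1)
      change (t : ℝ) ≤ 0
      nlinarith
    subst ht
    rw [edgePath_nil_zero] at h
    exact Or.inl ⟨rfl, rfl, D.cellMap_injective i h⟩
  by_cases hb' : i = b + 1
  · subst hb'
    have ht : t = 1 := by
      rw [bary_bondPath_succ] at e
      refine Subtype.ext (le_antisymm t2 ?_)
      change 1 ≤ (t : ℝ)
      nlinarith
    subst ht
    rw [edgePath_nil_one] at h
    exact Or.inr ⟨rfl, rfl, D.cellMap_injective _ h⟩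
  rw [D.bary_bondPath_of_ne hb hb'] at e
  nlinarith

theorem bond_eq_bond {b b' : Fin 3} {t t' : Icc (0 : ℝ) 1}
    (h : D.edgePath [] b t = D.edgePath [] b' t') : b = b' ∧ t = t' := by
  have e : ∀ i, D.bary i (D.bondPath b t) = D.bary i (D.bondPath b' t') := fun i => by
    rw [← coe_edgePath_nil, h, coe_edgePath_nil]
  have r1 := D.ratio_pos
  have r2 := D.ratio_lt_half
  have s1 := t'.2.1
  have s2 := t'.2.2
  have hpos : ∀ b, 0 < D.bary b (D.bondPath b t') ∧ 0 < D.bary (b + 1) (D.bondPath b t') := by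
    intro b
    rw [bary_bondPath_self, bary_bondPath_succ]
    constructor <;> nlinarith
  -- The two coordinates with indices b' and b' + 1 are positive on bond b', while only those with
  -- indices b and b + 1 can be nonzero on bond b; this pair of indices determines the bond.
  have hb : b = b' := by
    have k1 : ¬(b' ≠ b ∧ b' ≠ b + 1) := fun hh => by
      have := e b'
      rw [D.bary_bondPath_of_ne hh.1 hh.2] at this
      linarith [(hpos b').1]
    have k2 : ¬(b' + 1 ≠ b ∧ b' + 1 ≠ b + 1) := fun hh => by
      have := e (b' + 1)
      rw [D.bary_bondPath_of_ne hh.1 hh.2] at this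
      linarith [(hpos b').2]
    revert k1 k2
    clear * -
    revert b b'
    decide
  subst hb
  refine ⟨rfl, Subtype.ext ?_⟩
  have := e b
  rw [bary_bondPath_self, bary_bondPath_self] at this
  have h3 : ((t : ℝ) - t') * (1 - 2 * D.ratio) = 0 := by linarith
  rcases mul_eq_zero.1 h3 with h4 | h4
  · linarith
  · linarith

/-- The function on `K` that equals `f i ∘ G_i⁻¹` on `G_i(K)` and `g b` on the bond `b`. -/
noncomputable def glue (f : Fin 3 → D.K → ℝ) (g : Fin 3 → Icc (0 : ℝ) 1 → ℝ) (x : D.K) : ℝ :=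
  Sum.elim (fun a : Fin 3 × D.K => f a.1 a.2) (fun a : Fin 3 × Icc (0 : ℝ) 1 => g a.1 a.2)
    (Function.surjInv D.cover_surjective x)

section Glue

variable {f : Fin 3 → D.K → ℝ} {g : Fin 3 → Icc (0 : ℝ) 1 → ℝ}
  (h0 : ∀ b, g b 0 = f b (D.vertex (b + 1))) (h1 : ∀ b, g b 1 = f (b + 1) (D.vertex b))
include h0 h1

/-- The pieces of the covering meet only at endpoints of bonds, so agreement there makes the glued
value independent of the chosen preimage. -/
theorem glue_cover (a : (Fin 3 × D.K) ⊕ (Fin 3 × Icc (0 : ℝ) 1)) : D.glue f g (D.cover a) =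
    Sum.elim (fun a : Fin 3 × D.K => f a.1 a.2) (fun a : Fin 3 × Icc (0 : ℝ) 1 => g a.1 a.2) a := by
  have key : ∀ a a', D.cover a = D.cover a' →
      Sum.elim (fun a : Fin 3 × D.K => f a.1 a.2) (fun a : Fin 3 × Icc (0 : ℝ) 1 => g a.1 a.2) a =
      Sum.elim (fun a : Fin 3 × D.K => f a.1 a.2)
        (fun a : Fin 3 × Icc (0 : ℝ) 1 => g a.1 a.2) a' := by
    have mixed : ∀ i x b t, D.cellMap [i] x = D.edgePath [] b t → f i x = g b t := by
      intro i x b t h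
      rcases D.cell_eq_bond h with ⟨rfl, rfl, rfl⟩ | ⟨rfl, rfl, rfl⟩
      · exact (h0 i).symm
      · exact (h1 b).symm
    rintro (⟨i, x⟩ | ⟨b, t⟩) (⟨j, y⟩ | ⟨b', t'⟩) h
    · obtain ⟨rfl, rfl⟩ := D.cell_eq_cell h
      rfl
    · exact mixed i x b' t' h
    · exact (mixed j y b t h.symm).symm
    · obtain ⟨rfl, rfl⟩ := D.bond_eq_bond h
      rfl
  exact key _ _ (Function.surjInv_eq D.cover_surjective _)

theorem glue_cellMap (i : Fin 3) (x : D.K) : D.glue f g (D.cellMap [i] x) = f i x :=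
  D.glue_cover h0 h1 (Sum.inl (i, x))

theorem glue_edgePath (b : Fin 3) (t : Icc (0 : ℝ) 1) : D.glue f g (D.edgePath [] b t) = g b t :=
  D.glue_cover h0 h1 (Sum.inr (b, t))

end Glue

theorem continuous_of_cover {u : D.K → ℝ} (hf : ∀ i, Continuous (u ∘ D.cellMap [i]))
    (hg : ∀ b, Continuous (u ∘ D.edgePath [] b)) : Continuous u := by
  have hq := D.isClosedMap_cover.isQuotientMap D.continuous_cover D.cover_surjective
  rw [hq.continuous_iff, continuous_sum_dom]
  exact ⟨continuous_prod_of_discrete_left.2 hf, continuous_prod_of_discrete_left.2 hg⟩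

/-! ### Symmetries -/

section Symmetry

variable {φ : Plane →ₗ[ℝ] Plane} (hφ : φ '' D.K = D.K)
include hφ

/-- Each p_i is an extreme point: it is the only point of K where the i-th coordinate is 1. If y in
K is mapped to p_i, then p_i is a convex combination of the images of the vertices, so one of these
images must be p_i itself. -/
theorem exists_perm_of_image_eq : ∃ σ : Equiv.Perm (Fin 3), ∀ i, φ (D.p i) = D.p (σ i) := by
  have himg : ∀ x : D.K, φ x ∈ D.K := fun x => hφ.subset (mem_image_of_mem φ x.2)
  have hex : ∀ i, ∃ j, φ (D.p j) = D.p i := by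
    intro i
    obtain ⟨y, hy, hyi⟩ := hφ.symm.subset (D.p_mem_K i)
    by_contra! hne
    have hlt : ∀ j, D.bary i (φ (D.p j)) < 1 := by
      intro j
      refine lt_of_le_of_ne (D.bary_le_one i ⟨_, himg (D.vertex j)⟩) fun h => hne j ?_
      exact D.eq_p_of_bary_eq_one (x := ⟨_, himg (D.vertex j)⟩) h
    have e : D.bary i (D.p i) = D.bary 0 y * D.bary i (φ (D.p 0)) +
        D.bary 1 y * D.bary i (φ (D.p 1)) + D.bary 2 y * D.bary i (φ (D.p 2)) := by
      have hs := D.sum_bary y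
      rw [← hyi]
      conv_lhs => rw [D.bary_reconstruct y]
      simp only [map_add, map_smul]
      simp only [bary, inner_add_right, inner_smul_right] at hs ⊢
      linear_combination (-1 / 3 : ℝ) * hs
    rw [bary_p, if_pos rfl] at e
    have hs := D.sum_bary y
    have y0 := D.bary_nonneg 0 ⟨y, hy⟩
    have y1 := D.bary_nonneg 1 ⟨y, hy⟩
    have y2 := D.bary_nonneg 2 ⟨y, hy⟩
    have l0 := hlt 0
    have l1 := hlt 1
    have l2 := hlt 2
    simp only at y0 y1 y2
    have : 0 < D.bary 0 y ∨ 0 < D.bary 1 y ∨ 0 < D.bary 2 y := by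
      by_contra! hcon
      linarith [hcon.1, hcon.2.1, hcon.2.2]
    have m0 := mul_nonneg y0 (sub_nonneg.2 l0.le)
    have m1 := mul_nonneg y1 (sub_nonneg.2 l1.le)
    have m2 := mul_nonneg y2 (sub_nonneg.2 l2.le)
    rcases this with h | h | h
    · nlinarith [mul_pos h (sub_pos.2 l0)]
    · nlinarith [mul_pos h (sub_pos.2 l1)]
    · nlinarith [mul_pos h (sub_pos.2 l2)]
  choose τ hτ using hex
  have hinj : Function.Injective τ := by
    intro i j h
    have : D.p i = D.p j := by rw [← hτ i, ← hτ j, h]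
    by_contra hij
    have h1 := D.dist_p i j hij
    rw [this, dist_self] at h1
    norm_num at h1
  let e := Equiv.ofBijective τ (Finite.injective_iff_bijective.1 hinj)
  refine ⟨e.symm, fun i => ?_⟩
  have := hτ (e.symm i)
  rwa [show τ (e.symm i) = i from e.apply_symm_apply i] at this

end Symmetry

section Perm

variable {φ : Plane →ₗ[ℝ] Plane} {σ : Equiv.Perm (Fin 3)} (hσ : ∀ i, φ (D.p i) = D.p (σ i))
include hσ

theorem map_G (i : Fin 3) (x : Plane) : φ (D.G i x) = D.G (σ i) (φ x) := by
  simp [G, hσ]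

theorem map_wordMap (w : List (Fin 3)) (x : Plane) :
    φ (D.wordMap w x) = D.wordMap (w.map σ) (φ x) := by
  induction w with
  | nil => rfl
  | cons i w ih =>
    change φ (D.G i (D.wordMap w x)) = D.G (σ i) (D.wordMap (w.map σ) (φ x))
    rw [D.map_G hσ, ih]

theorem map_bondPath_of_succ {b : Fin 3} (h : σ (b + 1) = σ b + 1) (t : ℝ) :
    φ (D.bondPath b t) = D.bondPath (σ b) t := by
  simp [bondPath, D.map_G hσ, hσ, h]

theorem map_bondPath_of_pred {b : Fin 3} (h : σ (b + 1) + 1 = σ b) (t : ℝ) :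
    φ (D.bondPath b t) = D.bondPath (σ (b + 1)) (1 - t) := by
  simp [bondPath, D.map_G hσ, hσ, ← h, add_comm]

end Perm

/-- Rotations preserve the cyclic order used to index the bonds, reflections reverse it. -/
theorem perm_three (σ : Equiv.Perm (Fin 3)) :
    (∀ b, σ (b + 1) = σ b + 1) ∨ ∀ b, σ (b + 1) + 1 = σ b := by
  revert σ; decide

end SSGSetup

/-! ## Self-similar decomposition of the forms -/

namespace MatchingSeq

variable (R : MatchingSeq)

theorem r_eq (k : ℕ) : R.r k = 3 / 5 * (1 - R.ρ k) := by
  have := R.matching k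
  linarith

theorem ρ_lt_one (k : ℕ) : R.ρ k < 1 := by
  have := R.matching k
  have := R.r_pos k
  linarith

theorem r_le (k : ℕ) : R.r k ≤ 3 / 5 := by
  have := R.r_eq k
  have := R.ρ_pos k
  linarith

/-- The sequence of matching pairs with its first member dropped. -/
def shift : MatchingSeq where
  r k := R.r (k + 1)
  ρ k := R.ρ (k + 1)
  r_pos k := R.r_pos (k + 1)
  ρ_pos k := R.ρ_pos (k + 1)
  matching k := R.matching (k + 1)

theorem δ_pos (m : ℕ) : 0 < R.δ m := Finset.prod_pos fun i _ => R.r_pos i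

theorem γ_pos (k : ℕ) : 0 < R.γ k := mul_pos (R.δ_pos k) (R.ρ_pos k)

theorem δ_zero : R.δ 0 = 1 := by simp [δ]

theorem δ_succ (m : ℕ) : R.δ (m + 1) = R.r 0 * R.shift.δ m := by
  rw [δ, Finset.prod_range_succ', mul_comm]
  rfl

theorem γ_zero : R.γ 0 = R.ρ 0 := by simp [γ, δ_zero]

theorem γ_succ (k : ℕ) : R.γ (k + 1) = R.r 0 * R.shift.γ k := by
  rw [γ, δ_succ, mul_assoc]
  rfl

end MatchingSeq

namespace SSGSetup

variable (D : SSGSetup) (R : MatchingSeq)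

theorem sum_words_succ {M : Type*} [AddCommMonoid M] (k : ℕ) (F : List (Fin 3) → M) :
    ∑ w : Fin (k + 1) → Fin 3, F (List.ofFn w) =
      ∑ i : Fin 3, ∑ w : Fin k → Fin 3, F (i :: List.ofFn w) := by
  rw [← (Fin.consEquiv fun _ : Fin (k + 1) => Fin 3).sum_comp, Fintype.sum_prod_type]
  simp [Fin.consEquiv]

theorem lineForm_zero (u v : D.K → ℝ) :
    D.lineForm 0 u v = ∑ b : Fin 3, dirichletForm (D.onEdge u [] b) (D.onEdge v [] b) := by
  simp [lineForm]

theorem lineForm_succ (k : ℕ) (u v : D.K → ℝ) : D.lineForm (k + 1) u v =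
    ∑ i : Fin 3, D.lineForm k (u ∘ D.cellMap [i]) (v ∘ D.cellMap [i]) :=
  sum_words_succ k fun w => ∑ b : Fin 3, dirichletForm (D.onEdge u w b) (D.onEdge v w b)

theorem Qm_zero (u v : D.K → ℝ) : D.Qm 0 u v = D.Q0 u v := by
  simp [Qm]
  rfl

theorem Qm_succ (m : ℕ) (u v : D.K → ℝ) : D.Qm (m + 1) u v =
    ∑ i : Fin 3, D.Qm m (u ∘ D.cellMap [i]) (v ∘ D.cellMap [i]) :=
  sum_words_succ m fun w => D.Q0 (u ∘ D.cellMap w) (v ∘ D.cellMap w)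

theorem Q0_self_nonneg (u : D.K → ℝ) : 0 ≤ D.Q0 u u :=
  Finset.sum_nonneg fun _ _ => mul_self_nonneg _

theorem Qm_self_nonneg (m : ℕ) (u : D.K → ℝ) : 0 ≤ D.Qm m u u :=
  Finset.sum_nonneg fun _ _ => D.Q0_self_nonneg _

theorem lineForm_self_nonneg (k : ℕ) (u : D.K → ℝ) : 0 ≤ D.lineForm k u u :=
  Finset.sum_nonneg fun _ _ => Finset.sum_nonneg fun _ _ => dirichletForm_self_nonneg _

theorem continuous_onEdge_iff {u : D.K → ℝ} {w : List (Fin 3)} {b : Fin 3} :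
    ContinuousOn (D.onEdge u w b) (Icc 0 1) ↔ Continuous (u ∘ D.edgePath w b) := by
  rw [continuousOn_iff_continuous_domRestrict, onEdge, domRestrict_def]
  simp only [IccExtend_val]

theorem onEdge_coe (u : D.K → ℝ) (w : List (Fin 3)) (b : Fin 3) (t : Icc (0 : ℝ) 1) :
    D.onEdge u w b t = u (D.edgePath w b t) :=
  IccExtend_val _ _ t

/-- Both parts of the approximating form are nonnegative, so convergence bounds the partial sums of
the line part and the SG part becomes the limit of the remaining term. After this the default values
of `limUnder` and `tsum` play no role, and only this description of the domain is used. -/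
theorem mem_lineDomain_iff {u : D.K → ℝ} : u ∈ D.lineDomain R ↔ u ∈ D.tildeF ∧
    Summable (fun k => (R.γ k)⁻¹ * D.lineForm k u u) ∧
    Tendsto (fun m => (R.δ m)⁻¹ * D.Qm m u u) atTop (𝓝 0) := by
  have hterm : ∀ k, 0 ≤ (R.γ k)⁻¹ * D.lineForm k u u := fun k =>
    mul_nonneg (inv_nonneg.2 (R.γ_pos k).le) (D.lineForm_self_nonneg k u)
  have hQ : ∀ m, 0 ≤ (R.δ m)⁻¹ * D.Qm m u u := fun m =>
    mul_nonneg (inv_nonneg.2 (R.δ_pos m).le) (D.Qm_self_nonneg m u)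
  constructor
  · rintro ⟨⟨hu, L, hL⟩, hsg⟩
    have hsum : Summable (fun k => (R.γ k)⁻¹ * D.lineForm k u u) := by
      obtain ⟨C, hC⟩ := hL.bddAbove_range
      refine summable_of_sum_range_le hterm (c := C) fun m => ?_
      have := hC ⟨m, rfl⟩
      simp only [approxForm] at this
      linarith [hQ m]
    refine ⟨hu, hsum, ?_⟩
    have hform : D.form R u u = L := hL.limUnder_eq
    have ht := hL.sub hsum.hasSum.tendsto_sum_nat
    simp only [approxForm, add_sub_cancel_right] at ht
    rw [sgPart, hform, linePart] at hsg
    rwa [hsg] at ht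
  · rintro ⟨hu, hsum, h0⟩
    have ht := h0.add hsum.hasSum.tendsto_sum_nat
    rw [zero_add] at ht
    refine ⟨⟨hu, _, ht⟩, ?_⟩
    have hform : D.form R u u = D.linePart R u u := Tendsto.limUnder_eq ht
    rw [sgPart, hform, sub_self]

variable {D R}

theorem continuous_of_mem {u : D.K → ℝ} (hu : u ∈ D.lineDomain R) : Continuous u := hu.1.1.1

theorem memH1_of_mem {u : D.K → ℝ} (hu : u ∈ D.lineDomain R) (w : List (Fin 3)) (b : Fin 3) :
    MemH1 (D.onEdge u w b) := hu.1.1.2 w b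

theorem comp_cellMap_mem {u : D.K → ℝ} (hu : u ∈ D.lineDomain R) (i : Fin 3) :
    u ∘ D.cellMap [i] ∈ D.lineDomain R.shift := by
  rw [mem_lineDomain_iff] at hu ⊢
  obtain ⟨hu1, hu2, hu3⟩ := hu
  refine ⟨⟨hu1.1.comp (D.continuous_cellMap [i]), fun w b => hu1.2 (i :: w) b⟩, ?_, ?_⟩
  · refine Summable.of_nonneg_of_le (fun k => mul_nonneg (inv_nonneg.2 (R.shift.γ_pos k).le)
      (D.lineForm_self_nonneg k _)) (fun k => ?_)
      (((summable_nat_add_iff 1).2 hu2).mul_left (R.r 0))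
    rw [R.γ_succ, D.lineForm_succ, mul_inv, mul_assoc, mul_inv_cancel_left₀ (R.r_pos 0).ne']
    refine mul_le_mul_of_nonneg_left ?_ (inv_nonneg.2 (R.shift.γ_pos k).le)
    exact Finset.single_le_sum
      (f := fun i => D.lineForm k (u ∘ D.cellMap [i]) (u ∘ D.cellMap [i]))
      (fun _ _ => D.lineForm_self_nonneg k _) (Finset.mem_univ i)
  · have h := ((tendsto_add_atTop_iff_nat 1).2 hu3).const_mul (R.r 0)
    rw [mul_zero] at h
    refine squeeze_zero (fun m => mul_nonneg (inv_nonneg.2 (R.shift.δ_pos m).le)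
      (D.Qm_self_nonneg m _)) (fun m => ?_) h
    rw [R.δ_succ, D.Qm_succ, mul_inv, mul_assoc, mul_inv_cancel_left₀ (R.r_pos 0).ne']
    refine mul_le_mul_of_nonneg_left ?_ (inv_nonneg.2 (R.shift.δ_pos m).le)
    exact Finset.single_le_sum (f := fun i => D.Qm m (u ∘ D.cellMap [i]) (u ∘ D.cellMap [i]))
      (fun _ _ => D.Qm_self_nonneg m _) (Finset.mem_univ i)

/-- Deleting the level-0 term affects neither summability nor limits, and the rest is r_0⁻¹ times a
finite sum over cells. This yields condition (a) and membership of glued functions. -/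
theorem mem_of_cells {u : D.K → ℝ} (hu : ∀ i, u ∘ D.cellMap [i] ∈ D.lineDomain R.shift)
    (hb : ∀ b, MemH1 (D.onEdge u [] b)) : u ∈ D.lineDomain R := by
  rw [mem_lineDomain_iff]
  have h := fun i => (mem_lineDomain_iff D R.shift).1 (hu i)
  refine ⟨⟨D.continuous_of_cover (fun i => (h i).1.1)
    fun b => D.continuous_onEdge_iff.1 (hb b).1, fun w b => ?_⟩, ?_, ?_⟩
  · cases w with
    | nil => exact hb b
    | cons i w => exact (h i).1.2 w b
  · rw [← summable_nat_add_iff 1]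
    refine ((summable_sum (s := Finset.univ) fun i _ => (h i).2.1).mul_left (R.r 0)⁻¹).congr
      fun k => ?_
    rw [R.γ_succ, D.lineForm_succ, mul_inv, mul_assoc, ← Finset.mul_sum]
  · rw [← tendsto_add_atTop_iff_nat 1]
    have := (tendsto_finsetSum Finset.univ fun i _ => (h i).2.2).const_mul (R.r 0)⁻¹
    simp only [Finset.sum_const_zero, mul_zero] at this
    refine this.congr fun m => ?_
    rw [R.δ_succ, D.Qm_succ, mul_inv, mul_assoc, ← Finset.mul_sum]

/-! ### Bilinearity -/

theorem onEdge_add (u v : D.K → ℝ) (w : List (Fin 3)) (b : Fin 3) :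
    D.onEdge (u + v) w b = D.onEdge u w b + D.onEdge v w b := rfl

theorem onEdge_smul (c : ℝ) (u : D.K → ℝ) (w : List (Fin 3)) (b : Fin 3) :
    D.onEdge (c • u) w b = c • D.onEdge u w b := rfl

theorem add_mem_tildeF {u v : D.K → ℝ} (hu : u ∈ D.tildeF) (hv : v ∈ D.tildeF) :
    u + v ∈ D.tildeF :=
  ⟨hu.1.add hv.1, fun w b => (hu.2 w b).add (hv.2 w b)⟩

theorem smul_mem_tildeF (c : ℝ) {u : D.K → ℝ} (hu : u ∈ D.tildeF) : c • u ∈ D.tildeF :=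
  ⟨hu.1.const_smul c, fun w b => (hu.2 w b).smul c⟩

theorem const_mem_tildeF (c : ℝ) : (fun _ => c) ∈ D.tildeF := by
  refine ⟨continuous_const, fun w b => (memH1_affine c 0).congr fun t _ => ?_⟩
  simp [onEdge, IccExtend]

theorem lineForm_comm (k : ℕ) (u v : D.K → ℝ) : D.lineForm k u v = D.lineForm k v u := by
  simp only [lineForm]
  exact Finset.sum_congr rfl fun _ _ => Finset.sum_congr rfl fun _ _ => dirichletForm_comm _ _

theorem lineForm_add_left (k : ℕ) {u v w : D.K → ℝ} (hu : u ∈ D.tildeF) (hv : v ∈ D.tildeF)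
    (hw : w ∈ D.tildeF) : D.lineForm k (u + v) w = D.lineForm k u w + D.lineForm k v w := by
  simp only [lineForm, onEdge_add, ← Finset.sum_add_distrib]
  exact Finset.sum_congr rfl fun s _ => Finset.sum_congr rfl fun b _ =>
    dirichletForm_add_left (hu.2 _ b) (hv.2 _ b) (hw.2 _ b)

theorem lineForm_smul_left (k : ℕ) (c : ℝ) {u w : D.K → ℝ} (hu : u ∈ D.tildeF)
    (hw : w ∈ D.tildeF) : D.lineForm k (c • u) w = c * D.lineForm k u w := by
  simp only [lineForm, onEdge_smul, Finset.mul_sum]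
  exact Finset.sum_congr rfl fun s _ => Finset.sum_congr rfl fun b _ =>
    dirichletForm_smul_left c (hu.2 _ b) (hw.2 _ b)

theorem lineForm_add_self (k : ℕ) {u v : D.K → ℝ} (hu : u ∈ D.tildeF) (hv : v ∈ D.tildeF) :
    D.lineForm k (u + v) (u + v) =
      D.lineForm k u u + 2 * D.lineForm k u v + D.lineForm k v v := by
  rw [lineForm_add_left k hu hv (add_mem_tildeF hu hv), lineForm_comm k u (u + v),
    lineForm_comm k v (u + v), lineForm_add_left k hu hv hu, lineForm_add_left k hu hv hv,
    lineForm_comm k v u]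
  ring

theorem lineForm_smul_self (k : ℕ) (c : ℝ) {u : D.K → ℝ} (hu : u ∈ D.tildeF) :
    D.lineForm k (c • u) (c • u) = c ^ 2 * D.lineForm k u u := by
  rw [lineForm_smul_left k c hu (smul_mem_tildeF c hu), lineForm_comm,
    lineForm_smul_left k c hu hu]
  ring

/-- Nonnegativity of the form at u + v and u - v. It makes the mixed series absolutely convergent.
-/
theorem abs_lineForm_le (k : ℕ) {u v : D.K → ℝ} (hu : u ∈ D.tildeF) (hv : v ∈ D.tildeF) :
    2 * |D.lineForm k u v| ≤ D.lineForm k u u + D.lineForm k v v := by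
  have h1 := D.lineForm_self_nonneg k (u + v)
  rw [lineForm_add_self k hu hv] at h1
  have h2 := D.lineForm_self_nonneg k (u + (-1 : ℝ) • v)
  have hv' := smul_mem_tildeF (-1) hv
  rw [lineForm_add_self k hu hv', lineForm_smul_self k _ hv, lineForm_comm k u (_ • v),
    lineForm_smul_left k _ hv hu, lineForm_comm k v u] at h2
  rcases abs_cases (D.lineForm k u v) with h | h <;> linarith

theorem Q0_add_le (u v : D.K → ℝ) : D.Q0 (u + v) (u + v) ≤ 2 * D.Q0 u u + 2 * D.Q0 v v := by
  simp only [Q0, Finset.mul_sum, ← Finset.sum_add_distrib, Pi.add_apply]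
  refine Finset.sum_le_sum fun b _ => ?_
  nlinarith [sq_nonneg (u (D.vertex b) - u (D.vertex (b + 1)) -
    (v (D.vertex b) - v (D.vertex (b + 1))))]

theorem Qm_add_le (m : ℕ) (u v : D.K → ℝ) :
    D.Qm m (u + v) (u + v) ≤ 2 * D.Qm m u u + 2 * D.Qm m v v := by
  simp only [Qm, Finset.mul_sum, ← Finset.sum_add_distrib]
  exact Finset.sum_le_sum fun w _ => Q0_add_le (u ∘ _) (v ∘ _)

theorem Qm_smul_self (m : ℕ) (c : ℝ) (u : D.K → ℝ) :
    D.Qm m (c • u) (c • u) = c ^ 2 * D.Qm m u u := by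
  simp only [Qm, Q0, Finset.mul_sum, Function.comp_apply, Pi.smul_apply, smul_eq_mul]
  exact Finset.sum_congr rfl fun w _ => Finset.sum_congr rfl fun b _ => by ring

theorem summable_linePart {u v : D.K → ℝ} (hu : u ∈ D.lineDomain R) (hv : v ∈ D.lineDomain R) :
    Summable fun k => (R.γ k)⁻¹ * D.lineForm k u v := by
  rw [mem_lineDomain_iff] at hu hv
  refine Summable.of_norm_bounded (hu.2.1.add hv.2.1) fun k => ?_
  have h := abs_lineForm_le k hu.1 hv.1
  have hγ := inv_nonneg.2 (R.γ_pos k).le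
  rw [norm_mul, Real.norm_of_nonneg hγ, Real.norm_eq_abs, ← mul_add]
  exact mul_le_mul_of_nonneg_left (by linarith [abs_nonneg (D.lineForm k u v)]) hγ

theorem const_mem (c : ℝ) : (fun _ => c) ∈ D.lineDomain R := by
  have h0 : ∀ k, D.lineForm k (fun _ => c) (fun _ => c) = 0 := by
    intro k
    refine Finset.sum_eq_zero fun w _ => Finset.sum_eq_zero fun b _ => ?_
    rw [dirichletForm_congr (f := fun t => c + t * 0) (h := fun t => c + t * 0)
      (memH1_affine c 0) (memH1_affine c 0), dirichletForm_affine] <;>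
      simp [onEdge, IccExtend, EqOn]
  refine (mem_lineDomain_iff D R).2 ⟨const_mem_tildeF c, ?_, ?_⟩
  · simp [h0, summable_zero]
  · simp [Qm, Q0]

theorem add_mem {u v : D.K → ℝ} (hu : u ∈ D.lineDomain R) (hv : v ∈ D.lineDomain R) :
    u + v ∈ D.lineDomain R := by
  have hs := summable_linePart hu hv
  rw [mem_lineDomain_iff] at hu hv ⊢
  refine ⟨add_mem_tildeF hu.1 hv.1, ?_, ?_⟩
  · refine ((hu.2.1.add (hs.mul_left 2)).add hv.2.1).congr fun k => ?_
    rw [lineForm_add_self k hu.1 hv.1]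
    ring
  · have h := (hu.2.2.const_mul 2).add (hv.2.2.const_mul 2)
    rw [mul_zero, add_zero] at h
    refine squeeze_zero (fun m => mul_nonneg (inv_nonneg.2 (R.δ_pos m).le)
      (D.Qm_self_nonneg m _)) (fun m => ?_) h
    have := mul_le_mul_of_nonneg_left (Qm_add_le m u v) (inv_nonneg.2 (R.δ_pos m).le)
    linarith

theorem smul_mem (c : ℝ) {u : D.K → ℝ} (hu : u ∈ D.lineDomain R) : c • u ∈ D.lineDomain R := by
  rw [mem_lineDomain_iff] at hu ⊢
  refine ⟨smul_mem_tildeF c hu.1, ?_, ?_⟩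
  · refine (hu.2.1.mul_left (c ^ 2)).congr fun k => ?_
    rw [lineForm_smul_self k c hu.1]
    ring
  · have h := hu.2.2.const_mul (c ^ 2)
    rw [mul_zero] at h
    refine h.congr fun m => ?_
    rw [Qm_smul_self]
    ring

theorem sub_mem {u v : D.K → ℝ} (hu : u ∈ D.lineDomain R) (hv : v ∈ D.lineDomain R) :
    u - v ∈ D.lineDomain R := by
  have := add_mem hu (smul_mem (-1) hv)
  rwa [neg_one_smul, ← sub_eq_add_neg] at this

theorem linePart_comm (u v : D.K → ℝ) : D.linePart R u v = D.linePart R v u := by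
  simp only [linePart, lineForm_comm _ u v]

theorem linePart_add_left {u v w : D.K → ℝ} (hu : u ∈ D.lineDomain R) (hv : v ∈ D.lineDomain R)
    (hw : w ∈ D.lineDomain R) :
    D.linePart R (u + v) w = D.linePart R u w + D.linePart R v w := by
  rw [linePart, linePart, linePart,
    ← (summable_linePart hu hw).tsum_add (summable_linePart hv hw)]
  refine tsum_congr fun k => ?_
  rw [lineForm_add_left k hu.1.1 hv.1.1 hw.1.1, mul_add]

theorem linePart_smul_left (c : ℝ) {u v : D.K → ℝ} (hu : u ∈ D.lineDomain R)
    (hv : v ∈ D.lineDomain R) : D.linePart R (c • u) v = c * D.linePart R u v := by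
  rw [linePart, linePart, ← tsum_mul_left]
  refine tsum_congr fun k => ?_
  rw [lineForm_smul_left k c hu.1.1 hv.1.1]
  ring

theorem linePart_self_nonneg (u : D.K → ℝ) : 0 ≤ D.linePart R u u :=
  tsum_nonneg fun k =>
    mul_nonneg (inv_nonneg.2 (R.γ_pos k).le) (D.lineForm_self_nonneg k u)

theorem linePart_add_self {u v : D.K → ℝ} (hu : u ∈ D.lineDomain R) (hv : v ∈ D.lineDomain R) :
    D.linePart R (u + v) (u + v) =
      D.linePart R u u + 2 * D.linePart R u v + D.linePart R v v := by
  rw [linePart_add_left hu hv (add_mem hu hv), linePart_comm u (u + v),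
    linePart_comm v (u + v), linePart_add_left hu hv hu, linePart_add_left hu hv hv,
    linePart_comm v u]
  ring

theorem linePart_sub_self {u v : D.K → ℝ} (hu : u ∈ D.lineDomain R) (hv : v ∈ D.lineDomain R) :
    D.linePart R (u - v) (u - v) =
      D.linePart R u u - 2 * D.linePart R u v + D.linePart R v v := by
  have e : u - v = u + (-1 : ℝ) • v := by rw [neg_one_smul, sub_eq_add_neg]
  have hv' := smul_mem (-1) hv
  rw [e, linePart_add_self hu hv', linePart_comm u (_ • v), linePart_smul_left _ hv hu,
    linePart_smul_left _ hv hv', linePart_comm v (_ • v), linePart_smul_left _ hv hv,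
    linePart_comm v u]
  ring

/-- The self-similarity of the line part. -/
theorem linePart_eq {u v : D.K → ℝ} (hu : u ∈ D.lineDomain R) (hv : v ∈ D.lineDomain R) :
    D.linePart R u v = (R.ρ 0)⁻¹ * D.lineForm 0 u v +
      (R.r 0)⁻¹ * ∑ i, D.linePart R.shift (u ∘ D.cellMap [i]) (v ∘ D.cellMap [i]) := by
  rw [linePart, (summable_linePart hu hv).tsum_eq_zero_add, R.γ_zero]
  congr 1
  simp only [linePart]
  rw [← Summable.tsum_finsetSum fun i _ =>
    summable_linePart (comp_cellMap_mem hu i) (comp_cellMap_mem hv i), ← tsum_mul_left]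
  refine tsum_congr fun k => ?_
  rw [R.γ_succ, D.lineForm_succ, mul_inv, mul_assoc, Finset.mul_sum]

/-- The factor r_0 ≤ 3/5 is the contraction behind all estimates that descend through the levels. -/
theorem linePart_comp_cellMap_le {u : D.K → ℝ} (hu : u ∈ D.lineDomain R) (i : Fin 3) :
    D.linePart R.shift (u ∘ D.cellMap [i]) (u ∘ D.cellMap [i]) ≤ R.r 0 * D.linePart R u u := by
  have h1 := Finset.single_le_sum
    (f := fun i => D.linePart R.shift (u ∘ D.cellMap [i]) (u ∘ D.cellMap [i]))
    (fun _ _ => linePart_self_nonneg _) (Finset.mem_univ i)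
  rw [linePart_eq hu hu, mul_add, mul_inv_cancel_left₀ (R.r_pos 0).ne']
  refine h1.trans (le_add_of_nonneg_left ?_)
  exact mul_nonneg (R.r_pos 0).le (mul_nonneg (inv_nonneg.2 (R.ρ_pos 0).le)
    (D.lineForm_self_nonneg 0 u))

theorem dirichletForm_onEdge_nil_le {u : D.K → ℝ} (hu : u ∈ D.lineDomain R) (b : Fin 3) :
    dirichletForm (D.onEdge u [] b) (D.onEdge u [] b) ≤ R.ρ 0 * D.linePart R u u := by
  have h1 := Finset.single_le_sum
    (f := fun b => dirichletForm (D.onEdge u [] b) (D.onEdge u [] b))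
    (fun _ _ => dirichletForm_self_nonneg _) (Finset.mem_univ b)
  rw [linePart_eq hu hu, D.lineForm_zero, mul_add, mul_inv_cancel_left₀ (R.ρ_pos 0).ne']
  refine h1.trans (le_add_of_nonneg_right ?_)
  exact mul_nonneg (R.ρ_pos 0).le (mul_nonneg (inv_nonneg.2 (R.r_pos 0).le)
    (Finset.sum_nonneg fun _ _ => linePart_self_nonneg _))

end SSGSetup

/-! ## The resistance of the line part -/

namespace MatchingSeq

variable (R : MatchingSeq)

theorem one_sub_ρ_pos (k : ℕ) : 0 < 1 - R.ρ k := sub_pos.2 (R.ρ_lt_one k)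

/-- `∏_{i ≤ m} (1 - ρ_i)`. -/
noncomputable def partialProd (m : ℕ) : ℝ := ∏ i ∈ Finset.range m, (1 - R.ρ i)

/-- `1 - ∏_m (1 - ρ_m)`. -/
noncomputable def resistance : ℝ := 1 - ∏' m, (1 - R.ρ m)

/-- Finite products decrease as the index set grows and are bounded below by 0, so they converge to
their infimum, which may be 0. -/
theorem multipliable : Multipliable fun m => 1 - R.ρ m := by
  have hanti := Finset.prod_anti_set_of_le_one (f := fun i => 1 - R.ρ i)
    (fun i => (R.one_sub_ρ_pos i).le) fun i => by linarith [R.ρ_pos i]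
  refine ⟨⨅ s : Finset ℕ, ∏ i ∈ s, (1 - R.ρ i), ?_⟩
  refine tendsto_atTop_ciInf hanti ⟨0, ?_⟩
  rintro _ ⟨s, rfl⟩
  exact Finset.prod_nonneg fun i _ => (R.one_sub_ρ_pos i).le

theorem partialProd_pos (m : ℕ) : 0 < R.partialProd m :=
  Finset.prod_pos fun i _ => R.one_sub_ρ_pos i

theorem partialProd_le_one (m : ℕ) : R.partialProd m ≤ 1 :=
  Finset.prod_le_one (fun i _ => (R.one_sub_ρ_pos i).le) fun i _ => by linarith [R.ρ_pos i]

theorem partialProd_zero : R.partialProd 0 = 1 := by simp [partialProd]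

theorem partialProd_succ (m : ℕ) :
    R.partialProd (m + 1) = (1 - R.ρ 0) * R.shift.partialProd m := by
  rw [partialProd, Finset.prod_range_succ', mul_comm]
  rfl

theorem tendsto_partialProd : Tendsto R.partialProd atTop (𝓝 (1 - R.resistance)) := by
  rw [resistance, sub_sub_cancel]
  exact R.multipliable.hasProd.tendsto_prod_nat

theorem resistance_eq : R.resistance = R.ρ 0 + (1 - R.ρ 0) * R.shift.resistance := by
  have h1 := (tendsto_add_atTop_iff_nat 1).2 R.tendsto_partialProd
  have h2 := R.shift.tendsto_partialProd.const_mul (1 - R.ρ 0)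
  simp only [partialProd_succ] at h1
  have := tendsto_nhds_unique h1 h2
  linarith

theorem resistance_le_one : R.resistance ≤ 1 := by
  have := ge_of_tendsto' R.tendsto_partialProd fun m => (R.partialProd_pos m).le
  linarith

theorem resistance_nonneg : 0 ≤ R.resistance := by
  have := le_of_tendsto' R.tendsto_partialProd fun m => R.partialProd_le_one m
  linarith

theorem resistance_pos : 0 < R.resistance := by
  rw [resistance_eq]
  have := R.ρ_pos 0
  have := mul_nonneg (R.one_sub_ρ_pos 0).le R.shift.resistance_nonneg
  linarith

/-- Telescoping, since ρ_k P_k = P_k - P_{k+1}. -/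
theorem sum_range_mul_partialProd (m : ℕ) :
    ∑ k ∈ Finset.range m, R.ρ k * R.partialProd k = 1 - R.partialProd m := by
  induction m with
  | zero => simp [partialProd_zero]
  | succ m ih =>
    rw [Finset.sum_range_succ, ih, partialProd, partialProd, Finset.prod_range_succ]
    ring

theorem hasSum_mul_partialProd :
    HasSum (fun k => R.ρ k * R.partialProd k) R.resistance := by
  rw [hasSum_iff_tendsto_nat_of_nonneg fun k =>
    mul_nonneg (R.ρ_pos k).le (R.partialProd_pos k).le]
  simp only [sum_range_mul_partialProd]
  simpa using R.tendsto_partialProd.const_sub 1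

theorem partialProd_le_exp (m : ℕ) :
    R.partialProd m ≤ Real.exp (-∑ i ∈ Finset.range m, R.ρ i) := by
  rw [← Finset.sum_neg_distrib, Real.exp_sum]
  refine Finset.prod_le_prod (fun i _ => (R.one_sub_ρ_pos i).le) fun i _ => ?_
  linarith [Real.add_one_le_exp (-R.ρ i)]

/-- If the series diverges, the partial products are squeezed to 0 by exp(-∑ ρ_i). If it converges,
an infinite product of nonzero factors with summable deviations from 1 is nonzero. -/
theorem resistance_lt_one_iff : R.resistance < 1 ↔ Summable R.ρ := by
  constructor
  · intro h
    by_contra hs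
    have ht := (not_summable_iff_tendsto_nat_atTop_of_nonneg fun i => (R.ρ_pos i).le).1 hs
    have h2 := squeeze_zero (fun m => (R.partialProd_pos m).le) R.partialProd_le_exp
      (Real.tendsto_exp_neg_atTop_nhds_zero.comp ht)
    have := tendsto_nhds_unique h2 R.tendsto_partialProd
    linarith
  · intro hs
    have hne : ∏' m, (1 + -R.ρ m) ≠ 0 := by
      refine tprod_one_add_ne_zero_of_summable (fun i => ?_) ?_
      · have := R.one_sub_ρ_pos i
        rw [← sub_eq_add_neg]
        exact this.ne'
      · simpa using hs.abs
    have h1 : R.resistance ≠ 1 := by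
      intro h
      simp only [← sub_eq_add_neg] at hne
      rw [resistance] at h
      exact hne (by linarith)
    exact lt_of_le_of_ne R.resistance_le_one h1

end MatchingSeq

/-! ### The lower bound for the energy by network reduction. -/

/-- Any trial current c through an edge of resistance s bounds the energy of the voltage q from
below, with equality for q = s c. -/
theorem two_mul_sub_le_inv_mul_sq {s : ℝ} (hs : 0 < s) (q c : ℝ) :
    2 * q * c - s * c ^ 2 ≤ s⁻¹ * q ^ 2 := by
  have h : s⁻¹ * q ^ 2 - (2 * q * c - s * c ^ 2) = s⁻¹ * (q - s * c) ^ 2 := by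
    field_simp
    ring
  have : 0 ≤ s⁻¹ * (q - s * c) ^ 2 := by positivity
  linarith

/-- The lower bound for the energy of the network obtained by joining three triangles with edges of
resistance `s` by edges of resistance `ρ`. -/
theorem network_energy_ge {s ρ : ℝ} (hs : 0 < s) (hρ : 0 < ρ) (v : Fin 3 → Fin 3 → ℝ) :
    ∑ b, (v b b - v (b + 1) (b + 1)) * (v b b - v (b + 1) (b + 1)) ≤
      (5 / 3 * s + ρ) * (s⁻¹ * ∑ i, ∑ b, (v i b - v i (b + 1)) * (v i b - v i (b + 1)) +
        ρ⁻¹ * ∑ b, (v b (b + 1) - v (b + 1) b) ^ 2) := by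
  simp only [← sq, Fin.sum_univ_three, Fin.isValue, (by decide : (0 : Fin 3) + 1 = 1),
    (by decide : (1 : Fin 3) + 1 = 2), (by decide : (2 : Fin 3) + 1 = 0)]
  generalize v 0 0 = a
  generalize v 1 1 = b
  generalize v 2 2 = c
  generalize v 0 1 = ab
  generalize v 0 2 = ac
  generalize v 1 0 = ba
  generalize v 1 2 = bc
  generalize v 2 0 = ca
  generalize v 2 1 = cb
  have hY : 0 < 5 / 3 * s + ρ := by positivity
  obtain ⟨y, hy⟩ : ∃ y, y = (5 / 3 * s + ρ)⁻¹ := ⟨_, rfl⟩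
  have hyY : (5 / 3 * s + ρ) * y = 1 := by rw [hy]; exact mul_inv_cancel₀ hY.ne'
  -- The trial currents are those of the minimising potential for corner values a, b, c. They
  -- satisfy Kirchhoff's law at the six inner vertices, so the inner values cancel in the sum, and
  -- their dissipation is (5/3 s + ρ) y² times the sum of squared corner differences.
  have c1 := two_mul_sub_le_inv_mul_sq hs (a - ab) (y * (3 * a - 2 * b - c) / 3)
  have c2 := two_mul_sub_le_inv_mul_sq hs (ab - ac) (y * (b - c) / 3)
  have c3 := two_mul_sub_le_inv_mul_sq hs (ac - a) (-y * (3 * a - 2 * c - b) / 3)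
  have c4 := two_mul_sub_le_inv_mul_sq hs (ba - b) (-y * (3 * b - 2 * a - c) / 3)
  have c5 := two_mul_sub_le_inv_mul_sq hs (b - bc) (y * (3 * b - 2 * c - a) / 3)
  have c6 := two_mul_sub_le_inv_mul_sq hs (bc - ba) (y * (c - a) / 3)
  have c7 := two_mul_sub_le_inv_mul_sq hs (ca - cb) (y * (a - b) / 3)
  have c8 := two_mul_sub_le_inv_mul_sq hs (cb - c) (-y * (3 * c - 2 * b - a) / 3)
  have c9 := two_mul_sub_le_inv_mul_sq hs (c - ca) (y * (3 * c - 2 * a - b) / 3)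
  have d1 := two_mul_sub_le_inv_mul_sq hρ (ab - ba) (y * (a - b))
  have d2 := two_mul_sub_le_inv_mul_sq hρ (bc - cb) (y * (b - c))
  have d3 := two_mul_sub_le_inv_mul_sq hρ (ca - ac) (y * (c - a))
  have key : y * ((a - b) ^ 2 + (b - c) ^ 2 + (c - a) ^ 2) ≤
      s⁻¹ * ((a - ab) ^ 2 + (ab - ac) ^ 2 + (ac - a) ^ 2 +
        ((ba - b) ^ 2 + (b - bc) ^ 2 + (bc - ba) ^ 2) +
        ((ca - cb) ^ 2 + (cb - c) ^ 2 + (c - ca) ^ 2)) +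
      ρ⁻¹ * ((ab - ba) ^ 2 + (bc - cb) ^ 2 + (ca - ac) ^ 2) := by
    linear_combination c1 + c2 + c3 + c4 + c5 + c6 + c7 + c8 + c9 + d1 + d2 + d3 +
      y * ((a - b) ^ 2 + (b - c) ^ 2 + (c - a) ^ 2) * hyY
  have := mul_le_mul_of_nonneg_left key hY.le
  rwa [← mul_assoc, hyY, one_mul] at this

namespace SSGSetup

variable {D : SSGSetup} {R : MatchingSeq}

theorem sq_sub_le_dirichletForm_onEdge {u : D.K → ℝ} {w : List (Fin 3)} {b : Fin 3}
    (h : MemH1 (D.onEdge u w b)) (s t : Icc (0 : ℝ) 1) :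
    (u (D.edgePath w b t) - u (D.edgePath w b s)) ^ 2 ≤
      |(t : ℝ) - s| * dirichletForm (D.onEdge u w b) (D.onEdge u w b) := by
  rw [← onEdge_coe D u, ← onEdge_coe D u]
  exact h.sq_sub_le s.2 t.2

theorem bond_sq_sub_le {u : D.K → ℝ} {b : Fin 3} (h : MemH1 (D.onEdge u [] b)) :
    (u (D.cellMap [b] (D.vertex (b + 1))) - u (D.cellMap [b + 1] (D.vertex b))) ^ 2 ≤
      dirichletForm (D.onEdge u [] b) (D.onEdge u [] b) := by
  have := sq_sub_le_dirichletForm_onEdge h 1 0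
  simpa [edgePath_nil_zero, edgePath_nil_one] using this

theorem Q0_le_one_step {u : D.K → ℝ} (hb : ∀ b, MemH1 (D.onEdge u [] b)) {s ρ : ℝ} (hs : 0 < s)
    (hρ : 0 < ρ) : D.Q0 u u ≤ (5 / 3 * s + ρ) *
      (s⁻¹ * ∑ i, D.Q0 (u ∘ D.cellMap [i]) (u ∘ D.cellMap [i]) + ρ⁻¹ * D.lineForm 0 u u) := by
  have h := network_energy_ge hs hρ fun i j => u (D.cellMap [i] (D.vertex j))
  simp only [cellMap_vertex_self] at h
  refine h.trans (mul_le_mul_of_nonneg_left ?_ (by positivity))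
  refine add_le_add le_rfl (mul_le_mul_of_nonneg_left ?_ (by positivity))
  rw [lineForm_zero]
  exact Finset.sum_le_sum fun b _ => bond_sq_sub_le (hb b)

/-- The level-m cells are regarded as triangles of resistance ε δ_m instead of δ_m; the prefactor is
the image of ε under the composition of the m maps x ↦ ρ_i + (1 - ρ_i) x. A small ε charges heavily
for the SG term, which later disappears in the limit. -/
theorem Q0_le_approx {ε : ℝ} (hε : 0 < ε) (m : ℕ) {R : MatchingSeq} {u : D.K → ℝ}
    (hu : u ∈ D.tildeF) : D.Q0 u u ≤ (1 - R.partialProd m + R.partialProd m * ε) *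
      (ε⁻¹ * ((R.δ m)⁻¹ * D.Qm m u u) +
        ∑ k ∈ Finset.range m, (R.γ k)⁻¹ * D.lineForm k u u) := by
  induction m generalizing R u with
  | zero =>
    simp only [R.partialProd_zero, R.δ_zero, D.Qm_zero, Finset.range_zero, Finset.sum_empty]
    apply le_of_eq
    field_simp
    ring
  | succ m ih =>
    set x := 1 - R.shift.partialProd m + R.shift.partialProd m * ε with hx
    have hxpos : 0 < x := by
      have h1 := R.shift.partialProd_le_one m
      have h2 := mul_pos (R.shift.partialProd_pos m) hε
      linarith
    have hr := R.r_pos 0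
    have hX : 5 / 3 * (R.r 0 * x) + R.ρ 0 =
        1 - R.partialProd (m + 1) + R.partialProd (m + 1) * ε := by
      rw [R.partialProd_succ, R.r_eq 0, hx]
      ring
    have h := Q0_le_one_step (hu.2 []) (mul_pos hr hxpos) (R.ρ_pos 0)
    rw [hX] at h
    have hXpos : 0 ≤ 1 - R.partialProd (m + 1) + R.partialProd (m + 1) * ε := by
      rw [← hX]
      have := R.ρ_pos 0
      positivity
    refine h.trans (mul_le_mul_of_nonneg_left ?_ hXpos)
    have hsum : ∑ i, D.Q0 (u ∘ D.cellMap [i]) (u ∘ D.cellMap [i]) ≤ x *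
        ∑ i, (ε⁻¹ * ((R.shift.δ m)⁻¹ * D.Qm m (u ∘ D.cellMap [i]) (u ∘ D.cellMap [i])) +
          ∑ k ∈ Finset.range m,
            (R.shift.γ k)⁻¹ * D.lineForm k (u ∘ D.cellMap [i]) (u ∘ D.cellMap [i])) := by
      rw [Finset.mul_sum]
      exact Finset.sum_le_sum fun i _ => ih (R := R.shift) (u := u ∘ D.cellMap [i])
        ⟨hu.1.comp (D.continuous_cellMap [i]), fun w b => hu.2 (i :: w) b⟩
    have h2 := mul_le_mul_of_nonneg_left hsum (inv_nonneg.2 (mul_pos hr hxpos).le)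
    rw [Finset.sum_range_succ', R.γ_zero, R.δ_succ, D.Qm_succ]
    simp only [R.γ_succ, D.lineForm_succ]
    rw [Finset.sum_add_distrib, Finset.sum_comm] at h2
    simp only [← Finset.mul_sum] at h2
    have e1 : ∀ y, (R.r 0 * x)⁻¹ * (x * y) = (R.r 0)⁻¹ * y := fun y => by
      field_simp
    rw [e1] at h2
    simp only [mul_inv, mul_assoc, ← Finset.mul_sum] at h2 ⊢
    linarith

/-- The lower bound for the trace of the line part on the vertices of the triangle. -/
theorem Q0_le {u : D.K → ℝ} (hu : u ∈ D.lineDomain R) :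
    D.Q0 u u ≤ R.resistance * D.linePart R u u := by
  have hu' := (mem_lineDomain_iff D R).1 hu
  -- The limit in m comes first, at fixed ε: it removes the SG term in spite of its weight ε⁻¹. Only
  -- then does ε tend to 0.
  have h1 : ∀ ε > 0, D.Q0 u u ≤
      (1 - (1 - R.resistance) + (1 - R.resistance) * ε) * D.linePart R u u := by
    intro ε hε
    have ht := ((R.tendsto_partialProd.const_sub 1).add
      (R.tendsto_partialProd.mul_const ε)).mul
      ((hu'.2.2.const_mul ε⁻¹).add hu'.2.1.hasSum.tendsto_sum_nat)
    rw [mul_zero, zero_add] at ht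
    exact ge_of_tendsto' ht fun m => Q0_le_approx hε m hu'.1
  have ht : Tendsto (fun ε : ℝ => (1 - (1 - R.resistance) + (1 - R.resistance) * ε) *
      D.linePart R u u) (𝓝[>] 0)
      (𝓝 ((1 - (1 - R.resistance) + (1 - R.resistance) * 0) * D.linePart R u u)) := by
    refine Tendsto.mono_left (Continuous.tendsto ?_ 0) nhdsWithin_le_nhds
    fun_prop
  have := ge_of_tendsto ht (eventually_mem_nhdsWithin.mono fun ε hε => h1 ε hε)
  rwa [mul_zero, add_zero, sub_sub_cancel] at this

theorem Q0_le_linePart {u : D.K → ℝ} (hu : u ∈ D.lineDomain R) :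
    D.Q0 u u ≤ D.linePart R u u :=
  (Q0_le hu).trans (mul_le_of_le_one_left (linePart_self_nonneg u) R.resistance_le_one)

theorem Qm_le_linePart (m : ℕ) {R : MatchingSeq} {u : D.K → ℝ} (hu : u ∈ D.lineDomain R) :
    (R.δ m)⁻¹ * D.Qm m u u ≤ D.linePart R u u := by
  induction m generalizing R u with
  | zero => simpa [R.δ_zero, D.Qm_zero] using Q0_le_linePart hu
  | succ m ih =>
    rw [R.δ_succ, D.Qm_succ, mul_inv, mul_assoc, Finset.mul_sum, linePart_eq hu hu]
    refine le_trans ?_ (le_add_of_nonneg_left (mul_nonneg (inv_nonneg.2 (R.ρ_pos 0).le)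
      (D.lineForm_self_nonneg 0 u)))
    exact mul_le_mul_of_nonneg_left (Finset.sum_le_sum fun i _ => ih (comp_cellMap_mem hu i))
      (inv_nonneg.2 (R.r_pos 0).le)

theorem sq_sub_vertex_le (u : D.K → ℝ) (i j : Fin 3) :
    (u (D.vertex i) - u (D.vertex j)) ^ 2 ≤ D.Q0 u u := by
  have h : ∀ b, (u (D.vertex b) - u (D.vertex (b + 1))) ^ 2 ≤ D.Q0 u u := fun b => by
    rw [sq]
    exact Finset.single_le_sum (f := fun b : Fin 3 => (u (D.vertex b) - u (D.vertex (b + 1))) *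
      (u (D.vertex b) - u (D.vertex (b + 1)))) (fun _ _ => mul_self_nonneg _) (Finset.mem_univ b)
  have hij : i = j ∨ j = i + 1 ∨ i = j + 1 := by revert i j; decide
  rcases hij with rfl | rfl | rfl
  · simpa using D.Q0_self_nonneg u
  · exact h i
  · rw [sub_sq_comm]
    exact h j

end SSGSetup

/-! ## The line part is a resistance form -/

namespace SSGSetup

variable {D : SSGSetup} {R : MatchingSeq}

/-! ### Oscillation and equicontinuity. -/

theorem sqrt_linePart_comp_cellMap_le {u : D.K → ℝ} (hu : u ∈ D.lineDomain R) (i : Fin 3) :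
    √(D.linePart R.shift (u ∘ D.cellMap [i]) (u ∘ D.cellMap [i])) ≤
      4 / 5 * √(D.linePart R u u) := by
  have h1 := linePart_comp_cellMap_le hu i
  have h2 := mul_le_mul_of_nonneg_right (R.r_le 0) (linePart_self_nonneg (R := R) u)
  have h3 := linePart_self_nonneg (R := R) u
  -- The number 4/5 is a rational upper bound for √(3/5), as 3/5 ≤ 16/25.
  rw [Real.sqrt_le_left (by positivity), mul_pow, Real.sq_sqrt h3]
  linarith

theorem abs_sub_vertex_le {u : D.K → ℝ} (hu : u ∈ D.lineDomain R) (i j : Fin 3) :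
    |u (D.vertex i) - u (D.vertex j)| ≤ √(D.linePart R u u) :=
  Real.abs_le_sqrt ((sq_sub_vertex_le u i j).trans (Q0_le_linePart hu))

theorem abs_cell_vertex_sub_le {u : D.K → ℝ} (hu : u ∈ D.lineDomain R) (i j : Fin 3) :
    |u (D.cellMap [i] (D.vertex j)) - u (D.vertex 0)| ≤ 2 * √(D.linePart R u u) := by
  have h1 := abs_sub_vertex_le (comp_cellMap_mem hu i) j i
  have h2 := abs_sub_vertex_le hu i 0
  have h3 := sqrt_linePart_comp_cellMap_le hu i
  simp only [Function.comp_apply, cellMap_vertex_self] at h1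
  have h4 := Real.sqrt_nonneg (D.linePart R u u)
  have h5 := abs_sub_le (u (D.cellMap [i] (D.vertex j))) (u (D.vertex i)) (u (D.vertex 0))
  linarith

/-- Passing to a cell costs at most 2 to connect base vertices and contracts the rest by 4/5; 10 is
the fixed point of c ↦ (4/5) c + 2. -/
theorem abs_edge_sub_le (w : List (Fin 3)) (b : Fin 3) (t : Icc (0 : ℝ) 1) {R : MatchingSeq}
    {u : D.K → ℝ} (hu : u ∈ D.lineDomain R) :
    |u (D.edgePath w b t) - u (D.vertex 0)| ≤ 10 * √(D.linePart R u u) := by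
  have h4 := Real.sqrt_nonneg (D.linePart R u u)
  induction w generalizing R u with
  | nil =>
    have h1 := sq_sub_le_dirichletForm_onEdge (memH1_of_mem hu [] b) 0 t
    have h2 := dirichletForm_onEdge_nil_le hu b
    have h3 : (u (D.edgePath [] b t) - u (D.edgePath [] b 0)) ^ 2 ≤ D.linePart R u u := by
      refine h1.trans ?_
      refine (mul_le_of_le_one_left (dirichletForm_self_nonneg _) ?_).trans (h2.trans ?_)
      · simp only [Icc.coe_zero, sub_zero]
        rw [abs_of_nonneg t.2.1]
        exact t.2.2
      · exact mul_le_of_le_one_left (linePart_self_nonneg u) (R.ρ_lt_one 0).le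
    have h5 := Real.abs_le_sqrt h3
    rw [edgePath_nil_zero] at h5
    have h6 := abs_cell_vertex_sub_le hu b (b + 1)
    have h7 := abs_sub_le (u (D.edgePath [] b t)) (u (D.cellMap [b] (D.vertex (b + 1))))
      (u (D.vertex 0))
    linarith
  | cons i w ih =>
    have h1 := ih (comp_cellMap_mem hu i) (Real.sqrt_nonneg _)
    have h2 := sqrt_linePart_comp_cellMap_le hu i
    have h3 := abs_cell_vertex_sub_le hu i 0
    have h5 := abs_sub_le (u (D.edgePath (i :: w) b t)) (u (D.cellMap [i] (D.vertex 0)))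
      (u (D.vertex 0))
    change |u (D.edgePath (i :: w) b t) - u (D.cellMap [i] (D.vertex 0))| ≤ _ at h1
    linarith

theorem abs_sub_vertex_zero_le {u : D.K → ℝ} (hu : u ∈ D.lineDomain R) (x : D.K) :
    |u x - u (D.vertex 0)| ≤ 10 * √(D.linePart R u u) := by
  have hcl : IsClosed {x : D.K | |u x - u (D.vertex 0)| ≤ 10 * √(D.linePart R u u)} :=
    isClosed_le ((continuous_of_mem hu).sub continuous_const).abs continuous_const
  refine closure_minimal ?_ hcl (D.dense_edges x)
  rintro _ ⟨w, b, t, rfl⟩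
  exact abs_edge_sub_le w b t hu

/-- The oscillation of a function is bounded in terms of its energy. -/
theorem sq_sub_le {u : D.K → ℝ} (hu : u ∈ D.lineDomain R) (x y : D.K) :
    (u x - u y) ^ 2 ≤ 400 * D.linePart R u u := by
  have h1 := abs_sub_vertex_zero_le hu x
  have h2 := abs_sub_vertex_zero_le hu y
  have h3 := abs_sub_le (u x) (u (D.vertex 0)) (u y)
  rw [abs_sub_comm (u (D.vertex 0))] at h3
  rw [← sq_abs]
  refine (pow_le_pow_left₀ (abs_nonneg _) (h3.trans (add_le_add h1 h2)) 2).trans_eq ?_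
  have := Real.sq_sqrt (linePart_self_nonneg (R := R) u)
  linear_combination 400 * this

/-- Functions of bounded energy are equicontinuous. -/
theorem eventually_sq_sub_le {ε : ℝ} (hε : 0 < ε) (x : D.K) :
    ∀ᶠ y in 𝓝 x, ∀ R : MatchingSeq, ∀ u ∈ D.lineDomain R,
      (u y - u x) ^ 2 ≤ ε * D.linePart R u u := by
  -- Inside level-n cells the oscillation bound is used, weakened n times by 3/5; on bonds met
  -- earlier, Hölder continuity contributes the summand ε. The neighbourhood must not depend on `R`
  -- or `u`.
  have key : ∀ ε : ℝ, 0 < ε → ∀ n : ℕ, ∀ x : D.K, ∀ᶠ y in 𝓝 x, ∀ R : MatchingSeq, ∀ u ∈ D.lineDomain R,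
      (u y - u x) ^ 2 ≤ ((3 / 5) ^ n * 400 + ε) * D.linePart R u u := by
    intro ε hε n
    induction n with
    | zero =>
      intro x
      refine Eventually.of_forall fun y R u hu => (sq_sub_le hu y x).trans ?_
      exact mul_le_mul_of_nonneg_right (by linarith) (linePart_self_nonneg u)
    | succ n ih =>
      intro x
      refine D.eventually_nhds_of_cover (fun i y hy => ?_) fun b t ht => ?_
      · filter_upwards [ih y] with z hz R u hu
        rw [← hy]
        refine (hz R.shift _ (comp_cellMap_mem hu i)).trans ?_
        have h1 := linePart_comp_cellMap_le hu i
        have h2 := mul_le_mul_of_nonneg_right (R.r_le 0) (linePart_self_nonneg (R := R) u)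
        refine (mul_le_mul_of_nonneg_left (h1.trans h2) (by positivity)).trans ?_
        rw [← mul_assoc]
        refine mul_le_mul_of_nonneg_right ?_ (linePart_self_nonneg u)
        rw [pow_succ]
        linarith
      · have hnear : ∀ᶠ s : Icc (0 : ℝ) 1 in 𝓝 t, |(s : ℝ) - t| < ε := by
          filter_upwards [Metric.ball_mem_nhds t hε] with s hs
          exact hs
        filter_upwards [hnear] with s hs R u hu
        rw [← ht]
        refine (sq_sub_le_dirichletForm_onEdge (memH1_of_mem hu [] b) t s).trans ?_
        have h0 := linePart_self_nonneg (R := R) u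
        have h1 := (dirichletForm_onEdge_nil_le hu b).trans
          (mul_le_of_le_one_left h0 (R.ρ_lt_one 0).le)
        refine (mul_le_mul hs.le h1 (dirichletForm_self_nonneg _) hε.le).trans ?_
        refine mul_le_mul_of_nonneg_right ?_ h0
        have : (0 : ℝ) ≤ (3 / 5) ^ (n + 1) * 400 := by positivity
        linarith
  have ht : Tendsto (fun n : ℕ => (3 / 5 : ℝ) ^ n * 400) atTop (𝓝 (0 * 400)) :=
    (tendsto_pow_atTop_nhds_zero_of_lt_one (by norm_num) (by norm_num)).mul_const _
  rw [zero_mul] at ht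
  obtain ⟨n, hn⟩ := (ht.eventually_lt_const (half_pos hε)).exists
  filter_upwards [key _ (half_pos hε) n x] with y hy R u hu
  exact (hy R u hu).trans (mul_le_mul_of_nonneg_right (by linarith) (linePart_self_nonneg u))

theorem eq_const_of_linePart_eq_zero {u : D.K → ℝ} (hu : u ∈ D.lineDomain R)
    (h : D.linePart R u u = 0) : ∃ c : ℝ, u = fun _ => c := by
  refine ⟨u (D.vertex 0), funext fun x => ?_⟩
  have := sq_sub_le hu x (D.vertex 0)
  rw [h, mul_zero] at this
  exact sub_eq_zero.1 (pow_eq_zero_iff two_ne_zero |>.1 (le_antisymm this (sq_nonneg _)))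

theorem dirichletForm_onEdge_le (w : List (Fin 3)) (b : Fin 3) {R : MatchingSeq} {u : D.K → ℝ}
    (hu : u ∈ D.lineDomain R) :
    dirichletForm (D.onEdge u w b) (D.onEdge u w b) ≤ D.linePart R u u := by
  have h0 := linePart_self_nonneg (R := R) u
  induction w generalizing R u with
  | nil =>
    exact (dirichletForm_onEdge_nil_le hu b).trans (mul_le_of_le_one_left h0 (R.ρ_lt_one 0).le)
  | cons i w ih =>
    refine (ih (comp_cellMap_mem hu i) (linePart_self_nonneg _)).trans
      ((linePart_comp_cellMap_le hu i).trans (mul_le_of_le_one_left h0 ?_))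
    linarith [R.r_le 0]

theorem lineForm_const_right (k : ℕ) {u : D.K → ℝ} (hu : u ∈ D.tildeF) (c : ℝ) :
    D.lineForm k u (fun _ => c) = 0 := by
  refine Finset.sum_eq_zero fun w _ => Finset.sum_eq_zero fun b _ => ?_
  have h : IsPrimitive (D.onEdge (fun _ => c) (List.ofFn w) b) fun _ => 0 :=
    (isPrimitive_affine c 0).congr fun t _ => by simp [onEdge, IccExtend]
  rw [dirichletForm_eq (hu.2 _ b).isPrimitive h]
  simp

theorem linePart_const_right {u : D.K → ℝ} (hu : u ∈ D.lineDomain R) (c : ℝ) :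
    D.linePart R u (fun _ => c) = 0 := by
  simp [linePart, lineForm_const_right _ hu.1.1]

theorem linePart_add_const_self {u : D.K → ℝ} (hu : u ∈ D.lineDomain R) (c : ℝ) :
    D.linePart R (u + fun _ => c) (u + fun _ => c) = D.linePart R u u := by
  rw [linePart_add_self hu (const_mem c), linePart_const_right hu,
    linePart_const_right (const_mem c)]
  ring

/-! ### The Markov property -/

theorem lipschitzWith_unitContraction : LipschitzWith 1 fun t : ℝ => min (max t 0) 1 :=
  (LipschitzWith.id.max_const 0).min_const 1

theorem markov {u : D.K → ℝ} (hu : u ∈ D.lineDomain R) : unitContraction u ∈ D.lineDomain R ∧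
    D.linePart R (unitContraction u) (unitContraction u) ≤ D.linePart R u u := by
  have hL := lipschitzWith_unitContraction
  rw [mem_lineDomain_iff] at hu ⊢
  have hline : ∀ k, (R.γ k)⁻¹ * D.lineForm k (unitContraction u) (unitContraction u) ≤
      (R.γ k)⁻¹ * D.lineForm k u u := fun k =>
    mul_le_mul_of_nonneg_left (Finset.sum_le_sum fun w _ => Finset.sum_le_sum fun b _ =>
      ((hu.1.2 _ b).lipschitz_comp hL).2) (inv_nonneg.2 (R.γ_pos k).le)
  have hnn : ∀ k, 0 ≤ (R.γ k)⁻¹ * D.lineForm k (unitContraction u) (unitContraction u) := fun k =>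
    mul_nonneg (inv_nonneg.2 (R.γ_pos k).le) (D.lineForm_self_nonneg k _)
  have hsum := Summable.of_nonneg_of_le hnn hline hu.2.1
  refine ⟨⟨⟨hL.continuous.comp hu.1.1, fun w b => ((hu.1.2 w b).lipschitz_comp hL).1⟩, hsum, ?_⟩,
    hsum.tsum_le_tsum hline hu.2.1⟩
  refine squeeze_zero (fun m => mul_nonneg (inv_nonneg.2 (R.δ_pos m).le) (D.Qm_self_nonneg m _))
    (fun m => mul_le_mul_of_nonneg_left (Finset.sum_le_sum fun w _ =>
      Finset.sum_le_sum fun b _ => ?_) (inv_nonneg.2 (R.δ_pos m).le)) hu.2.2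
  have := hL.dist_le_mul (u (D.cellMap (List.ofFn w) (D.vertex b)))
    (u (D.cellMap (List.ofFn w) (D.vertex (b + 1))))
  rw [NNReal.coe_one, one_mul] at this
  exact abs_le_iff_mul_self_le.1 this

/-! ### Separation of points -/

theorem glue_mem {f : Fin 3 → D.K → ℝ} {g : Fin 3 → ℝ → ℝ} (hf : ∀ i, f i ∈ D.lineDomain R.shift)
    (hg : ∀ b, MemH1 (g b)) (h0 : ∀ b, g b 0 = f b (D.vertex (b + 1)))
    (h1 : ∀ b, g b 1 = f (b + 1) (D.vertex b)) :
    D.glue f (fun b t => g b t) ∈ D.lineDomain R := by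
  refine mem_of_cells (fun i => ?_) fun b => (hg b).congr fun t ht => ?_
  · have : D.glue f (fun b t => g b t) ∘ D.cellMap [i] = f i :=
      funext fun x => D.glue_cellMap (g := fun b t => g b t) h0 h1 i x
    rw [this]
    exact hf i
  · rw [D.onEdge_coe _ [] b ⟨t, ht⟩, D.glue_edgePath (g := fun b t => g b t) h0 h1]

/-- The function that equals `f i ∘ G_i⁻¹` on `G_i(K)` and is affine on the bonds. -/
noncomputable def affineGlue (D : SSGSetup) (f : Fin 3 → D.K → ℝ) : D.K → ℝ :=
  D.glue f fun b t =>
    f b (D.vertex (b + 1)) + t * (f (b + 1) (D.vertex b) - f b (D.vertex (b + 1)))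

theorem affineGlue_cellMap (f : Fin 3 → D.K → ℝ) (i : Fin 3) (x : D.K) :
    D.affineGlue f (D.cellMap [i] x) = f i x :=
  D.glue_cellMap (by simp) (by simp) i x

theorem affineGlue_edgePath (f : Fin 3 → D.K → ℝ) (b : Fin 3) (t : Icc (0 : ℝ) 1) :
    D.affineGlue f (D.edgePath [] b t) =
      f b (D.vertex (b + 1)) + t * (f (b + 1) (D.vertex b) - f b (D.vertex (b + 1))) :=
  D.glue_edgePath (by simp) (by simp) b t

theorem affineGlue_mem {f : Fin 3 → D.K → ℝ} (hf : ∀ i, f i ∈ D.lineDomain R.shift) :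
    D.affineGlue f ∈ D.lineDomain R :=
  glue_mem (g := fun b t => f b (D.vertex (b + 1)) +
      t * (f (b + 1) (D.vertex b) - f b (D.vertex (b + 1)))) hf (fun _ => memH1_affine _ _)
    (by simp) (by simp)

theorem exists_cell_or_interior_bond (x : D.K) : (∃ i y, D.cellMap [i] y = x) ∨
    ∃ b t, t ≠ 0 ∧ t ≠ 1 ∧ D.edgePath [] b t = x := by
  refine D.cases_K (P := fun x => (∃ i y, D.cellMap [i] y = x) ∨
    ∃ b t, t ≠ 0 ∧ t ≠ 1 ∧ D.edgePath [] b t = x) (fun i y => Or.inl ⟨i, y, rfl⟩)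
    (fun b t => ?_) x
  by_cases h0 : t = 0
  · exact Or.inl ⟨b, _, by rw [h0, edgePath_nil_zero]⟩
  by_cases h1 : t = 1
  · exact Or.inl ⟨b + 1, _, by rw [h1, edgePath_nil_one]⟩
  exact Or.inr ⟨b, t, h0, h1, rfl⟩

theorem separates_bond {b : Fin 3} {t : Icc (0 : ℝ) 1} (h0 : t ≠ 0) (h1 : t ≠ 1) {y : D.K}
    (hy : D.edgePath [] b t ≠ y) : ∃ u ∈ D.lineDomain R, u (D.edgePath [] b t) ≠ u y := by
  by_cases hyb : ∃ t', D.edgePath [] b t' = y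
  · obtain ⟨t', rfl⟩ := hyb
    -- On bond `b` this function is the parameter itself.
    refine ⟨D.affineGlue fun i _ => if i = b then 0 else 1, affineGlue_mem fun i => const_mem _, ?_⟩
    rw [affineGlue_edgePath, affineGlue_edgePath]
    have : ∀ b : Fin 3, b + 1 ≠ b := by decide
    simp only [if_pos, if_neg (this b), sub_zero, mul_one, zero_add]
    exact fun h => hy (by rw [Subtype.ext h])
  · have t0 : (0 : ℝ) < t := lt_of_le_of_ne t.2.1 fun h => h0 (Subtype.ext h.symm)
    have t1 : (t : ℝ) < 1 := lt_of_le_of_ne t.2.2 fun h => h1 (Subtype.ext h)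
    obtain ⟨g, hg⟩ : ∃ g : Fin 3 → ℝ → ℝ, g = fun c s => if c = b then s * (1 - s) else 0 :=
      ⟨_, rfl⟩
    have hg0 : ∀ c, g c 0 = 0 := by simp [hg]
    have hg1 : ∀ c, g c 1 = 0 := by simp [hg]
    refine ⟨D.glue (fun _ _ => 0) (fun c s => g c s),
      glue_mem (fun _ => const_mem 0) (fun c => ?_) hg0 hg1, ?_⟩
    · rw [hg]
      by_cases hc : c = b
      · simpa [hc] using memH1_tent
      · simpa [hc] using memH1_affine 0 0
    · have hyv : D.glue (fun _ _ => 0) (fun c s => g c s) y = 0 := by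
        revert hyb
        refine D.cases_K (P := fun y => (¬∃ t', D.edgePath [] b t' = y) →
          D.glue (fun _ _ => 0) (fun c s => g c s) y = 0) (fun i z _ => ?_) (fun c s hcs => ?_) y
        · exact D.glue_cellMap (g := fun c s => g c s) hg0 hg1 i z
        · rw [D.glue_edgePath (g := fun c s => g c s) hg0 hg1, hg]
          exact if_neg fun hc => hcs ⟨s, by rw [hc]⟩
      rw [hyv, D.glue_edgePath (g := fun c s => g c s) hg0 hg1, hg]
      simp only [if_pos]
      exact (mul_pos t0 (by linarith)).ne'

theorem separates {x y : D.K} (hxy : x ≠ y) : ∃ u ∈ D.lineDomain R, u x ≠ u y := by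
  obtain ⟨C, hC⟩ := Metric.isBounded_iff.1 (isCompact_univ (X := D.K)).isBounded
  have hr := D.ratio_pos
  -- Points in a common cell are pulled back, which divides their distance by `ratio`. At n = 0 the
  -- hypothesis contradicts the diameter bound, so the two points are in different pieces of the
  -- covering after finitely many steps.
  have key : ∀ n : ℕ, ∀ (R : MatchingSeq) (x y : D.K), x ≠ y → D.ratio ^ n * C < dist x y →
      ∃ u ∈ D.lineDomain R, u x ≠ u y := by
    intro n
    induction n with
    | zero =>
      intro R x y _ h
      rw [pow_zero, one_mul] at h
      exact absurd (hC trivial trivial) (not_le.2 h)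
    | succ n ih =>
      intro R x y hxy h
      rcases exists_cell_or_interior_bond x with ⟨i, x, rfl⟩ | ⟨b, t, h0, h1, rfl⟩
      · rcases exists_cell_or_interior_bond y with ⟨j, y, rfl⟩ | ⟨b, t, h0, h1, rfl⟩
        · by_cases hij : i = j
          · subst hij
            rw [dist_cellMap_singleton, pow_succ', mul_assoc] at h
            obtain ⟨v, hv, hne⟩ := ih R.shift x y (fun e => hxy (by rw [e]))
              (lt_of_mul_lt_mul_left h hr.le)
            -- The separating function is copied into all three cells; only its values in the i-th
            -- one matter.
            refine ⟨D.affineGlue fun _ => v, affineGlue_mem fun _ => hv, ?_⟩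
            rwa [affineGlue_cellMap, affineGlue_cellMap]
          · refine ⟨D.affineGlue fun k _ => if k = i then 0 else 1,
              affineGlue_mem fun _ => const_mem _, ?_⟩
            rw [affineGlue_cellMap, affineGlue_cellMap, if_pos rfl, if_neg (Ne.symm hij)]
            norm_num
        · obtain ⟨u, hu, hne⟩ := separates_bond (R := R) h0 h1 hxy.symm
          exact ⟨u, hu, hne.symm⟩
      · exact separates_bond h0 h1 hxy
  have ht : Tendsto (fun n : ℕ => D.ratio ^ n * C) atTop (𝓝 (0 * C)) :=
    (tendsto_pow_atTop_nhds_zero_of_lt_one hr.le (by linarith [D.ratio_lt_half])).mul_const C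
  rw [zero_mul] at ht
  obtain ⟨n, hn⟩ := (ht.eventually_lt_const (dist_pos.2 hxy)).exists
  exact key n R x y hxy hn

end SSGSetup

namespace SSGSetup

variable {D : SSGSetup} {R : MatchingSeq}

/-! ### Completeness -/

theorem sub_mem_tildeF {u v : D.K → ℝ} (hu : u ∈ D.tildeF) (hv : v ∈ D.tildeF) :
    u - v ∈ D.tildeF := by
  have := add_mem_tildeF hu (smul_mem_tildeF (-1) hv)
  rwa [neg_one_smul, ← sub_eq_add_neg] at this

theorem lineForm_add_le (k : ℕ) {u v : D.K → ℝ} (hu : u ∈ D.tildeF) (hv : v ∈ D.tildeF) :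
    D.lineForm k (u + v) (u + v) ≤ 2 * D.lineForm k u u + 2 * D.lineForm k v v := by
  rw [lineForm_add_self k hu hv]
  linarith [abs_lineForm_le k hu hv, le_abs_self (D.lineForm k u v)]

theorem sum_lineForm_le_linePart (m : ℕ) {u : D.K → ℝ} (hu : u ∈ D.lineDomain R) :
    ∑ k ∈ Finset.range m, (R.γ k)⁻¹ * D.lineForm k u u ≤ D.linePart R u u :=
  ((mem_lineDomain_iff D R).1 hu).2.1.sum_le_tsum _ fun k _ =>
    mul_nonneg (inv_nonneg.2 (R.γ_pos k).le) (D.lineForm_self_nonneg k u)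

/-- Completeness of the domain for pointwise convergent sequences. -/
theorem mem_of_tendsto {s : ℕ → D.K → ℝ} {u : D.K → ℝ} (hs : ∀ n, s n ∈ D.lineDomain R)
    (hC : ∀ ε > 0, ∃ N, ∀ m ≥ N, ∀ n ≥ N, D.linePart R (s m - s n) (s m - s n) < ε)
    (hu : Continuous u) (hlim : ∀ x, Tendsto (fun n => s n x) atTop (𝓝 (u x))) :
    u ∈ D.lineDomain R ∧ Tendsto (fun n => D.linePart R (s n - u) (s n - u)) atTop (𝓝 0) := by
  have hedge : ∀ w b, MemH1 (D.onEdge u w b) ∧ Tendsto (fun n =>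
      dirichletForm (D.onEdge (s n - u) w b) (D.onEdge (s n - u) w b)) atTop (𝓝 0) := by
    intro w b
    refine MemH1.of_tendsto (s := fun n => D.onEdge (s n) w b)
      (fun n => memH1_of_mem (hs n) w b) (fun ε hε => ?_) fun t ht => ?_
    · obtain ⟨N, hN⟩ := hC ε hε
      exact ⟨N, fun m hm n hn =>
        (dirichletForm_onEdge_le w b (sub_mem (hs m) (hs n))).trans_lt (hN m hm n hn)⟩
    · have e : ∀ v : D.K → ℝ, D.onEdge v w b t = v (D.edgePath w b ⟨t, ht⟩) := fun v =>
        D.onEdge_coe v w b ⟨t, ht⟩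
      simp only [e]
      exact hlim _
  have hut : u ∈ D.tildeF := ⟨hu, fun w b => (hedge w b).1⟩
  have hd : ∀ n, s n - u ∈ D.tildeF := fun n => sub_mem_tildeF (hs n).1.1 hut
  have hline : ∀ k, Tendsto (fun n => D.lineForm k (s n - u) (s n - u)) atTop (𝓝 0) := by
    intro k
    have := tendsto_finsetSum (Finset.univ : Finset (Fin k → Fin 3)) fun w _ =>
      tendsto_finsetSum (Finset.univ : Finset (Fin 3)) fun b _ => (hedge (List.ofFn w) b).2
    simpa [lineForm] using this
  have hQ : ∀ m, Tendsto (fun n => D.Qm m (s n - u) (s n - u)) atTop (𝓝 0) := by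
    intro m
    have h0 : ∀ x, Tendsto (fun n => (s n - u) x) atTop (𝓝 0) := fun x => by
      simpa using (hlim x).sub_const (u x)
    have := tendsto_finsetSum (Finset.univ : Finset (Fin m → Fin 3)) fun w _ =>
      tendsto_finsetSum (Finset.univ : Finset (Fin 3)) fun b _ =>
        ((h0 (D.cellMap (List.ofFn w) (D.vertex b))).sub
          (h0 (D.cellMap (List.ofFn w) (D.vertex (b + 1))))).mul
        ((h0 (D.cellMap (List.ofFn w) (D.vertex b))).sub
          (h0 (D.cellMap (List.ofFn w) (D.vertex (b + 1)))))
    simpa [Qm, Q0] using this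
  have hsplit : ∀ n j, s n - u = (s n - s j) + (s j - u) := fun n j => by abel
  -- For a fixed level, s n - u is split through s j and j → ∞, where the finite sums at s j - u
  -- vanish. The resulting bound does not depend on the level m.
  have bounds : ∀ ε > 0, ∃ N, ∀ n ≥ N,
      (∀ m, ∑ k ∈ Finset.range m, (R.γ k)⁻¹ * D.lineForm k (s n - u) (s n - u) ≤ 2 * ε) ∧
      ∀ m, (R.δ m)⁻¹ * D.Qm m (s n - u) (s n - u) ≤ 2 * ε := by
    intro ε hε
    obtain ⟨N, hN⟩ := hC ε hε
    refine ⟨N, fun n hn => ⟨fun m => ?_, fun m => ?_⟩⟩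
    · have ht := ((tendsto_finsetSum (Finset.range m) fun k _ =>
        (hline k).const_mul (R.γ k)⁻¹).const_mul 2).const_add (2 * ε)
      simp only [mul_zero, Finset.sum_const_zero, add_zero] at ht
      refine ge_of_tendsto ht ?_
      filter_upwards [eventually_ge_atTop N] with j hj
      have h1 := (sum_lineForm_le_linePart m (sub_mem (hs n) (hs j))).trans (hN n hn j hj).le
      have h2 : ∑ k ∈ Finset.range m, (R.γ k)⁻¹ * D.lineForm k (s n - u) (s n - u) ≤
          2 * ∑ k ∈ Finset.range m, (R.γ k)⁻¹ * D.lineForm k (s n - s j) (s n - s j) +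
          2 * ∑ k ∈ Finset.range m, (R.γ k)⁻¹ * D.lineForm k (s j - u) (s j - u) := by
        rw [Finset.mul_sum, Finset.mul_sum, ← Finset.sum_add_distrib]
        refine Finset.sum_le_sum fun k _ => ?_
        have h3 := lineForm_add_le k (sub_mem_tildeF (hs n).1.1 (hs j).1.1) (hd j)
        rw [← hsplit n j] at h3
        have := mul_le_mul_of_nonneg_left h3 (inv_nonneg.2 (R.γ_pos k).le)
        linarith
      linarith
    · have ht := (((hQ m).const_mul (R.δ m)⁻¹).const_mul 2).const_add (2 * ε)
      simp only [mul_zero, add_zero] at ht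
      refine ge_of_tendsto ht ?_
      filter_upwards [eventually_ge_atTop N] with j hj
      have h1 := (Qm_le_linePart m (sub_mem (hs n) (hs j))).trans (hN n hn j hj).le
      have h3 := Qm_add_le m (s n - s j) (s j - u)
      rw [← hsplit n j] at h3
      have := mul_le_mul_of_nonneg_left h3 (inv_nonneg.2 (R.δ_pos m).le)
      linarith
  have hnn : ∀ v k, 0 ≤ (R.γ k)⁻¹ * D.lineForm k v v := fun v k =>
    mul_nonneg (inv_nonneg.2 (R.γ_pos k).le) (D.lineForm_self_nonneg k v)
  have hQnn : ∀ v m, 0 ≤ (R.δ m)⁻¹ * D.Qm m v v := fun v m =>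
    mul_nonneg (inv_nonneg.2 (R.δ_pos m).le) (D.Qm_self_nonneg m v)
  have hback : ∀ n, u = s n + (-1 : ℝ) • (s n - u) := fun n => by
    rw [neg_one_smul]; abel
  refine ⟨(mem_lineDomain_iff D R).2 ⟨hut, ?_, ?_⟩, ?_⟩
  · obtain ⟨N, hN⟩ := bounds 1 one_pos
    have h1 := summable_of_sum_range_le (hnn (s N - u)) (hN N le_rfl).1
    have h2 := ((mem_lineDomain_iff D R).1 (hs N)).2.1
    refine Summable.of_nonneg_of_le (hnn u) (fun k => ?_) ((h2.mul_left 2).add (h1.mul_left 2))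
    have h3 := lineForm_add_le k (hs N).1.1 (smul_mem_tildeF (-1) (hd N))
    rw [← hback N, lineForm_smul_self k _ (hd N)] at h3
    have := mul_le_mul_of_nonneg_left h3 (inv_nonneg.2 (R.γ_pos k).le)
    linarith
  · rw [Metric.tendsto_atTop]
    intro ε hε
    -- The SG energy of `u` is at most twice that of `s N` plus twice that of s N - u. The first
    -- tends to 0 in m, and the second is small for all m at once; hence the zero SG part passes to
    -- the limit.
    obtain ⟨N, hN⟩ := bounds (ε / 8) (by positivity)
    have h2 := ((mem_lineDomain_iff D R).1 (hs N)).2.2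
    obtain ⟨M, hM⟩ := eventually_atTop.1 (h2.eventually_lt_const (by positivity : 0 < ε / 4))
    refine ⟨M, fun m hm => ?_⟩
    rw [Real.dist_eq, sub_zero, abs_of_nonneg (hQnn u m)]
    have h3 := Qm_add_le m (s N) ((-1 : ℝ) • (s N - u))
    rw [← hback N, Qm_smul_self] at h3
    have h4 := mul_le_mul_of_nonneg_left h3 (inv_nonneg.2 (R.δ_pos m).le)
    have h5 := (hN N le_rfl).2 m
    have h6 := hM m hm
    linarith
  · rw [Metric.tendsto_atTop]
    intro ε hε
    obtain ⟨N, hN⟩ := bounds (ε / 4) (by positivity)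
    refine ⟨N, fun n hn => ?_⟩
    rw [Real.dist_eq, sub_zero, abs_of_nonneg (linePart_self_nonneg _)]
    have := Real.tsum_le_of_sum_range_le (hnn (s n - u)) (hN n hn).1
    rw [← linePart] at this
    linarith

/-- Energy ignores constants, so the sequence is first normalised to vanish at one vertex. The
oscillation bound then makes it uniformly Cauchy, and its limit is continuous. -/
theorem complete {s : ℕ → D.K → ℝ} (hs : ∀ n, s n ∈ D.lineDomain R)
    (hC : ∀ ε > 0, ∃ N, ∀ m ≥ N, ∀ n ≥ N, D.linePart R (s m - s n) (s m - s n) < ε) :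
    ∃ u ∈ D.lineDomain R, Tendsto (fun n => D.linePart R (s n - u) (s n - u)) atTop (𝓝 0) := by
  set v : ℕ → D.K → ℝ := fun n => s n + fun _ => -s n (D.vertex 0) with hv
  have hvm : ∀ n, v n ∈ D.lineDomain R := fun n => add_mem (hs n) (const_mem _)
  have hvd : ∀ m n, v m - v n =
      (s m - s n) + fun _ => -(s m (D.vertex 0) - s n (D.vertex 0)) := fun m n => by
    ext x
    simp only [hv, Pi.sub_apply, Pi.add_apply]
    ring
  have hvC : ∀ ε > 0, ∃ N, ∀ m ≥ N, ∀ n ≥ N, D.linePart R (v m - v n) (v m - v n) < ε := by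
    intro ε hε
    obtain ⟨N, hN⟩ := hC ε hε
    refine ⟨N, fun m hm n hn => ?_⟩
    rw [hvd, linePart_add_const_self (sub_mem (hs m) (hs n))]
    exact hN m hm n hn
  have hunif : ∀ ε > 0, ∃ N, ∀ m ≥ N, ∀ n ≥ N, ∀ x, |v m x - v n x| < ε := by
    intro ε hε
    obtain ⟨N, hN⟩ := hvC (ε ^ 2 / 400) (by positivity)
    refine ⟨N, fun m hm n hn x => abs_lt_of_sq_lt_sq ?_ hε.le⟩
    have h1 := sq_sub_le (sub_mem (hvm m) (hvm n)) x (D.vertex 0)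
    have h2 := hN m hm n hn
    have h3 : (v m - v n) x - (v m - v n) (D.vertex 0) = v m x - v n x := by
      simp [hv]
    rw [h3] at h1
    linarith
  have hpt : ∀ x, ∃ l, Tendsto (fun n => v n x) atTop (𝓝 l) := fun x => by
    refine cauchySeq_tendsto_of_complete (Metric.cauchySeq_iff.2 fun ε hε => ?_)
    obtain ⟨N, hN⟩ := hunif ε hε
    exact ⟨N, fun m hm n hn => hN m hm n hn x⟩
  choose w hw using hpt
  have hwc : Continuous w := by
    have htu : TendstoUniformly v w atTop := by
      rw [Metric.tendstoUniformly_iff]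
      intro ε hε
      obtain ⟨N, hN⟩ := hunif (ε / 2) (half_pos hε)
      filter_upwards [eventually_ge_atTop N] with n hn x
      have : |w x - v n x| ≤ ε / 2 := le_of_tendsto ((hw x).sub_const (v n x)).abs
        ((eventually_ge_atTop N).mono fun m hm => (hN m hm n hn x).le)
      rw [Real.dist_eq]
      linarith
    exact htu.continuous (Frequently.of_forall fun n => continuous_of_mem (hvm n))
  obtain ⟨hwm, hwt⟩ := mem_of_tendsto hvm hvC hwc hw
  refine ⟨w, hwm, hwt.congr fun n => ?_⟩
  have : v n - w = (s n - w) + fun _ => -s n (D.vertex 0) := by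
    ext x
    simp only [hv, Pi.sub_apply, Pi.add_apply]
    ring
  rw [this, linePart_add_const_self (sub_mem (hs n) hwm)]

/-! ### The resistance metric -/

theorem linePart_pos_of_ne {u : D.K → ℝ} (hu : u ∈ D.lineDomain R) {x y : D.K} (h : u x ≠ u y) :
    0 < D.linePart R u u := by
  refine lt_of_le_of_ne (linePart_self_nonneg u) fun h0 => h ?_
  obtain ⟨c, rfl⟩ := eq_const_of_linePart_eq_zero hu h0.symm
  rfl

theorem bddAbove_resistanceSet (x y : D.K) :
    BddAbove (resistanceSet (D.linePart R) (D.lineDomain R) x y) := by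
  refine ⟨400, ?_⟩
  rintro _ ⟨u, hu, hpos, rfl⟩
  rw [div_le_iff₀ hpos, sq_abs]
  exact sq_sub_le hu x y

theorem isResistanceForm : IsResistanceForm (D.linePart R) (D.lineDomain R) where
  const_mem := const_mem
  add_mem _ hu _ hv := add_mem hu hv
  smul_mem c _ hu := smul_mem c hu
  symm u _ v _ := linePart_comm u v
  add_left _ hu _ hv _ hw := linePart_add_left hu hv hw
  smul_left c _ hu _ hv := linePart_smul_left c hu hv
  nonneg u _ := linePart_self_nonneg u
  eq_zero_iff u hu := by
    refine ⟨eq_const_of_linePart_eq_zero hu, ?_⟩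
    rintro ⟨c, rfl⟩
    exact linePart_const_right hu c
  complete _ hs hC := complete hs hC
  separates _ _ h := separates h
  bddAbove := bddAbove_resistanceSet
  markov _ hu := markov hu

theorem eventually_resistanceMetric_lt {ε : ℝ} (hε : 0 < ε) (x : D.K) :
    ∀ᶠ y in 𝓝 x, resistanceMetric (D.linePart R) (D.lineDomain R) x y < ε := by
  filter_upwards [eventually_sq_sub_le (half_pos hε) x] with y hy
  refine lt_of_le_of_lt (Real.sSup_le ?_ (half_pos hε).le) (half_lt_self hε)
  rintro _ ⟨u, hu, hpos, rfl⟩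
  rw [div_le_iff₀ hpos, sq_abs, sub_sq_comm]
  exact hy R u hu

/-- Near each y in `t`, one function separating x from y gives a positive lower bound by continuity;
compactness reduces to finitely many such neighbourhoods. -/
theorem exists_le_resistanceMetric {x : D.K} {t : Set D.K} (ht : IsCompact t) (hx : x ∉ t) :
    ∃ ε > 0, ∀ y ∈ t, ε ≤ resistanceMetric (D.linePart R) (D.lineDomain R) x y := by
  refine ht.induction_on (p := fun t => ∃ ε > 0, ∀ y ∈ t,
    ε ≤ resistanceMetric (D.linePart R) (D.lineDomain R) x y) ⟨1, one_pos, by simp⟩ ?_ ?_ ?_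
  · rintro s t hst ⟨ε, hε, h⟩
    exact ⟨ε, hε, fun y hy => h y (hst hy)⟩
  · rintro s t ⟨ε, hε, h⟩ ⟨ε', hε', h'⟩
    refine ⟨min ε ε', lt_min hε hε', fun y hy => ?_⟩
    rcases hy with hy | hy
    · exact (min_le_left _ _).trans (h y hy)
    · exact (min_le_right _ _).trans (h' y hy)
  · intro y hy
    obtain ⟨u, hu, hne⟩ := separates (R := R) (fun h => hx (h ▸ hy) : x ≠ y)
    have hE := linePart_pos_of_ne hu hne
    have hpos : 0 < |u x - u y| ^ 2 := pow_pos (abs_pos.2 (sub_ne_zero.2 hne)) 2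
    have hev : ∀ᶠ z in 𝓝 y, |u x - u y| ^ 2 / 2 < |u x - u z| ^ 2 :=
      ((continuous_const.sub (continuous_of_mem hu)).abs.pow 2).tendsto y |>.eventually_const_lt
        (half_lt_self hpos)
    refine ⟨_, mem_nhdsWithin_of_mem_nhds hev, |u x - u y| ^ 2 / 2 / D.linePart R u u,
      by positivity, fun z hz => ?_⟩
    refine le_trans ?_ (le_csSup (bddAbove_resistanceSet x z) ⟨u, hu, hE, rfl⟩)
    exact div_le_div_of_nonneg_right (le_of_lt hz) hE.le

theorem isOpen_iff_resistanceMetric (s : Set D.K) : IsOpen s ↔ ∀ x ∈ s, ∃ ε > 0, ∀ y : D.K,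
    resistanceMetric (D.linePart R) (D.lineDomain R) x y < ε → y ∈ s := by
  constructor
  · intro hs x hx
    obtain ⟨ε, hε, h⟩ := exists_le_resistanceMetric (R := R) (x := x) hs.isClosed_compl.isCompact
      (fun h => h hx)
    refine ⟨ε, hε, fun y hy => ?_⟩
    by_contra hys
    exact absurd (h y hys) (not_le.2 hy)
  · intro h
    rw [isOpen_iff_mem_nhds]
    intro x hx
    obtain ⟨ε, hε, hs⟩ := h x hx
    exact (eventually_resistanceMetric_lt hε x).mono hs

/-! ### Invariance under symmetries -/

section Invariance

variable {φ : Plane →ₗ[ℝ] Plane} {ψ : D.K → D.K} {σ : Equiv.Perm (Fin 3)}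
  (hψ : ∀ x, (ψ x : Plane) = φ x) (hσ : ∀ i, φ (D.p i) = D.p (σ i))
include hψ hσ

theorem map_cellMap (w : List (Fin 3)) (x : D.K) :
    ψ (D.cellMap w x) = D.cellMap (w.map σ) (ψ x) := by
  refine Subtype.ext ?_
  rw [hψ]
  change φ (D.wordMap w x) = D.wordMap (w.map σ) (ψ x)
  rw [D.map_wordMap hσ, hψ]

theorem map_vertex (i : Fin 3) : ψ (D.vertex i) = D.vertex (σ i) :=
  Subtype.ext ((hψ _).trans (hσ i))

/-- The symmetries map bonds to bonds, up to reversal. -/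
theorem onEdge_comp_symmetry : ∃ τ : Equiv.Perm (Fin 3),
    ∀ u ∈ D.tildeF, ∀ w b,
      MemH1 (D.onEdge (u ∘ ψ) w b) ∧
      dirichletForm (D.onEdge (u ∘ ψ) w b) (D.onEdge (u ∘ ψ) w b) =
        dirichletForm (D.onEdge u (w.map σ) (τ b)) (D.onEdge u (w.map σ) (τ b)) := by
  rcases perm_three σ with h | h
  · refine ⟨σ, fun u hu w b => ?_⟩
    have e : EqOn (D.onEdge (u ∘ ψ) w b) (D.onEdge u (w.map σ) (σ b)) (Icc 0 1) := fun t ht => by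
      have h1 := D.onEdge_coe (u ∘ ψ) w b ⟨t, ht⟩
      have h2 := D.onEdge_coe u (w.map σ) (σ b) ⟨t, ht⟩
      simp only at h1 h2
      rw [h1, h2, Function.comp_apply, edgePath, map_cellMap hψ hσ]
      refine congrArg (fun z => u (D.cellMap (w.map σ) z)) (Subtype.ext ?_)
      rw [hψ]
      exact D.map_bondPath_of_succ hσ (h b) t
    exact ⟨(hu.2 _ _).congr e, dirichletForm_congr (hu.2 _ _) (hu.2 _ _) e e⟩
  -- For a reflection the image of the bond (b, b + 1) starts, in its standard orientation, at σ(b +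
  -- 1), and the path is traversed backwards.
  · refine ⟨(Equiv.addRight (1 : Fin 3)).trans σ, fun u hu w b => ?_⟩
    have e : EqOn (D.onEdge (u ∘ ψ) w b)
        (fun t => D.onEdge u (w.map σ) (σ (b + 1)) (1 - t)) (Icc 0 1) := fun t ht => by
      have ht' : 1 - t ∈ Icc (0 : ℝ) 1 := ⟨by linarith [ht.2], by linarith [ht.1]⟩
      have h1 := D.onEdge_coe (u ∘ ψ) w b ⟨t, ht⟩
      have h2 := D.onEdge_coe u (w.map σ) (σ (b + 1)) ⟨1 - t, ht'⟩
      simp only at h1 h2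
      simp only
      rw [h1, h2, Function.comp_apply, edgePath, map_cellMap hψ hσ]
      refine congrArg (fun z => u (D.cellMap (w.map σ) z)) (Subtype.ext ?_)
      rw [hψ]
      exact D.map_bondPath_of_pred hσ (h b) t
    have hm := hu.2 (w.map σ) (σ (b + 1))
    exact ⟨hm.comp_one_sub.congr e, (dirichletForm_congr hm.comp_one_sub hm.comp_one_sub e e).trans
      (dirichletForm_comp_one_sub hm hm)⟩

theorem comp_symmetry_mem (hc : Continuous ψ) {u : D.K → ℝ} (hu : u ∈ D.lineDomain R) :
    u ∘ ψ ∈ D.lineDomain R ∧ D.linePart R (u ∘ ψ) (u ∘ ψ) = D.linePart R u u := by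
  obtain ⟨τ, hτ⟩ := onEdge_comp_symmetry hψ hσ
  have hline : ∀ k, D.lineForm k (u ∘ ψ) (u ∘ ψ) = D.lineForm k u u := by
    intro k
    refine Fintype.sum_equiv ((Equiv.refl (Fin k)).arrowCongr σ) _ _ fun w => ?_
    refine Fintype.sum_equiv τ _ _ fun b => ?_
    rw [(hτ u hu.1.1 _ b).2, List.map_ofFn]
    rfl
  have hQ0 : ∀ v : D.K → ℝ, D.Q0 (v ∘ ψ) (v ∘ ψ) = D.Q0 v v := by
    intro v
    rcases perm_three σ with h | h
    · refine Fintype.sum_equiv σ _ _ fun b => ?_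
      simp only [Function.comp_apply, map_vertex hψ hσ, h]
    · refine Fintype.sum_equiv ((Equiv.addRight (1 : Fin 3)).trans σ) _ _ fun b => ?_
      simp only [Function.comp_apply, map_vertex hψ hσ, Equiv.trans_apply, Equiv.coe_addRight, h]
      ring
  have hQ : ∀ m, D.Qm m (u ∘ ψ) (u ∘ ψ) = D.Qm m u u := by
    intro m
    refine Fintype.sum_equiv ((Equiv.refl (Fin m)).arrowCongr σ) _ _ fun w => ?_
    have : (u ∘ ψ) ∘ D.cellMap (List.ofFn w) =
        (u ∘ D.cellMap (List.ofFn ((Equiv.refl (Fin m)).arrowCongr σ w))) ∘ ψ := by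
      ext x
      simp only [Function.comp_apply]
      rw [map_cellMap hψ hσ, List.map_ofFn]
      rfl
    rw [this, hQ0]
  refine ⟨?_, by simp only [linePart, hline]⟩
  have hu' := (mem_lineDomain_iff D R).1 hu
  refine (mem_lineDomain_iff D R).2
    ⟨⟨hu'.1.1.comp hc, fun w b => (hτ u hu'.1 w b).1⟩, ?_, ?_⟩
  · simpa only [hline] using hu'.2.1
  · simpa only [hQ] using hu'.2.2

end Invariance

theorem isSymmetricForm : D.IsSymmetricForm (D.linePart R) (D.lineDomain R) where
  isResistanceForm := isResistanceForm
  continuous _ hu := continuous_of_mem hu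
  mem_iff u := by
    constructor
    · exact fun hu => ⟨fun i => ⟨u, hu, fun _ => rfl⟩, fun b => memH1_of_mem hu [] b⟩
    · rintro ⟨h1, h2⟩
      refine mem_of_cells (fun i => ?_) h2
      obtain ⟨v, hv, hvu⟩ := h1 i
      have : u ∘ D.cellMap [i] = v ∘ D.cellMap [i] := funext hvu
      rw [this]
      exact comp_cellMap_mem hv i
  isOpen_iff := isOpen_iff_resistanceMetric
  invariant φ hφ u hu := by
    obtain ⟨σ, hσ⟩ := D.exists_perm_of_image_eq hφ
    exact comp_symmetry_mem (ψ := fun x => ⟨φ x, hφ.subset (mem_image_of_mem φ x.2)⟩)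
      (fun _ => rfl) hσ
      ((φ.continuous_of_finiteDimensional.comp continuous_subtype_val).subtype_mk _) hu

end SSGSetup

/-! ## Harmonic functions and the trace on the vertices of the triangle -/

namespace MatchingSeq

variable (R : MatchingSeq)

/-- The ratio of the oscillation of a harmonic function on a cell and on `K`. -/
noncomputable def cellRatio : ℝ := R.r 0 * R.shift.resistance / R.resistance

theorem cellRatio_nonneg : 0 ≤ R.cellRatio :=
  div_nonneg (mul_nonneg (R.r_pos 0).le R.shift.resistance_nonneg) R.resistance_nonneg

/-- The share of a vertex difference that drops across the bond. -/
theorem one_sub_cellRatio : 1 - 5 / 3 * R.cellRatio = R.ρ 0 / R.resistance := by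
  have h := R.resistance_eq
  have hX := R.resistance_pos
  have hr := R.r_eq 0
  rw [cellRatio, eq_div_iff hX.ne', sub_mul, mul_assoc, div_mul_cancel₀ _ hX.ne', hr]
  linarith

theorem cellRatio_le : R.cellRatio ≤ 3 / 5 := by
  have h := R.one_sub_cellRatio
  have := div_nonneg (R.ρ_pos 0).le R.resistance_nonneg
  linarith

/-- The infinite product splits into its first m factors and the tail. The identity is proved
through the recursion, hence also holds when the product is 0. -/
theorem one_sub_resistance (m : ℕ) {R : MatchingSeq} :
    1 - R.resistance = R.partialProd m * (1 - (shift^[m] R).resistance) := by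
  induction m generalizing R with
  | zero => simp [partialProd_zero]
  | succ m ih =>
    rw [Function.iterate_succ_apply, partialProd_succ, mul_assoc, ← ih (R := R.shift),
      R.resistance_eq]
    ring

/-- The values at the points `p_{ij}` of the harmonic function with values `a` at the vertices. -/
noncomputable def cellValues (a : Fin 3 → ℝ) (i j : Fin 3) : ℝ :=
  if j = i then a i else a i - R.cellRatio * (4 * a i - a j - (a 0 + a 1 + a 2)) / 3

theorem cellValues_self (a : Fin 3 → ℝ) (i : Fin 3) : R.cellValues a i i = a i := if_pos rfl

theorem cellValues_sub (a : Fin 3 → ℝ) (b : Fin 3) :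
    R.cellValues a b (b + 1) - R.cellValues a (b + 1) b =
      R.ρ 0 / R.resistance * (a b - a (b + 1)) := by
  rw [← one_sub_cellRatio]
  fin_cases b <;> simp [cellValues] <;> ring

theorem sum_sq_cellValues (a : Fin 3 → ℝ) :
    ∑ i, ∑ b, (R.cellValues a i b - R.cellValues a i (b + 1)) ^ 2 =
      5 / 3 * R.cellRatio ^ 2 * ∑ b, (a b - a (b + 1)) ^ 2 := by
  simp [Fin.sum_univ_three, cellValues]
  ring

/-- Maximum principle: for j ≠ i and k the third index the value is (1 - t) a_i + t (2 a_j + a_k) /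
3 with t = `R.cellRatio` in [0, 1]. -/
theorem cellValues_mem_Icc {a : Fin 3 → ℝ} {l h : ℝ} (ha : ∀ i, a i ∈ Icc l h) (i j : Fin 3) :
    R.cellValues a i j ∈ Icc l h := by
  have t0 := R.cellRatio_nonneg
  have t1 : 0 ≤ 1 - R.cellRatio := by linarith [R.cellRatio_le]
  have k1 := fun i => mul_nonneg t0 (sub_nonneg.2 (ha i).1)
  have k2 := fun i => mul_nonneg t0 (sub_nonneg.2 (ha i).2)
  have k3 := fun i => mul_nonneg t1 (sub_nonneg.2 (ha i).1)
  have k4 := fun i => mul_nonneg t1 (sub_nonneg.2 (ha i).2)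
  have k10 := k1 0
  have k11 := k1 1
  have k12 := k1 2
  have k20 := k2 0
  have k21 := k2 1
  have k22 := k2 2
  have k3i := k3 i
  have k4i := k4 i
  have hai := ha i
  rw [cellValues]
  split_ifs with hij
  · exact hai
  · constructor <;> fin_cases i <;> fin_cases j <;> simp at * <;> linarith

theorem abs_cellValues_sub_le {a : Fin 3 → ℝ} {M : ℝ} (ha : ∀ i j, |a i - a j| ≤ M)
    (i j k : Fin 3) : |R.cellValues a i j - R.cellValues a i k| ≤ 3 / 5 * M := by
  have t0 := R.cellRatio_nonneg
  have hM : 0 ≤ M := (abs_nonneg _).trans (ha 0 0)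
  have hle := mul_le_mul_of_nonneg_right R.cellRatio_le hM
  refine le_trans ?_ hle
  have h := fun i j => mul_nonneg t0 (sub_nonneg.2 ((le_abs_self _).trans (ha i j)))
  have h01 := h 0 1
  have h02 := h 0 2
  have h10 := h 1 0
  have h12 := h 1 2
  have h20 := h 2 0
  have h21 := h 2 1
  have h00 := mul_nonneg t0 hM
  clear hle h ha
  rw [abs_le]
  fin_cases i <;> fin_cases j <;> fin_cases k <;> simp [cellValues] <;>
    first | exact h00 | (constructor <;> linarith)

end MatchingSeq

namespace SSGSetup

variable {D : SSGSetup} {R : MatchingSeq}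

/-- Approximations of the harmonic function with values `a` at the vertices. -/
noncomputable def harmonicApprox (D : SSGSetup) : ℕ → MatchingSeq → (Fin 3 → ℝ) → D.K → ℝ
  -- The starting function need only be continuous, have the right vertex values and stay within
  -- their range; its energy is never used.
  | 0, _, a => fun x => a 0 * D.bary 0 x + a 1 * D.bary 1 x + a 2 * D.bary 2 x
  | n + 1, R, a => D.affineGlue fun i => D.harmonicApprox n R.shift (R.cellValues a i)

theorem harmonicApprox_cellMap (n : ℕ) (R : MatchingSeq) (a : Fin 3 → ℝ) (i : Fin 3) (x : D.K) :
    D.harmonicApprox (n + 1) R a (D.cellMap [i] x) =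
      D.harmonicApprox n R.shift (R.cellValues a i) x :=
  affineGlue_cellMap _ i x

theorem harmonicApprox_vertex (n : ℕ) (R : MatchingSeq) (a : Fin 3 → ℝ) (i : Fin 3) :
    D.harmonicApprox n R a (D.vertex i) = a i := by
  induction n generalizing R a with
  | zero =>
    simp only [harmonicApprox, vertex, bary_p]
    fin_cases i <;> simp
  | succ n ih =>
    rw [← cellMap_vertex_self, harmonicApprox_cellMap, ih, R.cellValues_self]

theorem harmonicApprox_edgePath (n : ℕ) (R : MatchingSeq) (a : Fin 3 → ℝ) (b : Fin 3)
    (t : Icc (0 : ℝ) 1) : D.harmonicApprox (n + 1) R a (D.edgePath [] b t) =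
      R.cellValues a b (b + 1) +
        t * (R.cellValues a (b + 1) b - R.cellValues a b (b + 1)) := by
  rw [harmonicApprox, affineGlue_edgePath, harmonicApprox_vertex, harmonicApprox_vertex]

theorem continuous_harmonicApprox (n : ℕ) (R : MatchingSeq) (a : Fin 3 → ℝ) :
    Continuous (D.harmonicApprox n R a) := by
  induction n generalizing R a with
  | zero =>
    have h := fun i => (D.continuous_bary i).comp (continuous_subtype_val (p := (· ∈ D.K)))
    exact ((continuous_const.mul (h 0)).add (continuous_const.mul (h 1))).add
      (continuous_const.mul (h 2))
  | succ n ih =>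
    refine D.continuous_of_cover (fun i => ?_) fun b => ?_
    · exact (ih R.shift (R.cellValues a i)).congr fun x => (harmonicApprox_cellMap n R a i x).symm
    · refine Continuous.congr ?_ fun t => (harmonicApprox_edgePath n R a b t).symm
      fun_prop

theorem harmonicApprox_mem_Icc (n : ℕ) (R : MatchingSeq) {a : Fin 3 → ℝ} {l h : ℝ}
    (ha : ∀ i, a i ∈ Icc l h) (x : D.K) : D.harmonicApprox n R a x ∈ Icc l h := by
  induction n generalizing R a x with
  | zero =>
    have hs := D.sum_bary x
    have k1 := fun i => mul_nonneg (sub_nonneg.2 (ha i).1) (D.bary_nonneg i x)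
    have k2 := fun i => mul_nonneg (sub_nonneg.2 (ha i).2) (D.bary_nonneg i x)
    have el : l = l * D.bary 0 x + l * D.bary 1 x + l * D.bary 2 x := by
      linear_combination -l * hs
    have eh : h = h * D.bary 0 x + h * D.bary 1 x + h * D.bary 2 x := by
      linear_combination -h * hs
    simp only [harmonicApprox]
    constructor
    · linarith [k1 0, k1 1, k1 2]
    · linarith [k2 0, k2 1, k2 2]
  | succ n ih =>
    have hc := R.cellValues_mem_Icc ha
    refine D.cases_K (P := fun x => D.harmonicApprox (n + 1) R a x ∈ Icc l h) (fun i y => ?_)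
      (fun b t => ?_) x
    · rw [harmonicApprox_cellMap]
      exact ih R.shift (hc i) y
    · rw [harmonicApprox_edgePath]
      have := convex_Icc l h (hc b (b + 1)) (hc (b + 1) b) (sub_nonneg.2 t.2.2) t.2.1 (by ring)
      convert this using 1
      simp only [smul_eq_mul]
      ring

/-- On the level-0 bonds the approximations no longer change after the first step; in cells the
oscillation of the boundary values has shrunk by 3/5. -/
theorem abs_harmonicApprox_sub_le (n : ℕ) (R : MatchingSeq) {a : Fin 3 → ℝ} {M : ℝ}
    (ha : ∀ i j, |a i - a j| ≤ M) (x : D.K) :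
    |D.harmonicApprox (n + 1) R a x - D.harmonicApprox n R a x| ≤ (3 / 5) ^ n * M := by
  induction n generalizing R a M x with
  | zero =>
    obtain ⟨i, hi⟩ := Finite.exists_min a
    obtain ⟨j, hj⟩ := Finite.exists_max a
    have h1 := harmonicApprox_mem_Icc 0 R (fun k => ⟨hi k, hj k⟩) x
    have h2 := harmonicApprox_mem_Icc 1 R (fun k => ⟨hi k, hj k⟩) x
    have h3 := (le_abs_self _).trans (ha j i)
    rw [abs_le]
    constructor <;> simp only [pow_zero, one_mul, zero_add] <;> linarith [h1.1, h1.2, h2.1, h2.2]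
  | succ n ih =>
    refine D.cases_K (P := fun x => |D.harmonicApprox (n + 1 + 1) R a x -
      D.harmonicApprox (n + 1) R a x| ≤ (3 / 5) ^ (n + 1) * M) (fun i y => ?_) (fun b t => ?_) x
    · rw [harmonicApprox_cellMap, harmonicApprox_cellMap, pow_succ, mul_assoc]
      exact ih R.shift (R.abs_cellValues_sub_le ha i) y
    · rw [harmonicApprox_edgePath, harmonicApprox_edgePath, sub_self, abs_zero]
      exact mul_nonneg (by positivity) ((abs_nonneg _).trans (ha 0 0))

/-- The harmonic function of the line part with values `a` at the vertices. -/
noncomputable def harmonic (D : SSGSetup) (R : MatchingSeq) (a : Fin 3 → ℝ) (x : D.K) : ℝ :=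
  limUnder atTop fun n => D.harmonicApprox n R a x

theorem exists_osc_bound (a : Fin 3 → ℝ) : ∃ M, ∀ i j, |a i - a j| ≤ M := by
  obtain ⟨M, hM⟩ := (Set.finite_range fun k : Fin 3 × Fin 3 => |a k.1 - a k.2|).bddAbove
  exact ⟨M, fun i j => hM ⟨(i, j), rfl⟩⟩

theorem tendsto_harmonicApprox (R : MatchingSeq) (a : Fin 3 → ℝ) (x : D.K) :
    Tendsto (fun n => D.harmonicApprox n R a x) atTop (𝓝 (D.harmonic R a x)) := by
  obtain ⟨M, hM⟩ := exists_osc_bound a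
  refine (cauchySeq_of_le_geometric (3 / 5) M (by norm_num) fun n => ?_).tendsto_limUnder
  rw [dist_comm, mul_comm]
  exact abs_harmonicApprox_sub_le n R hM x

theorem continuous_harmonic (R : MatchingSeq) (a : Fin 3 → ℝ) : Continuous (D.harmonic R a) := by
  obtain ⟨M, hM⟩ := exists_osc_bound a
  have htu : TendstoUniformly (fun n => D.harmonicApprox n R a) (D.harmonic R a) atTop := by
    rw [Metric.tendstoUniformly_iff]
    intro ε hε
    have ht : Tendsto (fun n : ℕ => M * (3 / 5 : ℝ) ^ n / (1 - 3 / 5)) atTop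
        (𝓝 (M * 0 / (1 - 3 / 5))) :=
      ((tendsto_pow_atTop_nhds_zero_of_lt_one (by norm_num) (by norm_num)).const_mul _).div_const _
    rw [mul_zero, zero_div] at ht
    filter_upwards [ht.eventually_lt_const hε] with n hn x
    rw [dist_comm]
    refine lt_of_le_of_lt (dist_le_of_le_geometric_of_tendsto (3 / 5) M (by norm_num) (fun n => ?_)
      (tendsto_harmonicApprox R a x) n) hn
    rw [dist_comm, mul_comm]
    exact abs_harmonicApprox_sub_le n R hM x
  exact htu.continuous (Frequently.of_forall fun n => continuous_harmonicApprox n R a)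

theorem harmonic_vertex (R : MatchingSeq) (a : Fin 3 → ℝ) (i : Fin 3) :
    D.harmonic R a (D.vertex i) = a i := by
  have h := tendsto_harmonicApprox R a (D.vertex i)
  simp only [harmonicApprox_vertex] at h
  exact tendsto_nhds_unique h tendsto_const_nhds

theorem harmonic_comp_cellMap (R : MatchingSeq) (a : Fin 3 → ℝ) (i : Fin 3) :
    D.harmonic R a ∘ D.cellMap [i] = D.harmonic R.shift (R.cellValues a i) := by
  ext x
  have h := (tendsto_add_atTop_iff_nat 1).2 (tendsto_harmonicApprox R a (D.cellMap [i] x))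
  simp only [harmonicApprox_cellMap] at h
  exact tendsto_nhds_unique h (tendsto_harmonicApprox _ _ x)

theorem onEdge_harmonic (R : MatchingSeq) (a : Fin 3 → ℝ) (b : Fin 3) :
    EqOn (D.onEdge (D.harmonic R a) [] b) (fun t => R.cellValues a b (b + 1) +
      t * (R.cellValues a (b + 1) b - R.cellValues a b (b + 1))) (Icc 0 1) := by
  intro t ht
  rw [D.onEdge_coe _ [] b ⟨t, ht⟩]
  have h := (tendsto_add_atTop_iff_nat 1).2
    (tendsto_harmonicApprox R a (D.edgePath [] b ⟨t, ht⟩))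
  simp only [harmonicApprox_edgePath] at h
  exact tendsto_nhds_unique h tendsto_const_nhds

theorem memH1_harmonic (R : MatchingSeq) (a : Fin 3 → ℝ) (w : List (Fin 3)) (b : Fin 3) :
    MemH1 (D.onEdge (D.harmonic R a) w b) := by
  induction w generalizing R a with
  | nil => exact (memH1_affine _ _).congr (onEdge_harmonic R a b)
  | cons i w ih =>
    have := ih R.shift (R.cellValues a i)
    rw [← harmonic_comp_cellMap] at this
    exact this

/-! ### The energy of the harmonic functions. -/

/-- Each level multiplies the vertex form by (5/3) t² with t = r_0 X' / X, where X' is the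
resistance of the shift, that is by r_0 (1 - ρ_0) (X' / X)²; the quotients telescope. -/
theorem Qm_harmonic (m : ℕ) (R : MatchingSeq) (a : Fin 3 → ℝ) :
    D.Qm m (D.harmonic R a) (D.harmonic R a) = R.δ m * (R.partialProd m *
      (MatchingSeq.shift^[m] R).resistance ^ 2 / R.resistance ^ 2) *
        ∑ b, (a b - a (b + 1)) ^ 2 := by
  induction m generalizing R a with
  | zero =>
    have h := R.resistance_pos.ne'
    simp only [Qm_zero, Q0, harmonic_vertex, R.δ_zero, R.partialProd_zero, Function.iterate_zero,
      id_eq, one_mul]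
    rw [div_self (pow_ne_zero 2 h), one_mul]
    simp only [sq]
  | succ m ih =>
    have h := R.resistance_pos.ne'
    have h' := R.shift.resistance_pos.ne'
    simp only [Qm_succ, harmonic_comp_cellMap, ih]
    rw [← Finset.mul_sum, R.sum_sq_cellValues, R.δ_succ, R.partialProd_succ,
      Function.iterate_succ_apply, MatchingSeq.cellRatio,
      show 1 - R.ρ 0 = 5 / 3 * R.r 0 by rw [R.r_eq]; ring]
    field_simp

theorem lineForm_harmonic (k : ℕ) (R : MatchingSeq) (a : Fin 3 → ℝ) :
    D.lineForm k (D.harmonic R a) (D.harmonic R a) =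
      R.γ k * (R.ρ k * R.partialProd k / R.resistance ^ 2) * ∑ b, (a b - a (b + 1)) ^ 2 := by
  induction k generalizing R a with
  | zero =>
    have h : ∀ b, dirichletForm (D.onEdge (D.harmonic R a) [] b)
        (D.onEdge (D.harmonic R a) [] b) =
        (R.ρ 0 / R.resistance) ^ 2 * (a b - a (b + 1)) ^ 2 := fun b => by
      rw [dirichletForm_congr (memH1_affine _ _) (memH1_affine _ _) (onEdge_harmonic R a b)
        (onEdge_harmonic R a b), dirichletForm_affine, sub_sq_comm, R.cellValues_sub]
      ring
    simp only [lineForm_zero, h]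
    rw [← Finset.mul_sum, R.γ_zero, R.partialProd_zero]
    ring
  | succ k ih =>
    have h := R.resistance_pos.ne'
    have h' := R.shift.resistance_pos.ne'
    simp only [lineForm_succ, harmonic_comp_cellMap, ih]
    rw [← Finset.mul_sum, R.sum_sq_cellValues, R.γ_succ, R.partialProd_succ,
      MatchingSeq.cellRatio, show 1 - R.ρ 0 = 5 / 3 * R.r 0 by rw [R.r_eq]; ring,
      show R.ρ (k + 1) = R.shift.ρ k from rfl]
    field_simp

theorem hasSum_lineForm_harmonic (R : MatchingSeq) (a : Fin 3 → ℝ) :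
    HasSum (fun k => (R.γ k)⁻¹ * D.lineForm k (D.harmonic R a) (D.harmonic R a))
      (R.resistance⁻¹ * ∑ b, (a b - a (b + 1)) ^ 2) := by
  have h := R.resistance_pos.ne'
  have hs := R.hasSum_mul_partialProd.mul_right
    ((R.resistance ^ 2)⁻¹ * ∑ b, (a b - a (b + 1)) ^ 2)
  have e : R.resistance * ((R.resistance ^ 2)⁻¹ * ∑ b, (a b - a (b + 1)) ^ 2) =
      R.resistance⁻¹ * ∑ b, (a b - a (b + 1)) ^ 2 := by
    field_simp
  rw [e] at hs
  refine hs.congr_fun fun k => ?_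
  have := (R.γ_pos k).ne'
  rw [lineForm_harmonic]
  field_simp

/-- As X_m² ≤ X_m, the SG energy is controlled by P_m X_m = P_m - (1 - X), which tends to 0. -/
theorem harmonic_mem (R : MatchingSeq) (a : Fin 3 → ℝ) : D.harmonic R a ∈ D.lineDomain R := by
  refine (mem_lineDomain_iff D R).2 ⟨⟨continuous_harmonic R a, memH1_harmonic R a⟩,
    (hasSum_lineForm_harmonic R a).summable, ?_⟩
  have ht := ((R.tendsto_partialProd.sub_const (1 - R.resistance)).div_const
    (R.resistance ^ 2)).mul_const (∑ b, (a b - a (b + 1)) ^ 2)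
  rw [sub_self, zero_div, zero_mul] at ht
  refine squeeze_zero (fun m => mul_nonneg (inv_nonneg.2 (R.δ_pos m).le) (D.Qm_self_nonneg m _))
    (fun m => ?_) ht
  rw [Qm_harmonic, mul_assoc, inv_mul_cancel_left₀ (R.δ_pos m).ne',
    MatchingSeq.one_sub_resistance m (R := R)]
  refine mul_le_mul_of_nonneg_right (div_le_div_of_nonneg_right ?_ (sq_nonneg _))
    (Finset.sum_nonneg fun _ _ => sq_nonneg _)
  have h0 := (MatchingSeq.shift^[m] R).resistance_nonneg
  have h1 := (MatchingSeq.shift^[m] R).resistance_le_one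
  have := mul_le_mul_of_nonneg_left (mul_le_of_le_one_left h0 h1) (R.partialProd_pos m).le
  linarith

theorem Q0_harmonic (R : MatchingSeq) (a : Fin 3 → ℝ) :
    D.Q0 (D.harmonic R a) (D.harmonic R a) = ∑ b, (a b - a (b + 1)) ^ 2 := by
  simp only [Q0, harmonic_vertex, sq]

theorem linePart_harmonic (R : MatchingSeq) (a : Fin 3 → ℝ) :
    D.linePart R (D.harmonic R a) (D.harmonic R a) =
      R.resistance⁻¹ * D.Q0 (D.harmonic R a) (D.harmonic R a) := by
  rw [Q0_harmonic]
  exact (hasSum_lineForm_harmonic R a).tsum_eq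

/-! ### The trace on the vertices and the constant `r0`. -/

theorem Q0_congr {u v : D.K → ℝ} (h : EqOn v u (range D.vertex)) : D.Q0 v v = D.Q0 u u := by
  simp only [Q0, h (mem_range_self _)]

theorem inv_mul_Q0_le {u : D.K → ℝ} (hu : u ∈ D.lineDomain R) :
    R.resistance⁻¹ * D.Q0 u u ≤ D.linePart R u u :=
  inv_mul_le_of_le_mul₀ R.resistance_nonneg (linePart_self_nonneg u) (Q0_le hu)

theorem isHarmonicExtension_harmonic (R : MatchingSeq) (a : Fin 3 → ℝ) :
    IsHarmonicExtension (D.linePart R) (D.lineDomain R) (range D.vertex) (D.harmonic R a) := by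
  refine ⟨harmonic_mem R a, fun v hv hvu => ?_⟩
  rw [linePart_harmonic, ← Q0_congr hvu]
  exact inv_mul_Q0_le hv

theorem linePart_eq_of_isHarmonicExtension {u : D.K → ℝ}
    (hu : IsHarmonicExtension (D.linePart R) (D.lineDomain R) (range D.vertex) u) :
    D.linePart R u u = R.resistance⁻¹ * D.Q0 u u := by
  refine le_antisymm ?_ (inv_mul_Q0_le hu.1)
  have he : EqOn (D.harmonic R fun i => u (D.vertex i)) u (range D.vertex) := by
    rintro _ ⟨i, rfl⟩
    exact harmonic_vertex R _ i
  have := hu.2 _ (harmonic_mem R _) he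
  rwa [linePart_harmonic, Q0_congr he] at this

/-- The lower bound is an equality at `u` and at `v`. Applied to u + v and u - v it gives the two
inequalities between the mixed terms, so it is not needed that sums of harmonic functions are
harmonic. -/
theorem isTraceConstant_resistance :
    D.IsTraceConstant (D.linePart R) (D.lineDomain R) R.resistance := by
  refine ⟨R.resistance_pos, fun f => ⟨D.harmonic R f, isHarmonicExtension_harmonic R f,
    harmonic_vertex R f⟩, fun u v hu hv => ?_⟩
  have h1 := linePart_eq_of_isHarmonicExtension hu
  have h2 := linePart_eq_of_isHarmonicExtension hv
  have h3 := inv_mul_Q0_le (add_mem hu.1 hv.1)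
  have h4 := inv_mul_Q0_le (sub_mem hu.1 hv.1)
  rw [linePart_add_self hu.1 hv.1] at h3
  rw [linePart_sub_self hu.1 hv.1] at h4
  have e1 : D.Q0 (u + v) (u + v) = D.Q0 u u + 2 * D.Q0 u v + D.Q0 v v := by
    simp only [Q0, Finset.mul_sum, ← Finset.sum_add_distrib, Pi.add_apply]
    exact Finset.sum_congr rfl fun b _ => by ring
  have e2 : D.Q0 (u - v) (u - v) = D.Q0 u u - 2 * D.Q0 u v + D.Q0 v v := by
    simp only [Q0, Finset.mul_sum, ← Finset.sum_add_distrib, ← Finset.sum_sub_distrib,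
      Pi.sub_apply]
    exact Finset.sum_congr rfl fun b _ => by ring
  rw [e1] at h3
  rw [e2] at h4
  apply le_antisymm <;> linarith

theorem IsTraceConstant.unique {E : (D.K → ℝ) → (D.K → ℝ) → ℝ} {F : Set (D.K → ℝ)} {r r' : ℝ}
    (h : D.IsTraceConstant E F r) (h' : D.IsTraceConstant E F r') : r = r' := by
  -- Any nonconstant boundary value determines the constant; for the indicator of one vertex the
  -- vertex form equals 2.
  obtain ⟨u, hu, huv⟩ := h.2.1 fun i => if i = 0 then 1 else 0
  have e := (h.2.2 u u hu hu).symm.trans (h'.2.2 u u hu hu)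
  have hQ : D.Q0 u u = 2 := by
    simp only [Q0, huv, Fin.sum_univ_three, (by decide : (0 : Fin 3) + 1 = 1),
      (by decide : (1 : Fin 3) + 1 = 2), (by decide : (2 : Fin 3) + 1 = 0),
      (by decide : ¬(1 : Fin 3) = 0), (by decide : ¬(2 : Fin 3) = 0), if_true, if_false]
    norm_num
  rw [hQ] at e
  exact inv_injective (mul_right_cancel₀ two_ne_zero e)

theorem r0_eq {E : (D.K → ℝ) → (D.K → ℝ) → ℝ} {F : Set (D.K → ℝ)} {r : ℝ}
    (h : D.IsTraceConstant E F r) : D.r0 E F = r := by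
  have hex : ∃ r, D.IsTraceConstant E F r := ⟨r, h⟩
  rw [r0, dif_pos hex]
  exact hex.choose_spec.unique h

end SSGSetup

theorem mainTheorem9 (D : SSGSetup) (R : MatchingSeq) :
    D.IsSymmetricForm (D.linePart R) (D.lineDomain R) ∧
    D.IsTraceConstant (D.linePart R) (D.lineDomain R)
      (D.r0 (D.linePart R) (D.lineDomain R)) ∧
    Multipliable (fun m => 1 - R.ρ m) ∧
    D.r0 (D.linePart R) (D.lineDomain R) = 1 - ∏' m, (1 - R.ρ m) ∧
    HasSum (fun m => R.ρ m * ∏ i ∈ Finset.range m, (1 - R.ρ i))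
      (D.r0 (D.linePart R) (D.lineDomain R)) ∧
    (D.r0 (D.linePart R) (D.lineDomain R) < 1 ↔ Summable R.ρ) := by
  have h : D.IsTraceConstant (D.linePart R) (D.lineDomain R) R.resistance :=
    SSGSetup.isTraceConstant_resistance
  rw [SSGSetup.r0_eq h]
  exact ⟨SSGSetup.isSymmetricForm, h, R.multipliable, rfl, R.hasSum_mul_partialProd,
    R.resistance_lt_one_iff⟩
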